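/- **Setting.** Let $\Omega\subset\mathbb R^2$ be a rectangle, divided into at least two closed rectangular cells by a tensor-product grid $\mathcal T_h$ (not necessarily uniform), and let $k\ge 1$. Write $(\cdot,\cdot)$ and $\|\cdot\|$ for the $L^2(\Omega)$ inner product and norm, and set $$Y_h^m=\{v\in C^0(\overline\Omega): v|_K\in Q_m(K)\ \forall K\in\mathcal T_h\},\quad \mathbf X_h^k=\{\boldsymbol v\in Y_h^k\times Y_h^k:\boldsymbol v|_{\partial\Omega}=0\},\quad M_h^{k-1}=\{q\in Y_h^{k-1}:\textstyle\int_\Omega q\,dx=0\}.$$ The operator $B_h^T:M_h^{k-1}\to\mathbf X_h^k$ is defined by $(\boldsymbol v,B_h^Tq)=(\boldsymbol v,\nabla q)$ for all $\boldsymbol v\in\mathbf X_h^k$. Let $Z_0=\{x_i\}$ be the set of tensor products of the $k+1$ Gauss–Lobatto nodes on all cells, and let $(f,g)_h$ be the cellwise tensor-product Gauss–Lobatto quadrature of $fg$ (mass lumping). Put $b(\boldsymbol u,\boldsymbol v,\boldsymbol w)=\frac12\{(\boldsymbol u\cdot\nabla\boldsymbol v,\boldsymbol w)-(\boldsymbol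 u\cdot\nabla\boldsymbol w,\boldsymbol v)\}$ and $[s]=\max(-1,\min(1,s))$. The parameters satisfy $Re,We^*,\epsilon,\eta_1,\eta_2>0$ and $\theta_c>1$; the mobility $M$ is measurable with $0<m_1\le M\le m_2$ on $[-1,1]$; $\eta(s)=\frac{1-s}2+\frac{1+s}2\frac{\eta_2}{\eta_1}$. The potential is $F=F_v+F_n$ with $F_v(s)=\frac12[(1+s)\ln(1+s)+(1-s)\ln(1-s)]$, $F_n(s)=-\frac{\theta_c}2s^2$, $f_v=F_v'$ on $(-1,1)$ and $f_n=F_n'$. The quotient $\frac{F_v(s)-F_v(t)}{s-t}$ means $f_v(t)$ when $s=t$. Let $T,\delta t>0$ and $N_T=\lfloor T/\delta t\rfloor$. **Scheme.** Given $\phi_h^0\in Y_h^k$ and $\boldsymbol u_h^0\in\mathbf X_h^k$, the first step ($N_T\ge1$) seeks $\phi_h^1,\mu_h^1\in Y_h^k$, $\boldsymbol u_h^1\in\mathbf X_h^k$, $p_h^1\in M_h^{k-1}$ such that for all $v,\varphi\in Y_h^k$, $\boldsymbol v\in\mathbf X_h^k$, $q\in Y_h^{k-1}$ $$(\phi^1_h-\phi^0_h,v)_h+\delta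 t(M(\phi^0_h)\nabla\mu^1_h,\nabla v)-\delta t(\phi_h^0\boldsymbol u_h^0,\nabla v)=0,$$ $$(\mu_h^1,\varphi)_h=(f_v(\phi_h^1),\varphi)_h+(f_n(\phi_h^0),\varphi)+\epsilon^2(\nabla\phi_h^1,\nabla\varphi),$$ $$(\boldsymbol u^1_h-\boldsymbol u_h^0,\boldsymbol v)+\tfrac{\delta t}{Re}(\eta(\phi_h^0)\nabla\boldsymbol u^1_h,\nabla\boldsymbol v)+\delta t\,b(\boldsymbol u_h^0,\boldsymbol u_h^1,\boldsymbol v)=-\delta t(\nabla p_h^1,\boldsymbol v)-\tfrac{\delta t}{\epsilon We^*}(\phi_h^0\nabla\mu_h^1,\boldsymbol v),\qquad(\nabla\cdot\boldsymbol u_h^1,q)=0.$$ For $1\le n\le N_T-1$, with $\phi^{n+\frac12}=\frac{\phi^{n+1}+\phi^n}2$, $\widetilde\phi^{n+\frac12}=\frac{3\phi^n-\phi^{n-1}}2$, $\widetilde{\boldsymbol u}^{n+\frac12}=\frac{3\boldsymbol u^n-\boldsymbol u^{n-1}}2$ and $\overline{\boldsymbol u}^{n+\frac12}=\frac{\overline{\boldsymbol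 u}^{n+1}+\boldsymbol u^n}2$, one seeks $(\phi_h^{n+1},\mu_h^{n+\frac12},\overline{\boldsymbol u}_h^{n+\frac12},p_h^{n+1},\boldsymbol u_h^{n+1})\in Y_h^k\times Y_h^k\times\mathbf X_h^k\times M_h^{k-1}\times\mathbf X_h^k$ such that for all $v,\varphi\in Y_h^k$, $\boldsymbol v\in\mathbf X_h^k$, $q\in Y_h^{k-1}$ $$(\phi^{n+1}_h-\phi^n_h,v)_h+\delta t(M([\widetilde\phi_h^{n+\frac12}])\nabla\mu_h^{n+\frac12},\nabla v)-\delta t(\widetilde\phi_h^{n+\frac12}\overline{\boldsymbol u}_h^{n+\frac12},\nabla v)=0,$$ $$(\mu_h^{n+\frac12},\varphi)_h=\Big(\tfrac{F_v(\phi_h^{n+1})-F_v(\phi_h^n)}{\phi_h^{n+1}-\phi_h^n},\varphi\Big)_h+(f_n(\widetilde\phi_h^{n+\frac12}),\varphi)+\epsilon^2(\nabla\phi_h^{n+\frac12},\nabla\varphi)+\delta t(f_v(\phi_h^{n+1})-f_v(\phi_h^n),\varphi)_h,$$ $$(2\overline{\boldsymbol u}_h^{n+\frac12},\boldsymbol v)+\tfrac{\delta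 t}{Re}(\eta([\widetilde\phi_h^{n+\frac12}])\nabla\overline{\boldsymbol u}_h^{n+\frac12},\nabla\boldsymbol v)+\delta t\,b(\widetilde{\boldsymbol u}_h^{n+\frac12},\overline{\boldsymbol u}_h^{n+\frac12},\boldsymbol v)=-\delta t(\nabla p_h^n,\boldsymbol v)+(2\boldsymbol u_h^n,\boldsymbol v)-\tfrac{\delta t}{\epsilon We^*}(\widetilde\phi_h^{n+\frac12}\nabla\mu_h^{n+\frac12},\boldsymbol v),$$ $$(\boldsymbol u_h^{n+1}-\overline{\boldsymbol u}_h^{n+1},\boldsymbol v)+\tfrac{\delta t}2(\nabla(p_h^{n+1}-p_h^n),\boldsymbol v)+(\nabla\cdot\boldsymbol u_h^{n+1},q)=0.$$ **Theorem.** Assume $|\phi_h^0|\le1$ a.e. in $\Omega$ and $\frac1{|\Omega|}\int_\Omega\phi_h^0\,dx\in(-1,1)$. Then for every such grid and every $\delta t>0$ the scheme, started with the first-order step, has exactly one solution (up to time level $N_T$, in all the unknowns listed) such that $$|\phi_h^n(x_i)|<1\quad\forall x_i\in Z_0,\ n=1,\dots,N_T.$$ Furthermore, with $$E^n=\frac1{\epsilon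 We^*}\Big[(F_v(\phi_h^n),1)_h+(F_n(\phi_h^n),1)+\frac{\epsilon^2}2\|\nabla\phi_h^n\|^2+\frac{\theta_c}4\|\phi_h^n-\phi_h^{n-1}\|^2\Big]+\frac12\|\boldsymbol u_h^n\|^2+\frac{\delta t^2}8\|B_h^Tp_h^n\|^2,$$ this solution satisfies, for $1\le n\le N_T-1$, with $M=M([\widetilde\phi_h^{n+\frac12}])$ and $\eta=\eta([\widetilde\phi_h^{n+\frac12}])$, $$E^{n+1}+\frac{\delta t}{\epsilon We^*}\|\sqrt M\nabla\mu_h^{n+\frac12}\|^2+\frac{\delta t}{Re}\|\sqrt\eta\nabla\overline{\boldsymbol u}_h^{n+\frac12}\|^2\le E^n.$$ -/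

import Mathlib

open MeasureTheory Set

noncomputable section

namespace CHNS

/-! ### Rectangular grids -/

/-- A (not necessarily uniform) grid of closed rectangular cells covering a closed rectangle:
`x 0 < x 1 < ... < x nx` and `y 0 < y 1 < ... < y ny`. -/
structure RectGrid where
  nx : ℕ
  ny : ℕ
  nx_pos : 0 < nx
  ny_pos : 0 < ny
  x : Fin (nx + 1) → ℝ
  y : Fin (ny + 1) → ℝ
  x_mono : StrictMono x
  y_mono : StrictMono y

/-- The closed rectangular domain covered by the grid. -/
def RectGrid.dom (G : RectGrid) : Set (ℝ × ℝ) :=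
  Icc (G.x 0) (G.x (Fin.last G.nx)) ×ˢ Icc (G.y 0) (G.y (Fin.last G.ny))

/-- The closed cell with index `c`. -/
def RectGrid.cell (G : RectGrid) (c : Fin G.nx × Fin G.ny) : Set (ℝ × ℝ) :=
  Icc (G.x c.1.castSucc) (G.x c.1.succ) ×ˢ Icc (G.y c.2.castSucc) (G.y c.2.succ)

lemma RectGrid.isCompact_dom (G : RectGrid) : IsCompact G.dom :=
  isCompact_Icc.prod isCompact_Icc

lemma RectGrid.cell_subset (G : RectGrid) (c : Fin G.nx × Fin G.ny) : G.cell c ⊆ G.dom := by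
  apply Set.prod_mono
  · exact Icc_subset_Icc (G.x_mono.monotone (Fin.zero_le _)) (G.x_mono.monotone (Fin.le_last _))
  · exact Icc_subset_Icc (G.y_mono.monotone (Fin.zero_le _)) (G.y_mono.monotone (Fin.le_last _))

/-! ### Finite element spaces

A finite element function is represented by its extension by zero outside the closed domain, so
that two finite element functions are equal as soon as they agree on the domain. -/

/-- `Y_h^k`: continuous on the closed domain, and on every cell a polynomial of degree at most `k`
in each of the two variables. -/
def femSpace (G : RectGrid) (k : ℕ) : Submodule ℝ (ℝ × ℝ → ℝ) where
  carrier := {f | ContinuousOn f G.dom ∧ (∀ z, z ∉ G.dom → f z = 0) ∧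
    ∀ c, ∃ a : Fin (k + 1) → Fin (k + 1) → ℝ, ∀ z ∈ G.cell c,
      f z = ∑ i, ∑ j, a i j * (z.1 ^ (i : ℕ) * z.2 ^ (j : ℕ))}
  add_mem' := by
    rintro f g ⟨hf, hf0, hfp⟩ ⟨hg, hg0, hgp⟩
    refine ⟨hf.add hg, fun z hz => by simp [hf0 z hz, hg0 z hz], fun c => ?_⟩
    obtain ⟨a, ha⟩ := hfp c
    obtain ⟨b, hb⟩ := hgp c
    refine ⟨a + b, fun z hz => ?_⟩
    simp [ha z hz, hb z hz, add_mul, Finset.sum_add_distrib]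
  zero_mem' := ⟨continuousOn_const, fun _ _ => rfl, fun _ => ⟨0, by simp⟩⟩
  smul_mem' := by
    rintro r f ⟨hf, hf0, hfp⟩
    refine ⟨hf.const_smul r, fun z hz => by simp [hf0 z hz], fun c => ?_⟩
    obtain ⟨a, ha⟩ := hfp c
    refine ⟨r • a, fun z hz => ?_⟩
    simp [ha z hz, mul_assoc, Finset.mul_sum]

/-- `X_h^k`: pairs of functions in `Y_h^k` that vanish on the boundary of the domain. -/
def velSpace (G : RectGrid) (k : ℕ) : Submodule ℝ ((ℝ × ℝ → ℝ) × (ℝ × ℝ → ℝ)) where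
  carrier := {v | v.1 ∈ femSpace G k ∧ v.2 ∈ femSpace G k ∧
    ∀ z ∈ frontier G.dom, v.1 z = 0 ∧ v.2 z = 0}
  add_mem' := by
    rintro u v ⟨hu, hu', hu0⟩ ⟨hv, hv', hv0⟩
    refine ⟨add_mem hu hv, add_mem hu' hv', fun z hz => ?_⟩
    simp [hu0 z hz, hv0 z hz]
  zero_mem' := ⟨zero_mem _, zero_mem _, fun _ _ => ⟨rfl, rfl⟩⟩
  smul_mem' := by
    rintro r u ⟨hu, hu', hu0⟩
    refine ⟨Submodule.smul_mem _ r hu, Submodule.smul_mem _ r hu', fun z hz => ?_⟩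
    simp [hu0 z hz]

lemma integrableOn_of_mem_femSpace {G : RectGrid} {k : ℕ} {f : ℝ × ℝ → ℝ}
    (hf : f ∈ femSpace G k) : IntegrableOn f G.dom :=
  hf.1.integrableOn_compact G.isCompact_dom

/-- Functions in `Y_h^m` with integral zero; the pressure space `M_h^{k-1}` is the case
`m = k - 1`. -/
def meanZeroSpace (G : RectGrid) (m : ℕ) : Submodule ℝ (ℝ × ℝ → ℝ) where
  carrier := {q | q ∈ femSpace G m ∧ ∫ z in G.dom, q z = 0}
  add_mem' := by
    rintro p q ⟨hp, hp0⟩ ⟨hq, hq0⟩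
    refine ⟨add_mem hp hq, ?_⟩
    have := integral_add (integrableOn_of_mem_femSpace hp) (integrableOn_of_mem_femSpace hq)
    simpa [hp0, hq0] using this
  zero_mem' := ⟨zero_mem _, by simp⟩
  smul_mem' := by
    rintro r q ⟨hq, hq0⟩
    refine ⟨Submodule.smul_mem _ r hq, ?_⟩
    have := integral_const_mul (μ := volume.restrict G.dom) r q
    simpa [hq0] using this

/-! ### Integrals and differential operators

The derivatives of a finite element function exist in the interior of every cell, hence almost
everywhere in the domain. -/

/-- The `L²` inner product of scalar functions. -/
def ip (G : RectGrid) (f g : ℝ × ℝ → ℝ) : ℝ := ∫ z in G.dom, f z * g z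

/-- The `L²` inner product of vector fields. -/
def ipVec (G : RectGrid) (u v : (ℝ × ℝ → ℝ) × (ℝ × ℝ → ℝ)) : ℝ :=
  ip G u.1 v.1 + ip G u.2 v.2

/-- The gradient of a scalar function. -/
def grad (f : ℝ × ℝ → ℝ) : (ℝ × ℝ → ℝ) × (ℝ × ℝ → ℝ) :=
  (fun z => fderiv ℝ f z (1, 0), fun z => fderiv ℝ f z (0, 1))

/-- The divergence of a vector field. -/
def divg (v : (ℝ × ℝ → ℝ) × (ℝ × ℝ → ℝ)) : ℝ × ℝ → ℝ :=
  fun z => fderiv ℝ v.1 z (1, 0) + fderiv ℝ v.2 z (0, 1)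

/-- The product of a scalar function and a vector field. -/
def scal (a : ℝ × ℝ → ℝ) (v : (ℝ × ℝ → ℝ) × (ℝ × ℝ → ℝ)) : (ℝ × ℝ → ℝ) × (ℝ × ℝ → ℝ) :=
  (fun z => a z * v.1 z, fun z => a z * v.2 z)

/-- `(a ∇u, ∇v)` for vector fields `u`, `v` and a scalar coefficient `a`. -/
def ipGradVec (G : RectGrid) (a : ℝ × ℝ → ℝ) (u v : (ℝ × ℝ → ℝ) × (ℝ × ℝ → ℝ)) : ℝ :=
  ipVec G (scal a (grad u.1)) (grad v.1) + ipVec G (scal a (grad u.2)) (grad v.2)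

/-- The directional derivative `(u · ∇) v`. -/
def conv (u v : (ℝ × ℝ → ℝ) × (ℝ × ℝ → ℝ)) : (ℝ × ℝ → ℝ) × (ℝ × ℝ → ℝ) :=
  (fun z => u.1 z * (grad v.1).1 z + u.2 z * (grad v.1).2 z,
   fun z => u.1 z * (grad v.2).1 z + u.2 z * (grad v.2).2 z)

/-- The skew-symmetric trilinear form `b(u, v, w)`. -/
def triForm (G : RectGrid) (u v w : (ℝ × ℝ → ℝ) × (ℝ × ℝ → ℝ)) : ℝ :=
  (1 / 2) * (ipVec G (conv u v) w - ipVec G (conv u w) v)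

/-! ### Gauss-Lobatto quadrature and mass lumping -/

/-- The Gauss-Lobatto nodes of degree `k ≥ 1` on `[0, 1]`: the two endpoints and the zeros of the
derivative of the `k`-th Legendre polynomial (shifted to `[0, 1]`). -/
def glNodes (k : ℕ) : Finset ℝ :=
  insert 0 (insert 1
    (Polynomial.derivative
      ((Polynomial.shiftedLegendre k).map (Int.castRingHom ℝ))).roots.toFinset)

/-- The weight of the node `s`: the integral over `[0, 1]` of its Lagrange basis polynomial. -/
def glWeight (k : ℕ) (s : ℝ) : ℝ :=
  ∫ t in (0 : ℝ)..1, (Lagrange.basis (glNodes k) id s).eval t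

/-- The affine image in the cell `c` of the point `(s, t)` of the reference cell `[0, 1]²`. -/
def RectGrid.node (G : RectGrid) (c : Fin G.nx × Fin G.ny) (s t : ℝ) : ℝ × ℝ :=
  (G.x c.1.castSucc + s * (G.x c.1.succ - G.x c.1.castSucc),
   G.y c.2.castSucc + t * (G.y c.2.succ - G.y c.2.castSucc))

/-- The area of the cell `c`. -/
def RectGrid.cellArea (G : RectGrid) (c : Fin G.nx × Fin G.ny) : ℝ :=
  (G.x c.1.succ - G.x c.1.castSucc) * (G.y c.2.succ - G.y c.2.castSucc)

/-- The set `Z₀` of the tensor product Gauss-Lobatto nodes of all cells. -/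
def RectGrid.nodes (G : RectGrid) (k : ℕ) : Set (ℝ × ℝ) :=
  {z | ∃ c, ∃ s ∈ glNodes k, ∃ t ∈ glNodes k, z = G.node c s t}

/-- The mass-lumped inner product `(f, g)_h`. -/
def lumped (G : RectGrid) (k : ℕ) (f g : ℝ × ℝ → ℝ) : ℝ :=
  ∑ c, ∑ s ∈ glNodes k, ∑ t ∈ glNodes k,
    (G.cellArea c * glWeight k s * glWeight k t) * (f (G.node c s t) * g (G.node c s t))

/-! ### The discrete gradient operator -/

lemma exists_mem_Icc_succ {n : ℕ} (x : Fin (n + 1) → ℝ) (hn : 0 < n) {t : ℝ}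
    (h0 : x 0 ≤ t) (h1 : t ≤ x (Fin.last n)) :
    ∃ i : Fin n, t ∈ Icc (x i.castSucc) (x i.succ) := by
  induction n with
  | zero => omega
  | succ n ih =>
    by_cases h : x (Fin.last n).castSucc ≤ t
    · exact ⟨Fin.last n, h, by simpa using h1⟩
    · push Not at h
      rcases Nat.eq_zero_or_pos n with rfl | hn'
      · exact absurd h0 (not_le.mpr h)
      · obtain ⟨i, hi⟩ := ih (fun j => x j.castSucc) hn' h0 h.le
        exact ⟨i.castSucc, hi⟩

lemma RectGrid.dom_eq_iUnion (G : RectGrid) : G.dom = ⋃ c, G.cell c := by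
  apply Subset.antisymm
  · rintro z ⟨⟨h1, h2⟩, h3, h4⟩
    obtain ⟨i, hi⟩ := exists_mem_Icc_succ G.x G.nx_pos h1 h2
    obtain ⟨j, hj⟩ := exists_mem_Icc_succ G.y G.ny_pos h3 h4
    exact mem_iUnion.mpr ⟨(i, j), hi, hj⟩
  · exact iUnion_subset G.cell_subset

lemma fderiv_mul_integrableOn {G : RectGrid} {m : ℕ} {q g : ℝ × ℝ → ℝ}
    (hq : q ∈ femSpace G m) (hg : ContinuousOn g G.dom) (e : ℝ × ℝ) :
    IntegrableOn (fun z => g z * fderiv ℝ q z e) G.dom := by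
  rw [G.dom_eq_iUnion, integrableOn_finite_iUnion]
  intro c
  obtain ⟨a, ha⟩ := hq.2.2 c
  set P : ℝ × ℝ → ℝ := fun z => ∑ i, ∑ j, a i j * (z.1 ^ (i : ℕ) * z.2 ^ (j : ℕ)) with hP
  have hPs : ContDiff ℝ 1 P := by
    rw [hP]; fun_prop
  set U := Ioo (G.x c.1.castSucc) (G.x c.1.succ) ×ˢ Ioo (G.y c.2.castSucc) (G.y c.2.succ) with hU
  have hae : U =ᵐ[volume] G.cell c :=
    Measure.set_prod_ae_eq Ioo_ae_eq_Icc Ioo_ae_eq_Icc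
  have hUc : U ⊆ G.cell c := Set.prod_mono Ioo_subset_Icc_self Ioo_subset_Icc_self
  have hUo : IsOpen U := isOpen_Ioo.prod isOpen_Ioo
  have hI : IntegrableOn (fun z => g z * fderiv ℝ P z e) (G.cell c) := by
    apply ContinuousOn.integrableOn_compact (isCompact_Icc.prod isCompact_Icc)
    apply (hg.mono (G.cell_subset c)).mul
    exact ((hPs.continuous_fderiv one_ne_zero).clm_apply continuous_const).continuousOn
  refine (IntegrableOn.congr_fun (hI.mono_set hUc) ?_ hUo.measurableSet).congr_set_ae hae.symm
  intro z hz
  have : q =ᶠ[nhds z] P := by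
    filter_upwards [hUo.mem_nhds hz] with w hw
    exact ha w (hUc hw)
  simp only [this.fderiv_eq]

instance finiteDimensional_femSpace (G : RectGrid) (k : ℕ) :
    FiniteDimensional ℝ (femSpace G k) := by
  let W : (Fin G.nx × Fin G.ny) → Submodule ℝ (ℝ × ℝ → ℝ) := fun c =>
    Submodule.span ℝ (Set.range fun ij : Fin (k + 1) × Fin (k + 1) =>
      (G.cell c).indicator fun z : ℝ × ℝ => z.1 ^ (ij.1 : ℕ) * z.2 ^ (ij.2 : ℕ))
  have hfd : ∀ c, FiniteDimensional ℝ (W c) := fun c =>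
    FiniteDimensional.span_of_finite ℝ (Set.finite_range _)
  let Φ : femSpace G k →ₗ[ℝ] ((c : Fin G.nx × Fin G.ny) → W c) :=
    { toFun := fun f c => ⟨(G.cell c).indicator f.1, by
        obtain ⟨a, ha⟩ := f.2.2.2 c
        have : (G.cell c).indicator f.1 = ∑ i, ∑ j, a i j •
            ((G.cell c).indicator fun z : ℝ × ℝ => z.1 ^ (i : ℕ) * z.2 ^ (j : ℕ)) := by
          ext z
          by_cases hz : z ∈ G.cell c
          · simp [hz, ha z hz]
          · simp [hz]
        rw [this]
        exact Submodule.sum_mem _ fun i _ => Submodule.sum_mem _ fun j _ =>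
          Submodule.smul_mem _ _ (Submodule.subset_span ⟨(i, j), rfl⟩)⟩
      map_add' := by
        intro f g
        ext c z
        by_cases hz : z ∈ G.cell c <;> simp [hz]
      map_smul' := by
        intro r f
        ext c z
        by_cases hz : z ∈ G.cell c <;> simp [hz] }
  apply Module.Finite.of_injective Φ
  intro f g hfg
  ext z
  by_cases hz : z ∈ G.dom
  · rw [G.dom_eq_iUnion] at hz
    obtain ⟨c, hc⟩ := mem_iUnion.mp hz
    have := congrFun (congrArg Subtype.val (congrFun hfg c)) z
    simpa [Φ, hc] using this
  · rw [f.2.2.1 z hz, g.2.2.1 z hz]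

instance finiteDimensional_velSpace (G : RectGrid) (k : ℕ) :
    FiniteDimensional ℝ (velSpace G k) := by
  let Φ : velSpace G k →ₗ[ℝ] femSpace G k × femSpace G k :=
    { toFun := fun v => (⟨v.1.1, v.2.1⟩, ⟨v.1.2, v.2.2.1⟩)
      map_add' := fun _ _ => rfl
      map_smul' := fun _ _ => rfl }
  apply Module.Finite.of_injective Φ
  intro u v huv
  have h1 : u.1.1 = v.1.1 := congrArg (fun p => (p.1 : ℝ × ℝ → ℝ)) huv
  have h2 : u.1.2 = v.1.2 := congrArg (fun p => (p.2 : ℝ × ℝ → ℝ)) huv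
  exact Subtype.ext (Prod.ext h1 h2)

lemma eq_zero_of_ip_self {G : RectGrid} {k : ℕ} {f : ℝ × ℝ → ℝ} (hf : f ∈ femSpace G k)
    (h : ip G f f = 0) : f = 0 := by
  have hc : ContinuousOn (fun z => f z * f z) G.dom := hf.1.mul hf.1
  have hint : IntegrableOn (fun z => f z * f z) G.dom := hc.integrableOn_compact G.isCompact_dom
  have h0 := (integral_eq_zero_iff_of_nonneg (fun z => mul_self_nonneg (f z)) hint).mp h
  have hcl : G.dom ⊆ closure (interior G.dom) := by
    have hx : G.x 0 ≠ G.x (Fin.last G.nx) := (G.x_mono.injective.ne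
      (by have := G.nx_pos; simp [Fin.ext_iff]; omega))
    have hy : G.y 0 ≠ G.y (Fin.last G.ny) := (G.y_mono.injective.ne
      (by have := G.ny_pos; simp [Fin.ext_iff]; omega))
    rw [RectGrid.dom, interior_prod_eq, interior_Icc, interior_Icc, closure_prod_eq,
      closure_Ioo hx, closure_Ioo hy]
  have := Measure.eqOn_of_ae_eq h0 hc continuousOn_const hcl
  ext z
  by_cases hz : z ∈ G.dom
  · simpa using this hz
  · exact hf.2.1 z hz

lemma ip_self_nonneg (G : RectGrid) (f : ℝ × ℝ → ℝ) : 0 ≤ ip G f f :=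
  integral_nonneg fun z => mul_self_nonneg (f z)

/-- The discrete gradient of `q` exists: the linear functional `v ↦ (v, ∇q)` on `X_h^k` is
represented by an element of `X_h^k`. -/
theorem exists_discreteGrad (G : RectGrid) (k m : ℕ) (q : femSpace G m) :
    ∃ w : velSpace G k, ∀ v : velSpace G k, ipVec G v.1 w.1 = ipVec G v.1 (grad q.1) := by
  have hadd : ∀ {f₁ f₂ g : ℝ × ℝ → ℝ}, IntegrableOn (fun z => f₁ z * g z) G.dom →
      IntegrableOn (fun z => f₂ z * g z) G.dom → ip G (f₁ + f₂) g = ip G f₁ g + ip G f₂ g := by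
    intro f₁ f₂ g h₁ h₂
    simp only [ip, Pi.add_apply, add_mul]
    exact integral_add h₁ h₂
  have hsmul : ∀ (r : ℝ) (f g : ℝ × ℝ → ℝ), ip G (r • f) g = r * ip G f g := by
    intro r f g
    simp only [ip, Pi.smul_apply, smul_eq_mul, mul_assoc]
    exact integral_const_mul r _
  have hcomm : ∀ f g : ℝ × ℝ → ℝ, ip G f g = ip G g f := by
    intro f g
    simp only [ip, mul_comm]
  have hff : ∀ {f g : ℝ × ℝ → ℝ}, f ∈ femSpace G k → g ∈ femSpace G k →
      IntegrableOn (fun z => f z * g z) G.dom := fun hf hg =>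
    (hf.1.mul hg.1).integrableOn_compact G.isCompact_dom
  let A : velSpace G k →ₗ[ℝ] Module.Dual ℝ (velSpace G k) := LinearMap.mk₂ ℝ
    (fun w v => ipVec G v.1 w.1)
    (by
      intro w₁ w₂ v
      simp only [ipVec, Submodule.coe_add, Prod.fst_add, Prod.snd_add]
      rw [hcomm v.1.1, hcomm v.1.2, hadd (hff w₁.2.1 v.2.1) (hff w₂.2.1 v.2.1),
        hadd (hff w₁.2.2.1 v.2.2.1) (hff w₂.2.2.1 v.2.2.1), hcomm v.1.1, hcomm v.1.1,
        hcomm v.1.2, hcomm v.1.2]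
      ring)
    (by
      intro r w v
      simp only [ipVec, Submodule.coe_smul, Prod.smul_fst, Prod.smul_snd, smul_eq_mul]
      rw [hcomm v.1.1, hcomm v.1.2, hsmul, hsmul, hcomm v.1.1, hcomm v.1.2]
      ring)
    (by
      intro w v₁ v₂
      simp only [ipVec, Submodule.coe_add, Prod.fst_add, Prod.snd_add]
      rw [hadd (hff v₁.2.1 w.2.1) (hff v₂.2.1 w.2.1),
        hadd (hff v₁.2.2.1 w.2.2.1) (hff v₂.2.2.1 w.2.2.1)]
      ring)
    (by
      intro r w v
      simp only [ipVec, Submodule.coe_smul, Prod.smul_fst, Prod.smul_snd, smul_eq_mul, hsmul]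
      ring)
  let ℓ : Module.Dual ℝ (velSpace G k) :=
    { toFun := fun v => ipVec G v.1 (grad q.1)
      map_add' := by
        intro u v
        simp only [ipVec, Submodule.coe_add, Prod.fst_add, Prod.snd_add]
        rw [hadd (g := (grad q.1).1) (fderiv_mul_integrableOn q.2 u.2.1.1 _)
            (fderiv_mul_integrableOn q.2 v.2.1.1 _),
          hadd (g := (grad q.1).2) (fderiv_mul_integrableOn q.2 u.2.2.1.1 _)
            (fderiv_mul_integrableOn q.2 v.2.2.1.1 _)]
        ring
      map_smul' := by
        intro r v
        simp only [ipVec, Submodule.coe_smul, Prod.smul_fst, Prod.smul_snd, hsmul,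
          RingHom.id_apply, smul_eq_mul]
        ring }
  have hinj : Function.Injective A := by
    rw [injective_iff_map_eq_zero]
    intro w hw
    have h : ipVec G w.1 w.1 = 0 := congrArg (fun L => L w) hw
    have h1 := ip_self_nonneg G w.1.1
    have h2 := ip_self_nonneg G w.1.2
    simp only [ipVec] at h
    exact Subtype.ext (Prod.ext (eq_zero_of_ip_self w.2.1 (by linarith))
      (eq_zero_of_ip_self w.2.2.1 (by linarith)))
  obtain ⟨w, hw⟩ := (LinearMap.injective_iff_surjective_of_finrank_eq_finrank
    Subspace.dual_finrank_eq.symm).mp hinj ℓ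
  exact ⟨w, fun v => congrArg (fun L => L v) hw⟩

/-- The discrete gradient operator `B_h^T`, from mean-zero functions in `Y_h^m` to `X_h^k`; it is
characterized by `discreteGrad_spec`. -/
def discreteGrad (G : RectGrid) (k : ℕ) {m : ℕ} (q : meanZeroSpace G m) : velSpace G k :=
  Classical.choose (exists_discreteGrad G k m ⟨q.1, q.2.1⟩)

/-- The defining relation `(v, B_h^T q) = (v, ∇q)` for all `v` in `X_h^k`. -/
theorem discreteGrad_spec (G : RectGrid) (k : ℕ) {m : ℕ} (q : meanZeroSpace G m)
    (v : velSpace G k) :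
    ipVec G v.1 (discreteGrad G k q).1 = ipVec G v.1 (grad q.1) :=
  Classical.choose_spec (exists_discreteGrad G k m ⟨q.1, q.2.1⟩) v

/-! ### Physical parameters and the Flory-Huggins potential -/

/-- The parameters of the Cahn-Hilliard-Navier-Stokes system: Reynolds number, modified Weber
number, interface width, relative critical temperature, the two viscosities, and the mobility
function with its lower and upper bounds on `[-1, 1]`. -/
structure Params where
  Re : ℝ
  We : ℝ
  ε : ℝ
  θc : ℝ
  η₁ : ℝ
  η₂ : ℝ
  M : ℝ → ℝ
  m₁ : ℝ
  m₂ : ℝ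
  Re_pos : 0 < Re
  We_pos : 0 < We
  ε_pos : 0 < ε
  one_lt_θc : 1 < θc
  η₁_pos : 0 < η₁
  η₂_pos : 0 < η₂
  M_meas : Measurable M
  m₁_pos : 0 < m₁
  M_bounds : ∀ s ∈ Icc (-1 : ℝ) 1, m₁ ≤ M s ∧ M s ≤ m₂

/-- The dimensionless viscosity `η(s)`. -/
def Params.η (P : Params) (s : ℝ) : ℝ := (1 - s) / 2 + (1 + s) / 2 * (P.η₂ / P.η₁)

/-- The convex part `F_v` of the potential, used for `s ∈ [-1, 1]`
(the convention `0 * log 0 = 0` gives the continuous values at `±1`). -/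
def Fv (s : ℝ) : ℝ := (1 / 2) * ((1 + s) * Real.log (1 + s) + (1 - s) * Real.log (1 - s))

/-- The derivative `f_v` of `F_v`, meaningful only for `s ∈ (-1, 1)`. -/
def fv (s : ℝ) : ℝ := (1 / 2) * (Real.log (1 + s) - Real.log (1 - s))

/-- The concave part `F_n` of the potential; the Flory-Huggins potential is `F = F_v + F_n`. -/
def Params.Fn (P : Params) (s : ℝ) : ℝ := -(P.θc / 2) * s ^ 2

/-- The derivative `f_n` of `F_n`. -/
def Params.fn (P : Params) (s : ℝ) : ℝ := -P.θc * s

/-- The difference quotient `(F_v(s) - F_v(t)) / (s - t)`, with its limit value `f_v(t)` when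
`s = t`. -/
def quotFv (s t : ℝ) : ℝ := if s = t then fv t else (Fv s - Fv t) / (s - t)

/-- The truncation `[s]` to the interval `[-1, 1]`. -/
def trunc (s : ℝ) : ℝ := max (-1) (min 1 s)

/-! ### The scheme -/

/-- One step of the first-order scheme, from `φ⁰, u⁰` to `φ¹, μ¹, u¹, p¹`. -/
structure FirstOrderStep (P : Params) (G : RectGrid) (k : ℕ) (δt : ℝ)
    (φ₀ : femSpace G k) (u₀ : velSpace G k)
    (φ₁ μ₁ : femSpace G k) (u₁ : velSpace G k) (p₁ : meanZeroSpace G (k - 1)) : Prop where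
  phase : ∀ v : femSpace G k,
    lumped G k (φ₁.1 - φ₀.1) v.1
      + δt * ipVec G (scal (fun z => P.M (φ₀.1 z)) (grad μ₁.1)) (grad v.1)
      - δt * ipVec G (scal φ₀.1 u₀.1) (grad v.1) = 0
  chem : ∀ ψ : femSpace G k,
    lumped G k μ₁.1 ψ.1 =
      lumped G k (fun z => fv (φ₁.1 z)) ψ.1
        + ip G (fun z => P.fn (φ₀.1 z)) ψ.1
        + P.ε ^ 2 * ipVec G (grad φ₁.1) (grad ψ.1)
  momentum : ∀ v : velSpace G k,
    ipVec G (u₁.1 - u₀.1) v.1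
      + δt / P.Re * ipGradVec G (fun z => P.η (φ₀.1 z)) u₁.1 v.1
      + δt * triForm G u₀.1 u₁.1 v.1 =
    -δt * ipVec G (grad p₁.1) v.1
      - δt * (P.ε⁻¹ / P.We) * ipVec G (scal φ₀.1 (grad μ₁.1)) v.1
  incompressible : ∀ q : femSpace G (k - 1), ip G (divg u₁.1) q.1 = 0

/-- The extrapolation `(3 aⁿ - aⁿ⁻¹) / 2`; the arguments are `aⁿ⁻¹` and `aⁿ`. -/
def extrap {V : Type*} [AddCommGroup V] [Module ℝ V] (a' a : V) : V :=
  (1 / 2 : ℝ) • ((3 : ℝ) • a - a')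

/-- One step of the second-order scheme. The data are `φ' = φⁿ⁻¹`, `φ = φⁿ`, `u' = uⁿ⁻¹`,
`u = uⁿ`, `p = pⁿ`; the unknowns are `φ₁ = φⁿ⁺¹`, `μ = μ^{n+1/2}`, `ubar = ū^{n+1/2}`,
`p₁ = pⁿ⁺¹`, `u₁ = uⁿ⁺¹`. Since `ū^{n+1/2} = (ūⁿ⁺¹ + uⁿ) / 2`, the intermediate velocity `ūⁿ⁺¹`
is `2 ubar - u`. -/
structure SecondOrderStep (P : Params) (G : RectGrid) (k : ℕ) (δt : ℝ)
    (φ' φ : femSpace G k) (u' u : velSpace G k) (p : meanZeroSpace G (k - 1))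
    (φ₁ μ : femSpace G k) (ubar : velSpace G k) (p₁ : meanZeroSpace G (k - 1))
    (u₁ : velSpace G k) : Prop where
  phase : ∀ v : femSpace G k,
    lumped G k (φ₁.1 - φ.1) v.1
      + δt * ipVec G (scal (fun z => P.M (trunc ((extrap φ' φ).1 z))) (grad μ.1)) (grad v.1)
      - δt * ipVec G (scal (extrap φ' φ).1 ubar.1) (grad v.1) = 0
  chem : ∀ ψ : femSpace G k,
    lumped G k μ.1 ψ.1 =
      lumped G k (fun z => quotFv (φ₁.1 z) (φ.1 z)) ψ.1
        + ip G (fun z => P.fn ((extrap φ' φ).1 z)) ψ.1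
        + P.ε ^ 2 * ipVec G (grad ((1 / 2 : ℝ) • (φ₁ + φ)).1) (grad ψ.1)
        + δt * lumped G k (fun z => fv (φ₁.1 z) - fv (φ.1 z)) ψ.1
  momentum : ∀ v : velSpace G k,
    ipVec G ((2 : ℝ) • ubar.1) v.1
      + δt / P.Re * ipGradVec G (fun z => P.η (trunc ((extrap φ' φ).1 z))) ubar.1 v.1
      + δt * triForm G (extrap u' u).1 ubar.1 v.1 =
    -δt * ipVec G (grad p.1) v.1
      + ipVec G ((2 : ℝ) • u.1) v.1
      - δt * (P.ε⁻¹ / P.We) * ipVec G (scal (extrap φ' φ).1 (grad μ.1)) v.1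
  projection : ∀ (v : velSpace G k) (q : femSpace G (k - 1)),
    ipVec G (u₁.1 - ((2 : ℝ) • ubar.1 - u.1)) v.1
      + δt / 2 * ipVec G (grad (p₁ - p).1) v.1
      + ip G (divg u₁.1) q.1 = 0

/-- A discrete trajectory: `φ n = φⁿ` and `u n = uⁿ` for `n ≥ 0`, `p n = pⁿ` for `n ≥ 1`;
`μ 0 = μ¹` is the chemical potential of the first-order step, and `μ n = μ^{n+1/2}`,
`ubar n = ū^{n+1/2}` for `n ≥ 1`. Values at other indices are irrelevant. -/
structure Trajectory (G : RectGrid) (k : ℕ) where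
  φ : ℕ → femSpace G k
  μ : ℕ → femSpace G k
  ubar : ℕ → velSpace G k
  p : ℕ → meanZeroSpace G (k - 1)
  u : ℕ → velSpace G k

/-- `S` solves the scheme up to time level `N`: it starts from `φ⁰, u⁰`, its first step is
a step of the first-order scheme, all further steps are steps of the second-order scheme. -/
structure Trajectory.Solves {G : RectGrid} {k : ℕ} (S : Trajectory G k) (P : Params) (δt : ℝ)
    (N : ℕ) (φ₀ : femSpace G k) (u₀ : velSpace G k) : Prop where
  init_φ : S.φ 0 = φ₀
  init_u : S.u 0 = u₀
  first : 1 ≤ N → FirstOrderStep P G k δt (S.φ 0) (S.u 0) (S.φ 1) (S.μ 0) (S.u 1) (S.p 1)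
  second : ∀ n, 1 ≤ n → n + 1 ≤ N →
    SecondOrderStep P G k δt (S.φ (n - 1)) (S.φ n) (S.u (n - 1)) (S.u n) (S.p n)
      (S.φ (n + 1)) (S.μ n) (S.ubar n) (S.p (n + 1)) (S.u (n + 1))

/-- `|φⁿ(x_i)| < 1` at all Gauss-Lobatto nodes, for `n = 1, ..., N`. -/
def Trajectory.BoundPreserving {G : RectGrid} {k : ℕ} (S : Trajectory G k) (N : ℕ) : Prop :=
  ∀ n, 1 ≤ n → n ≤ N → ∀ z ∈ G.nodes k, |(S.φ n).1 z| < 1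

/-- Two trajectories agree in all the quantities that the scheme determines up to level `N`. -/
structure Trajectory.AgreeUpTo {G : RectGrid} {k : ℕ} (S S' : Trajectory G k) (N : ℕ) : Prop where
  φ : ∀ n, n ≤ N → S.φ n = S'.φ n
  u : ∀ n, n ≤ N → S.u n = S'.u n
  p : ∀ n, 1 ≤ n → n ≤ N → S.p n = S'.p n
  μ : ∀ n, n + 1 ≤ N → S.μ n = S'.μ n
  ubar : ∀ n, 1 ≤ n → n + 1 ≤ N → S.ubar n = S'.ubar n

/-- The modified energy `Eⁿ`, for `n ≥ 1`. The convex part of the potential is integrated with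
mass lumping and the concave part exactly, as in the scheme. -/
def Trajectory.energy {G : RectGrid} {k : ℕ} (S : Trajectory G k) (P : Params) (δt : ℝ)
    (n : ℕ) : ℝ :=
  1 / (P.ε * P.We) *
      (lumped G k (fun z => Fv ((S.φ n).1 z)) (fun _ => 1)
        + ip G (fun z => P.Fn ((S.φ n).1 z)) (fun _ => 1)
        + P.ε ^ 2 / 2 * ipVec G (grad (S.φ n).1) (grad (S.φ n).1)
        + P.θc / 4 * ip G (S.φ n - S.φ (n - 1)).1 (S.φ n - S.φ (n - 1)).1)
    + 1 / 2 * ipVec G (S.u n).1 (S.u n).1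
    + δt ^ 2 / 8 * ipVec G (discreteGrad G k (S.p n)).1 (discreteGrad G k (S.p n)).1

/-- The energy dissipated in the step from `n` to `n + 1`, for `n ≥ 1`:
`δt / (ε We) ‖√M ∇μ^{n+1/2}‖² + δt / Re ‖√η ∇ū^{n+1/2}‖²`, with `M` and `η` evaluated at the
truncated extrapolated phase variable. -/
def Trajectory.dissipation {G : RectGrid} {k : ℕ} (S : Trajectory G k) (P : Params) (δt : ℝ)
    (n : ℕ) : ℝ :=
  let φt : ℝ × ℝ → ℝ := fun z => trunc ((extrap (S.φ (n - 1)) (S.φ n)).1 z)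
  δt / (P.ε * P.We) *
      ipVec G (scal (fun z => Real.sqrt (P.M (φt z))) (grad (S.μ n).1))
        (scal (fun z => Real.sqrt (P.M (φt z))) (grad (S.μ n).1))
    + δt / P.Re * ipGradVec G (fun z => P.η (φt z)) (S.ubar n).1 (S.ubar n).1

end CHNS

end

/-!
Each time step decouples into two finite-dimensional systems, and both are uniquely solvable.

**Phase variable, chemical potential and intermediate velocity.** (In the first-order step the phase
equation contains only the given velocity, and this system consists of its first two equations.)
Testing the phase equation with `μ`, the equation of the chemical potential with the new phase
variable and the momentum equation with the velocity, all coupling terms cancel: the transport terms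
are adjoint to each other, the convection form is skew, and `(φ₁, μ)_h` occurs in both of the first
two equations. What remains is a positive definite bilinear form, once the mean values of `φ₁` and
`μ` have been split off, together with the values at the nodes of a nonlinearity that increases on
`(-1, 1)`. This nonlinearity blows up at `±1`: it is `f_v` itself in the first-order step, while in
the second-order step the difference quotient of `F_v` stays bounded and the stabilizing term
`δt (f_v(φ₁) - f_v(φ))` supplies the singularity (`isBarrier_fv`, `isBarrier_quotFv`). Uniqueness is
monotonicity. For existence the nonlinearity is frozen outside `[-r, r]`, which leaves a strongly
monotone Lipschitz equation; since the conserved mean value of the phase variable lies in `(-1, 1)`,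
testing with the solution bounds the nonlinearity uniformly in `r`, and for `r` close to `1` no node
lies beyond the cut-off (`existsUnique_of_isBarrier`, `existsUnique_cahnHilliard`). Positivity of
the Gauss-Lobatto weights is essential here, and so is the exactness of the quadrature on `Y_h^k`,
which transfers the condition on the initial mean value to the nodes; both follow from the
orthogonality of the derivatives of Legendre polynomials (`unitInt_eq_sum`, `glWeight_pos`).

**Velocity and pressure.** In the first-order step the momentum equation, and in the second-order
step the projection, is a saddle point problem with a definite form for the velocity. It is uniquely
solvable as soon as `B_h^T` is injective on mean-zero pressures, a qualitative inf-sup condition for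
continuous `Q_k`-`Q_{k-1}` elements (`eq_zero_of_transForm_eq_zero`). For `k = 1` a continuous
piecewise constant function is constant; for `k ≥ 2`, `∇q` is tested with tensor products of
one-dimensional bubbles. The product of `∂ₓ q` with a test function has degree at most `2 k - 1` in
`x` in each cell, so it is integrated exactly by Gauss-Lobatto quadrature, and a bubble that
vanishes at all nodes but one isolates the values of `∂ₓ q` on one vertical line. Repeating this in
`y` shows that `q` is constant in each cell along sufficiently many horizontal and vertical lines,
hence on every cell. This needs a grid line in the interior of the domain, which is why at least two
cells are required.

**Energy law.** The same test functions are used, with `φⁿ⁺¹ - φⁿ` in the equation of the chemical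
potential. The difference quotient produces the exact increment of `F_v`, the stabilizing term has a
sign, and the error of the extrapolation in the concave part is absorbed by `θ_c / 4 ‖φⁿ - φⁿ⁻¹‖²`
(`phaseEnergy_sub_le`). The projection step amounts to
`2 ū^{n+1/2} = uⁿ⁺¹ + uⁿ + δt / 2 (B_h^T pⁿ⁺¹ - B_h^T pⁿ)`, and since `uⁿ` and `uⁿ⁺¹` are
orthogonal to the range of `B_h^T`, the kinetic energy and the pressure terms combine to the exact
increment of the last two terms of `Eⁿ` (`SecondOrderForms.kinetic_identity`).
-/

namespace CHNS

/-! ### Gauss-Lobatto quadrature in one dimension -/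

section GaussLobatto

open Polynomial

/-- The linear functional `p ↦ ∫₀¹ p`. -/
noncomputable def unitInt : ℝ[X] →ₗ[ℝ] ℝ where
  toFun p := ∫ t in (0 : ℝ)..1, p.eval t
  map_add' p q := by
    simp only [eval_add]
    exact intervalIntegral.integral_add (p.continuous.intervalIntegrable _ _)
      (q.continuous.intervalIntegrable _ _)
  map_smul' r p := by simp

lemma unitInt_apply (p : ℝ[X]) : unitInt p = ∫ t in (0 : ℝ)..1, p.eval t := rfl

lemma unitInt_derivative (p : ℝ[X]) : unitInt (derivative p) = p.eval 1 - p.eval 0 :=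
  intervalIntegral.integral_eq_sub_of_hasDerivAt (fun t _ => p.hasDerivAt t)
    ((derivative p).continuous.intervalIntegrable _ _)

lemma unitInt_derivative_mul (p q : ℝ[X]) (h0 : p.eval 0 * q.eval 0 = 0)
    (h1 : p.eval 1 * q.eval 1 = 0) :
    unitInt (derivative p * q) = -unitInt (p * derivative q) := by
  have h := unitInt_derivative (p * q)
  rw [derivative_mul, map_add, eval_mul, eval_mul, h0, h1] at h
  linarith

lemma unitInt_pos {p : ℝ[X]} (hp : p ≠ 0) (h : ∀ t ∈ Icc (0 : ℝ) 1, 0 ≤ p.eval t) :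
    0 < unitInt p := by
  refine intervalIntegral.integral_pos zero_lt_one p.continuous.continuousOn
    (fun x hx => h x (Ioc_subset_Icc_self hx)) ?_
  by_contra! hc
  refine hp (p.eq_zero_of_infinite_isRoot ((Icc_infinite (zero_lt_one (α := ℝ))).mono ?_))
  exact fun t ht => le_antisymm (hc t ht) (h t ht)

/-- The shifted Legendre polynomial over the reals. -/
noncomputable def legendre (k : ℕ) : ℝ[X] := (shiftedLegendre k).map (Int.castRingHom ℝ)

lemma rodrigues (k : ℕ) :
    C ((k.factorial : ℕ) : ℝ) * legendre k = derivative^[k] ((X * (1 - X)) ^ k) := by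
  have h := congrArg (Polynomial.map (Int.castRingHom ℝ)) (factorial_mul_shiftedLegendre_eq k)
  rw [← iterate_derivative_map] at h
  simpa [legendre, mul_pow] using h

lemma unitInt_iterate_derivative_mul (k : ℕ) {j : ℕ} (hj : j ≤ k) {p : ℝ[X]}
    (hp : p.degree < j) :
    unitInt (derivative^[j] ((X * (1 - X)) ^ k) * p) = 0 := by
  induction j generalizing p with
  | zero =>
    have : p = 0 := by simpa [Polynomial.degree_lt_iff_coeff_zero, Polynomial.ext_iff] using hp
    simp [this]
  | succ j ih =>
    have hdvd := pow_sub_dvd_iterate_derivative_of_pow_dvd j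
      (dvd_refl ((X * (1 - X) : ℝ[X]) ^ k))
    obtain ⟨g, hg⟩ := (dvd_pow_self (X * (1 - X) : ℝ[X]) (by omega : k - j ≠ 0)).trans hdvd
    rw [Function.iterate_succ_apply', unitInt_derivative_mul, ih (by omega), neg_zero]
    · by_cases h0 : p = 0
      · simp [h0]
      · have h1 := degree_derivative_lt h0
        rw [degree_eq_natDegree h0] at hp h1
        refine lt_of_lt_of_le h1 ?_
        exact_mod_cast Nat.le_of_lt_succ (by exact_mod_cast hp)
    · rw [hg]; simp
    · rw [hg]; simp

/-- The Legendre polynomial of degree `k` is orthogonal to all polynomials of smaller degree. -/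
lemma unitInt_legendre_mul (k : ℕ) {p : ℝ[X]} (hp : p.degree < k) :
    unitInt (legendre k * p) = 0 := by
  have h := unitInt_iterate_derivative_mul k le_rfl hp
  rw [← rodrigues, mul_assoc, ← smul_eq_C_mul, map_smul, smul_eq_mul] at h
  exact (mul_eq_zero.mp h).resolve_left (by positivity)

lemma natDegree_legendre (k : ℕ) : (legendre k).natDegree = k := by
  rw [legendre, natDegree_map_eq_of_injective Int.cast_injective, natDegree_shiftedLegendre]

lemma natDegree_derivative_legendre (k : ℕ) : (derivative (legendre k)).natDegree = k - 1 := by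
  rw [natDegree_derivative, natDegree_legendre]

lemma derivative_legendre_ne_zero {k : ℕ} (hk : 1 ≤ k) : derivative (legendre k) ≠ 0 := by
  intro h
  have := derivative_eq_zero.mp h
  rw [natDegree_legendre] at this
  omega

/-- The derivative of the Legendre polynomial of degree `k` is orthogonal to all polynomials of
degree less than `k - 1` with respect to the weight `t (1 - t)`. -/
lemma unitInt_weight_mul_derivative_legendre (k : ℕ) {p : ℝ[X]}
    (hp : p.degree < (k - 1 : ℕ)) :
    unitInt (X * (1 - X) * derivative (legendre k) * p) = 0 := by
  rw [show X * (1 - X) * derivative (legendre k) * p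
    = derivative (legendre k) * (X * (1 - X) * p) by ring, unitInt_derivative_mul _ _ (by simp)
    (by simp)]
  rw [unitInt_legendre_mul, neg_zero]
  by_cases h0 : p = 0
  · simp [h0]
  have h1 : (X * (1 - X) * p : ℝ[X]).natDegree ≤ 2 + p.natDegree := by
    refine natDegree_mul_le.trans (Nat.add_le_add_right ?_ _)
    compute_degree
  have h2 := (natDegree_lt_iff_degree_lt h0).mpr hp
  refine lt_of_le_of_lt degree_le_natDegree ?_
  have h3 := natDegree_derivative_le (X * (1 - X) * p)
  exact_mod_cast (by omega :
    (derivative (X * (1 - X) * p : ℝ[X])).natDegree < k)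

/-- Over the reals, differentiation preserves having as many roots as the degree. -/
lemma natDegree_le_card_roots_iterate_derivative {p : ℝ[X]} (hp : p.natDegree ≤ p.roots.card)
    (j : ℕ) : (derivative^[j] p).natDegree ≤ (derivative^[j] p).roots.card := by
  induction j with
  | zero => exact hp
  | succ j ih =>
    rw [Function.iterate_succ_apply']
    have h1 := card_roots_le_derivative (derivative^[j] p)
    have h2 := natDegree_derivative_le (derivative^[j] p)
    omega

lemma card_roots_derivative_legendre (k : ℕ) :
    k - 1 ≤ (derivative (legendre k)).roots.card := by
  have hsp : ((X * (1 - X) : ℝ[X]) ^ k).natDegree ≤ ((X * (1 - X) : ℝ[X]) ^ k).roots.card := by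
    have h : (X * (1 - X) : ℝ[X]) = C (-1) * ((X - C 0) * (X - C 1)) := by
      simp only [C_0, C_1, C_neg]; ring
    rw [roots_pow, natDegree_pow, Multiset.card_nsmul, h, roots_C_mul _ (by norm_num),
      roots_mul (mul_ne_zero (X_sub_C_ne_zero _) (X_sub_C_ne_zero _)), roots_X_sub_C, roots_X_sub_C]
    refine Nat.mul_le_mul_left _ ?_
    refine (natDegree_C_mul_le _ _).trans (natDegree_mul_le.trans ?_)
    rw [natDegree_X_sub_C, natDegree_X_sub_C]
    simp
  have h := natDegree_le_card_roots_iterate_derivative hsp (k + 1)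
  rw [Function.iterate_succ_apply', ← rodrigues, derivative_C_mul,
    roots_C_mul _ (by positivity), natDegree_C_mul (by positivity),
    natDegree_derivative_legendre] at h
  exact h

lemma eval_weight_nonneg {t : ℝ} (ht : t ∈ Icc (0 : ℝ) 1) : 0 ≤ t * (1 - t) :=
  mul_nonneg ht.1 (sub_nonneg.mpr ht.2)

lemma weight_ne_zero : (X * (1 - X) : ℝ[X]) ≠ 0 :=
  mul_ne_zero X_ne_zero fun h => by simpa using congrArg (eval 0) h

lemma degree_lt_of_X_sub_C_mul {k : ℕ} (hk : 1 ≤ k) {f g : ℝ[X]} (hf : f.Monic)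
    (hf1 : 1 ≤ f.natDegree) (h : derivative (legendre k) = f * g) :
    g ≠ 0 ∧ g.degree < (k - 1 : ℕ) := by
  have hg : g ≠ 0 := fun h0 => derivative_legendre_ne_zero hk (by simp [h, h0])
  refine ⟨hg, (natDegree_lt_iff_degree_lt hg).mp ?_⟩
  have := natDegree_derivative_legendre k
  rw [h, natDegree_mul hf.ne_zero hg] at this
  omega

/-- The zeros of the derivative of a Legendre polynomial are interior: otherwise splitting off the
linear factor `t - r`, which has constant sign, would contradict orthogonality. -/
lemma mem_Ioo_of_isRoot {k : ℕ} (hk : 1 ≤ k) {r : ℝ}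
    (hr : (derivative (legendre k)).IsRoot r) : r ∈ Ioo (0 : ℝ) 1 := by
  obtain ⟨g, hg⟩ := dvd_iff_isRoot.mpr hr
  obtain ⟨hg0, hdeg⟩ := degree_lt_of_X_sub_C_mul hk (monic_X_sub_C r) (by simp) hg
  have h0 := unitInt_weight_mul_derivative_legendre k hdeg
  rw [hg] at h0
  by_contra hcon
  rw [mem_Ioo, not_and_or, not_lt, not_lt] at hcon
  have hne : X * (1 - X) * ((X - C r) * g) * g ≠ 0 :=
    mul_ne_zero (mul_ne_zero weight_ne_zero (mul_ne_zero (X_sub_C_ne_zero r) hg0)) hg0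
  rcases hcon with hr0 | hr1
  · refine (unitInt_pos hne fun t ht => ?_).ne' h0
    have h1 := mul_nonneg (mul_nonneg (eval_weight_nonneg ht) (sub_nonneg.mpr (hr0.trans ht.1)))
      (mul_self_nonneg (g.eval t))
    simp only [eval_mul, eval_X, eval_sub, eval_one, eval_C]
    linarith
  · refine (unitInt_pos (neg_ne_zero.mpr hne) fun t ht => ?_).ne' (by rw [map_neg, h0, neg_zero])
    have h1 := mul_nonneg (mul_nonneg (eval_weight_nonneg ht) (sub_nonneg.mpr (ht.2.trans hr1)))
      (mul_self_nonneg (g.eval t))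
    simp only [eval_neg, eval_mul, eval_X, eval_sub, eval_one, eval_C]
    linarith

/-- The zeros of the derivative of a Legendre polynomial are simple, since the square of a linear
factor could be split off without changing signs. -/
lemma nodup_roots_derivative_legendre {k : ℕ} (hk : 1 ≤ k) :
    (derivative (legendre k)).roots.Nodup := by
  rw [Multiset.nodup_iff_count_le_one]
  intro r
  by_contra! hcon
  rw [count_roots] at hcon
  obtain ⟨g, hg⟩ := (le_rootMultiplicity_iff (derivative_legendre_ne_zero hk)).mp
    (Nat.succ_le_of_lt hcon)
  obtain ⟨hg0, hdeg⟩ := degree_lt_of_X_sub_C_mul hk ((monic_X_sub_C r).pow 2) (by simp) hg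
  have h0 := unitInt_weight_mul_derivative_legendre k hdeg
  rw [hg] at h0
  refine (unitInt_pos (mul_ne_zero (mul_ne_zero weight_ne_zero
    (mul_ne_zero (pow_ne_zero 2 (X_sub_C_ne_zero r)) hg0)) hg0) fun t ht => ?_).ne' h0
  have h1 := mul_nonneg (mul_nonneg (eval_weight_nonneg ht) (sq_nonneg (t - r)))
      (mul_self_nonneg (g.eval t))
  simp only [eval_mul, eval_X, eval_sub, eval_one, eval_C, eval_pow]
  linarith

/-- The interior Gauss-Lobatto nodes. -/
noncomputable def glInner (k : ℕ) : Finset ℝ := (derivative (legendre k)).roots.toFinset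

lemma glNodes_eq (k : ℕ) : glNodes k = insert 0 (insert 1 (glInner k)) := rfl

lemma mem_glInner {k : ℕ} (hk : 1 ≤ k) {s : ℝ} :
    s ∈ glInner k ↔ (derivative (legendre k)).eval s = 0 := by
  rw [glInner, Multiset.mem_toFinset, mem_roots (derivative_legendre_ne_zero hk), IsRoot.def]

lemma glInner_subset_Ioo {k : ℕ} (hk : 1 ≤ k) {s : ℝ} (hs : s ∈ glInner k) :
    s ∈ Ioo (0 : ℝ) 1 :=
  mem_Ioo_of_isRoot hk ((mem_glInner hk).mp hs)

lemma card_glInner {k : ℕ} (hk : 1 ≤ k) : (glInner k).card = k - 1 := by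
  rw [glInner, Multiset.toFinset_card_of_nodup (nodup_roots_derivative_legendre hk)]
  refine le_antisymm ?_ (card_roots_derivative_legendre k)
  rw [← natDegree_derivative_legendre k]
  exact card_roots' _

lemma one_notMem_glInner {k : ℕ} (hk : 1 ≤ k) : (1 : ℝ) ∉ glInner k :=
  fun h => lt_irrefl _ (glInner_subset_Ioo hk h).2

lemma zero_notMem_glInner {k : ℕ} (hk : 1 ≤ k) : (0 : ℝ) ∉ insert 1 (glInner k) := by
  rw [Finset.mem_insert, not_or]
  exact ⟨zero_ne_one, fun h => lt_irrefl _ (glInner_subset_Ioo hk h).1⟩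

lemma card_glNodes {k : ℕ} (hk : 1 ≤ k) : (glNodes k).card = k + 1 := by
  rw [glNodes_eq, Finset.card_insert_of_notMem (zero_notMem_glInner hk),
    Finset.card_insert_of_notMem (one_notMem_glInner hk), card_glInner hk]
  omega

lemma glInner_subset_glNodes (k : ℕ) : glInner k ⊆ glNodes k :=
  (Finset.subset_insert _ _).trans (Finset.subset_insert _ _)

lemma zero_mem_glNodes (k : ℕ) : (0 : ℝ) ∈ glNodes k := Finset.mem_insert_self _ _

lemma one_mem_glNodes (k : ℕ) : (1 : ℝ) ∈ glNodes k :=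
  Finset.mem_insert_of_mem (Finset.mem_insert_self _ _)

lemma glNodes_subset_Icc {k : ℕ} (hk : 1 ≤ k) {s : ℝ} (hs : s ∈ glNodes k) :
    s ∈ Icc (0 : ℝ) 1 := by
  rw [glNodes_eq, Finset.mem_insert, Finset.mem_insert] at hs
  rcases hs with rfl | rfl | hs
  · simp
  · simp
  · exact Ioo_subset_Icc_self (glInner_subset_Ioo hk hs)

lemma mem_glNodes_cases {k : ℕ} {s : ℝ} (hs : s ∈ glNodes k) : s = 0 ∨ s = 1 ∨ s ∈ glInner k := by
  simpa [glNodes_eq] using hs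

/-- An interpolatory quadrature formula is exact on polynomials of degree at most `k`. -/
lemma unitInt_eq_sum_of_degree_lt {k : ℕ} (hk : 1 ≤ k) {p : ℝ[X]}
    (hp : p.degree < (k + 1 : ℕ)) : unitInt p = ∑ s ∈ glNodes k, glWeight k s * p.eval s := by
  have h := Lagrange.eq_interpolate (v := id) (s := glNodes k) (f := p)
    (Function.injective_id.injOn) (by rwa [card_glNodes hk])
  conv_lhs => rw [h, Lagrange.interpolate_apply, map_sum]
  refine Finset.sum_congr rfl fun s _ => ?_
  rw [← smul_eq_C_mul, map_smul, smul_eq_mul, mul_comm]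
  rfl

/-- Gauss-Lobatto quadrature with `k + 1` nodes is exact up to degree `2 k - 1`: division by the
nodal polynomial `t (1 - t) L_k'` leaves a quotient orthogonal to it. -/
lemma unitInt_eq_sum {k : ℕ} (hk : 1 ≤ k) {p : ℝ[X]} (hp : p.natDegree ≤ 2 * k - 1) :
    unitInt p = ∑ s ∈ glNodes k, glWeight k s * p.eval s := by
  set Q := X * (1 - X) * derivative (legendre k) with hQ
  have hQ0 : Q ≠ 0 := mul_ne_zero weight_ne_zero (derivative_legendre_ne_zero hk)
  have hQd : Q.natDegree = k + 1 := by
    have h2 : (X * (1 - X) : ℝ[X]).natDegree = 2 := by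
      rw [show (X * (1 - X) : ℝ[X]) = -X ^ 2 + X by ring]
      compute_degree!
    rw [hQ, natDegree_mul weight_ne_zero (derivative_legendre_ne_zero hk),
      natDegree_derivative_legendre, h2]
    omega
  have hQe : ∀ s ∈ glNodes k, Q.eval s = 0 := by
    intro s hs
    rcases mem_glNodes_cases hs with rfl | rfl | hs
    · simp [hQ]
    · simp [hQ]
    · simp [hQ, (mem_glInner hk).mp hs]
  have hdm := EuclideanDomain.div_add_mod p Q
  have hmod : (p % Q).degree < (k + 1 : ℕ) := by
    have := degree_mod_lt p hQ0
    rwa [degree_eq_natDegree hQ0, hQd] at this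
  have hdiv : (p / Q).degree < (k - 1 : ℕ) := by
    by_cases hlt : p.degree < Q.degree
    · rw [(Polynomial.div_eq_zero_iff hQ0).mpr hlt, degree_zero]
      exact WithBot.bot_lt_coe _
    · have hpQ := degree_add_div hQ0 (not_lt.mp hlt)
      by_cases h0 : p / Q = 0
      · rw [h0, degree_zero]
        exact WithBot.bot_lt_coe _
      · have hp0 : p ≠ 0 := by
          rintro rfl
          simp at h0
        rw [degree_eq_natDegree hQ0, degree_eq_natDegree h0, degree_eq_natDegree hp0] at hpQ
        rw [degree_eq_natDegree h0]
        norm_cast at hpQ ⊢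
        omega
  have hsplit : unitInt p = unitInt (p % Q) := by
    conv_lhs => rw [← hdm, map_add, unitInt_weight_mul_derivative_legendre k hdiv, zero_add]
  rw [hsplit, unitInt_eq_sum_of_degree_lt hk hmod]
  refine Finset.sum_congr rfl fun s hs => ?_
  conv_rhs => rw [← hdm, eval_add, eval_mul, hQe s hs, zero_mul, zero_add]

lemma sum_eval_prod_erase {k : ℕ} {s : ℝ} (hs : s ∈ glNodes k) (p : ℝ[X])
    (h : ∀ t ∈ glNodes k, t ≠ s → p.eval t = 0) :
    ∑ t ∈ glNodes k, glWeight k t * p.eval t = glWeight k s * p.eval s :=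
  Finset.sum_eq_single_of_mem s hs fun t ht hts => by rw [h t ht hts, mul_zero]

/-- The Gauss-Lobatto weights are positive: the formula is applied to a nonnegative polynomial of
degree at most `2 k - 1` that vanishes at all nodes but one. -/
lemma glWeight_pos {k : ℕ} (hk : 1 ≤ k) {s : ℝ} (hs : s ∈ glNodes k) : 0 < glWeight k s := by
  suffices H : ∃ p : ℝ[X], p.natDegree ≤ 2 * k - 1 ∧ (∀ t ∈ Icc (0 : ℝ) 1, 0 ≤ p.eval t) ∧
      0 < p.eval s ∧ ∀ t ∈ glNodes k, t ≠ s → p.eval t = 0 by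
    obtain ⟨p, hdeg, hnn, hps, hz⟩ := H
    have h1 := unitInt_pos (p := p) (by rintro rfl; simp at hps) hnn
    rw [unitInt_eq_sum hk hdeg, sum_eval_prod_erase hs p hz] at h1
    exact pos_of_mul_pos_left h1 hps.le
  set R : Finset ℝ → ℝ[X] := fun S => ∏ t ∈ S, (X - C t) with hR
  have hRd : ∀ S, (R S).natDegree = S.card := fun S => by
    rw [hR]; simp [natDegree_prod_of_monic, monic_X_sub_C]
  have hRz : ∀ S, ∀ t ∈ S, (R S).eval t = 0 := fun S t ht => by
    simp only [hR, eval_prod, eval_sub, eval_X, eval_C]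
    exact Finset.prod_eq_zero ht (sub_self t)
  have hRn : ∀ S, s ∉ S → 0 < (R S).eval s ^ 2 := fun S hS => by
    refine sq_pos_iff.mpr ?_
    simp only [hR, eval_prod, eval_sub, eval_X, eval_C]
    exact Finset.prod_ne_zero_iff.mpr fun t ht h => hS (sub_eq_zero.mp h ▸ ht)
  rcases mem_glNodes_cases hs with rfl | rfl | hs'
  · refine ⟨(1 - X) * R (glInner k) ^ 2, ?_, fun t ht => ?_, ?_, fun t ht hts => ?_⟩
    · refine natDegree_mul_le.trans ?_
      have h1 : (1 - X : ℝ[X]).natDegree ≤ 1 := by compute_degree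
      have h2 := natDegree_pow_le (p := R (glInner k)) (n := 2)
      rw [hRd, card_glInner hk] at h2
      omega
    · simpa using mul_nonneg (sub_nonneg.mpr ht.2) (sq_nonneg _)
    · simpa using hRn _ fun h => lt_irrefl _ (glInner_subset_Ioo hk h).1
    · rcases mem_glNodes_cases ht with rfl | rfl | ht'
      · exact absurd rfl hts
      · simp
      · simp [hRz _ t ht']
  · refine ⟨X * R (glInner k) ^ 2, ?_, fun t ht => ?_, ?_, fun t ht hts => ?_⟩
    · refine natDegree_mul_le.trans ?_
      have h2 := natDegree_pow_le (p := R (glInner k)) (n := 2)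
      rw [hRd, card_glInner hk] at h2
      rw [natDegree_X]
      omega
    · simpa using mul_nonneg ht.1 (sq_nonneg _)
    · simpa using hRn _ (one_notMem_glInner hk)
    · rcases mem_glNodes_cases ht with rfl | rfl | ht'
      · simp
      · exact absurd rfl hts
      · simp [hRz _ t ht']
  · have hs01 := glInner_subset_Ioo hk hs'
    refine ⟨X * (1 - X) * R ((glInner k).erase s) ^ 2, ?_, fun t ht => ?_, ?_,
      fun t ht hts => ?_⟩
    · refine natDegree_mul_le.trans ?_
      have h1 : (X * (1 - X) : ℝ[X]).natDegree ≤ 2 := by compute_degree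
      have h2 := natDegree_pow_le (p := R ((glInner k).erase s)) (n := 2)
      rw [hRd, Finset.card_erase_of_mem hs', card_glInner hk] at h2
      have h3 := Finset.card_pos.mpr ⟨s, hs'⟩
      rw [card_glInner hk] at h3
      omega
    · simpa using mul_nonneg (eval_weight_nonneg ht) (sq_nonneg _)
    · simpa using mul_pos (mul_pos hs01.1 (sub_pos.mpr hs01.2)) (hRn _ (Finset.notMem_erase s _))
    · rcases mem_glNodes_cases ht with rfl | rfl | ht'
      · simp
      · simp
      · simp [hRz _ t (Finset.mem_erase.mpr ⟨hts, ht'⟩)]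

/-- Gauss-Lobatto quadrature on the interval `[a, b]`. -/
lemma integral_eq_sum_glNodes {k : ℕ} (hk : 1 ≤ k) {p : ℝ[X]} (hp : p.natDegree ≤ 2 * k - 1)
    (a b : ℝ) : ∫ x in a..b, p.eval x =
      (b - a) * ∑ s ∈ glNodes k, glWeight k s * p.eval (a + s * (b - a)) := by
  have hdeg : (p.comp (C a + C (b - a) * X)).natDegree ≤ 2 * k - 1 := by
    refine natDegree_comp_le.trans ((Nat.mul_le_mul hp ?_).trans (mul_one _).le)
    compute_degree
  have h := unitInt_eq_sum hk hdeg
  have h2 := intervalIntegral.smul_integral_comp_add_mul (a := 0) (b := 1) (fun x => p.eval x)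
    (b - a) a
  simp only [smul_eq_mul, mul_zero, add_zero, mul_one, add_sub_cancel] at h2
  rw [← h2]
  simp only [unitInt_apply, eval_comp, eval_add, eval_C, eval_mul, eval_X] at h
  rw [h]
  simp only [mul_comm (b - a)]

end GaussLobatto

/-! ### Monotone equations with nodal barrier terms -/

section Monotone

open Filter Topology
open scoped NNReal

/-- A Lipschitz continuous, strongly monotone map on a Hilbert space has a zero. -/
lemma exists_zero_of_strongly_monotone {E : Type*} [NormedAddCommGroup E] [InnerProductSpace ℝ E]
    [CompleteSpace E] (T : E → E) {L : ℝ}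
    (hmono : ∀ x y, ‖x - y‖ ^ 2 ≤ inner ℝ (T x - T y) (x - y))
    (hlip : ∀ x y, ‖T x - T y‖ ≤ L * ‖x - y‖) : ∃ x, T x = 0 := by
  set M := |L| + 1 with hM
  have hM1 : 1 ≤ M := by rw [hM]; linarith [abs_nonneg L]
  have hM0 : 0 < M := by linarith
  have hlip' : ∀ x y, ‖T x - T y‖ ≤ M * ‖x - y‖ := fun x y =>
    (hlip x y).trans (mul_le_mul_of_nonneg_right (by rw [hM]; linarith [le_abs_self L])
      (norm_nonneg _))
  have hq0 : 0 ≤ 1 - (M ^ 2)⁻¹ := by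
    rw [sub_nonneg]; exact inv_le_one_of_one_le₀ (one_le_pow₀ hM1)
  set q : ℝ≥0 := (Real.sqrt (1 - (M ^ 2)⁻¹)).toNNReal with hq
  -- The step size `M⁻²` minimizes the contraction factor.
  have hcontr : ContractingWith q (fun x => x - (M ^ 2)⁻¹ • T x) := by
    refine ⟨?_, LipschitzWith.of_dist_le_mul fun x y => ?_⟩
    · rw [hq, Real.toNNReal_lt_one, Real.sqrt_lt' one_pos]
      have : 0 < (M ^ 2)⁻¹ := by positivity
      linarith
    · rw [hq, Real.coe_toNNReal _ (Real.sqrt_nonneg _), dist_eq_norm, dist_eq_norm]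
      have hsq : ‖x - (M ^ 2)⁻¹ • T x - (y - (M ^ 2)⁻¹ • T y)‖ ^ 2
          ≤ (1 - (M ^ 2)⁻¹) * ‖x - y‖ ^ 2 := by
        have h1 : x - (M ^ 2)⁻¹ • T x - (y - (M ^ 2)⁻¹ • T y)
            = (x - y) - (M ^ 2)⁻¹ • (T x - T y) := by rw [smul_sub]; abel
        rw [h1, norm_sub_sq_real, inner_smul_right, real_inner_comm, norm_smul, mul_pow,
          Real.norm_eq_abs, sq_abs]
        have h2 := hmono x y
        have h3 : ‖T x - T y‖ ^ 2 ≤ M ^ 2 * ‖x - y‖ ^ 2 := by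
          rw [← mul_pow]; exact pow_le_pow_left₀ (norm_nonneg _) (hlip' x y) 2
        have h4 : 0 < (M ^ 2)⁻¹ := by positivity
        have h5 : (M ^ 2)⁻¹ ^ 2 * ‖T x - T y‖ ^ 2 ≤ (M ^ 2)⁻¹ * ‖x - y‖ ^ 2 := by
          calc (M ^ 2)⁻¹ ^ 2 * ‖T x - T y‖ ^ 2
              ≤ (M ^ 2)⁻¹ ^ 2 * (M ^ 2 * ‖x - y‖ ^ 2) := by gcongr
            _ = (M ^ 2)⁻¹ * ‖x - y‖ ^ 2 := by field_simp
        have h6 := mul_le_mul_of_nonneg_left h2 h4.le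
        linarith
      calc ‖x - (M ^ 2)⁻¹ • T x - (y - (M ^ 2)⁻¹ • T y)‖
          ≤ Real.sqrt ((1 - (M ^ 2)⁻¹) * ‖x - y‖ ^ 2) := Real.le_sqrt_of_sq_le hsq
        _ = Real.sqrt (1 - (M ^ 2)⁻¹) * ‖x - y‖ := by
          rw [Real.sqrt_mul hq0, Real.sqrt_sq (norm_nonneg _)]
  refine ⟨hcontr.fixedPoint, ?_⟩
  have hfix := hcontr.fixedPoint_isFixedPt
  have h1 : (M ^ 2)⁻¹ • T hcontr.fixedPoint = 0 := by
    have := hfix.eq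
    simpa using this
  exact (smul_eq_zero.mp h1).resolve_left (by positivity)

/-- A nonlinearity on `(-1, 1)` that is monotone, locally Lipschitz continuous, and blows up at
both ends; only its values in `(-1, 1)` matter. -/
structure IsBarrier (g : ℝ → ℝ) : Prop where
  mono : MonotoneOn g (Ioo (-1) 1)
  lip : ∀ r < 1, ∃ K : ℝ, 0 ≤ K ∧ ∀ s ∈ Icc (-r) r, ∀ t ∈ Icc (-r) r, |g s - g t| ≤ K * |s - t|
  top : Tendsto g (𝓝[<] 1) atTop
  bot : Tendsto (fun s => g (-s)) (𝓝[<] 1) atBot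

/-- Projection of the real line onto `[-r, r]`. -/
noncomputable def clip (r s : ℝ) : ℝ := max (-r) (min r s)

lemma clip_mem {r : ℝ} (hr : 0 ≤ r) (s : ℝ) : clip r s ∈ Icc (-r) r :=
  ⟨le_max_left _ _, max_le (by linarith) (min_le_left _ _)⟩

lemma clip_mono (r : ℝ) : Monotone (clip r) := fun _ _ h =>
  max_le_max le_rfl (min_le_min le_rfl h)

lemma abs_clip_sub_clip_le (r s t : ℝ) : |clip r s - clip r t| ≤ |s - t| := by
  refine (abs_max_sub_max_le_max _ _ _ _).trans ?_
  rw [sub_self, abs_zero]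
  refine max_le (abs_nonneg _) ((abs_min_sub_min_le_max _ _ _ _).trans ?_)
  rw [sub_self, abs_zero]
  exact max_le (abs_nonneg _) le_rfl

lemma clip_of_mem {r s : ℝ} (hs : s ∈ Icc (-r) r) : clip r s = s := by
  rw [clip, min_eq_right hs.2, max_eq_right hs.1]

lemma clip_of_le {r s : ℝ} (hr : 0 ≤ r) (hs : r ≤ s) : clip r s = r := by
  rw [clip, min_eq_left hs, max_eq_right (by linarith)]

lemma clip_of_le_neg {r s : ℝ} (hs : s ≤ -r) : clip r s = -r :=
  max_eq_left ((min_le_right _ _).trans hs)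

section InnerProduct

variable {E : Type*} [NormedAddCommGroup E] [InnerProductSpace ℝ E] [FiniteDimensional ℝ E]
  {ι : Type*} [Fintype ι]

lemma exists_solution_of_lipschitz (A : E →ₗ[ℝ] E →ₗ[ℝ] ℝ) (hA : ∀ x, A x x = ‖x‖ ^ 2)
    (ℓ : E →ₗ[ℝ] ℝ) (w : ι → ℝ) (hw : ∀ i, 0 < w i) (e : ι → E →ₗ[ℝ] ℝ) (m : ℝ)
    (g : ι → ℝ → ℝ) (hmono : ∀ i, Monotone (g i))
    (K : ι → ℝ) (hlip : ∀ i s t, |g i s - g i t| ≤ K i * |s - t|) :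
    ∃ x, ∀ y, A x y + ∑ i, w i * g i (m + e i x) * e i y = ℓ y := by
  let A' : E →ₗ[ℝ] E →L[ℝ] ℝ := (LinearMap.toContinuousLinearMap (𝕜 := ℝ)).toLinearMap ∘ₗ A
  let A'' : E →L[ℝ] E →L[ℝ] ℝ := LinearMap.toContinuousLinearMap A'
  let e' : ι → E →L[ℝ] ℝ := fun i => LinearMap.toContinuousLinearMap (e i)
  let ℓ' : E →L[ℝ] ℝ := LinearMap.toContinuousLinearMap ℓ
  let Φ : E → E →L[ℝ] ℝ := fun x => A'' x + ∑ i, (w i * g i (m + e' i x)) • e' i - ℓ'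
  let T : E → E := fun x => (InnerProductSpace.toDual ℝ E).symm (Φ x)
  have hT : ∀ x y, inner ℝ (T x) y = Φ x y := fun x y =>
    InnerProductSpace.toDual_symm_apply
  have hdiff : ∀ x y, Φ x - Φ y =
      A'' (x - y) + ∑ i, (w i * (g i (m + e' i x) - g i (m + e' i y))) • e' i := by
    intro x y
    ext z
    simp only [Φ, map_sub, mul_sub, sub_mul, Finset.sum_sub_distrib, sub_apply, add_apply,
      sum_apply, smul_apply, smul_eq_mul]
    ring
  have hTmono : ∀ x y, ‖x - y‖ ^ 2 ≤ inner ℝ (T x - T y) (x - y) := by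
    intro x y
    rw [inner_sub_left, hT, hT, ← sub_apply, hdiff,
      add_apply, sum_apply]
    have h1 : A'' (x - y) (x - y) = ‖x - y‖ ^ 2 := hA _
    rw [h1]
    refine le_add_of_nonneg_right (Finset.sum_nonneg fun i _ => ?_)
    rw [smul_apply, smul_eq_mul, mul_assoc]
    refine mul_nonneg (hw i).le ?_
    rw [map_sub]
    rcases le_total (e' i y) (e' i x) with h | h
    · exact mul_nonneg (sub_nonneg.mpr (hmono i (by linarith))) (sub_nonneg.mpr h)
    · exact mul_nonneg_of_nonpos_of_nonpos (sub_nonpos.mpr (hmono i (by linarith)))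
        (sub_nonpos.mpr h)
  have hTlip : ∀ x y, ‖T x - T y‖ ≤
      (‖A''‖ + ∑ i, w i * (K i * ‖e' i‖) * ‖e' i‖) * ‖x - y‖ := by
    intro x y
    have h1 : ‖T x - T y‖ = ‖Φ x - Φ y‖ := by
      simp only [T]
      rw [← map_sub, LinearIsometryEquiv.norm_map]
    rw [h1, hdiff, add_mul, Finset.sum_mul]
    refine (norm_add_le _ _).trans (add_le_add (A''.le_opNorm _) ((norm_sum_le _ _).trans
      (Finset.sum_le_sum fun i _ => ?_)))
    rw [norm_smul, norm_mul, Real.norm_eq_abs, Real.norm_eq_abs, abs_of_pos (hw i)]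
    have h2 := hlip i (m + e' i x) (m + e' i y)
    have h3 : |m + e' i x - (m + e' i y)| ≤ ‖e' i‖ * ‖x - y‖ := by
      rw [add_sub_add_left_eq_sub, ← map_sub]
      exact (e' i).le_opNorm _
    have hK : 0 ≤ K i := by
      have := hlip i 1 0
      norm_num at this
      exact (abs_nonneg _).trans this
    calc w i * |g i (m + e' i x) - g i (m + e' i y)| * ‖e' i‖
        ≤ w i * (K i * (‖e' i‖ * ‖x - y‖)) * ‖e' i‖ := by
          have := (hw i).le
          gcongr
          exact h2.trans (mul_le_mul_of_nonneg_left h3 hK)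
      _ = w i * (K i * ‖e' i‖) * ‖e' i‖ * ‖x - y‖ := by ring
  obtain ⟨x, hx⟩ := exists_zero_of_strongly_monotone T
    (L := ‖A''‖ + ∑ i, w i * (K i * ‖e' i‖) * ‖e' i‖) hTmono hTlip
  refine ⟨x, fun y => ?_⟩
  have h := hT x y
  rw [hx, inner_zero_left] at h
  simp only [Φ, sub_apply, add_apply,
    sum_apply, smul_apply, smul_eq_mul] at h
  have h' : A x y + ∑ i, w i * g i (m + e i x) * e i y - ℓ y = 0 := h.symm
  linarith

/-- Existence for an equation with nodal barrier terms: the barriers are cut off at `±r`. Testing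
with the solution bounds the sum of the absolute values of the cut-off terms independently of `r`,
because `|m| < 1`, so that for `r` close to `1` the cut-off is not active. -/
lemma exists_solution_of_isBarrier (A : E →ₗ[ℝ] E →ₗ[ℝ] ℝ) (hA : ∀ x, A x x = ‖x‖ ^ 2)
    (ℓ : E →ₗ[ℝ] ℝ) (w : ι → ℝ) (hw : ∀ i, 0 < w i) (e : ι → E →ₗ[ℝ] ℝ) {m : ℝ}
    (hm : |m| < 1) (g : ι → ℝ → ℝ) (hg : ∀ i, IsBarrier (g i)) :
    ∃ x, (∀ i, |m + e i x| < 1) ∧ ∀ y, A x y + ∑ i, w i * g i (m + e i x) * e i y = ℓ y := by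
  have hev : ∀ C : ι → ℝ, ∀ᶠ r in 𝓝[<] (1 : ℝ), ∀ i, C i ≤ g i r ∧ g i (-r) ≤ -C i := fun C =>
    eventually_all.mpr fun i => ((hg i).top.eventually_ge_atTop _).and
      ((hg i).bot.eventually_le_atBot _)
  have hlt : ∀ a < (1 : ℝ), ∀ᶠ r in 𝓝[<] (1 : ℝ), r ∈ Ioo a 1 := fun a ha =>
    Ioo_mem_nhdsLT ha
  obtain ⟨r₀, hr₀, hr₀m, hr₀1⟩ := ((hev 0).and (hlt _ hm)).exists
  have hr₀0 : 0 < r₀ := (abs_nonneg m).trans_lt hr₀m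
  set d := r₀ - |m| with hd
  have hd0 : 0 < d := sub_pos.mpr hr₀m
  set B : ι → ℝ := fun i => max (g i r₀) (-g i (-r₀)) with hB
  have hB0 : ∀ i, 0 ≤ B i := fun i => (hr₀ i).1.trans (le_max_left _ _)
  let ℓ' : E →L[ℝ] ℝ := LinearMap.toContinuousLinearMap ℓ
  set C₁ := ‖ℓ'‖ ^ 2 / 4 + ∑ i, w i * (4 * B i) with hC₁
  obtain ⟨r, hr, hrr, hr1⟩ := ((hev fun i => C₁ / (d * w i) + 1).and (hlt _ hr₀1)).exists
  have hr0 : 0 < r := hr₀0.trans hrr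
  have hsub : Icc (-r) r ⊆ Ioo (-1 : ℝ) 1 := fun s hs => ⟨by linarith [hs.1], by linarith [hs.2]⟩
  set G : ι → ℝ → ℝ := fun i s => g i (clip r s) with hG
  have hGmono : ∀ i, Monotone (G i) := fun i s t hst =>
    (hg i).mono (hsub (clip_mem hr0.le _)) (hsub (clip_mem hr0.le _)) (clip_mono r hst)
  choose K hK0 hK using fun i => (hg i).lip r hr1
  obtain ⟨x, hx⟩ := exists_solution_of_lipschitz A hA ℓ w hw e m G hGmono K fun i s t =>
    (hK i _ (clip_mem hr0.le _) _ (clip_mem hr0.le _)).trans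
      (mul_le_mul_of_nonneg_left (abs_clip_sub_clip_le r s t) (hK0 i))
  have hGr : ∀ i, ∀ s ∈ Icc (-r) r, G i s = g i s := fun i s hs => by
    simp only [hG, clip_of_mem hs]
  have hmle := abs_le.mp (le_refl |m|)
  have hlow : ∀ i s, d * |G i s| - 4 * B i ≤ G i s * (s - m) := by
    intro i s
    have hp : G i r₀ = g i r₀ := hGr i _ ⟨by linarith, hrr.le⟩
    have hn : G i (-r₀) = g i (-r₀) := hGr i _ ⟨by linarith, by linarith⟩
    have hr1 : 0 ≤ g i r₀ := (hr₀ i).1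
    have hr2 : g i (-r₀) ≤ 0 := by simpa using (hr₀ i).2
    rcases le_total r₀ s with h1 | h1
    · have h2 : 0 ≤ G i s := hr1.trans (hp.symm.le.trans (hGmono i h1))
      rw [abs_of_nonneg h2]
      nlinarith [hB0 i, mul_nonneg h2 (by linarith : 0 ≤ s - m - d)]
    · rcases le_total s (-r₀) with h3 | h3
      · have h2 : G i s ≤ 0 := (hGmono i h3).trans (hn.le.trans hr2)
        rw [abs_of_nonpos h2]
        nlinarith [hB0 i, mul_nonneg (neg_nonneg.mpr h2) (by linarith : 0 ≤ m - s - d)]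
      · have h4 : |G i s| ≤ B i := by
          rw [abs_le]
          have h5 := hGmono i h1
          have h6 := hGmono i h3
          rw [hp] at h5
          rw [hn] at h6
          have h7 : g i r₀ ≤ B i := le_max_left _ _
          have h8 : -g i (-r₀) ≤ B i := le_max_right _ _
          constructor <;> linarith
        have h5 : |G i s * (s - m)| ≤ B i * 2 := by
          rw [abs_mul]
          refine mul_le_mul h4 ?_ (abs_nonneg _) (hB0 i)
          rw [abs_le]
          constructor <;> linarith
        have h6 : d * |G i s| ≤ 1 * B i :=
          mul_le_mul (by linarith [abs_nonneg m]) h4 (abs_nonneg _) zero_le_one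
        linarith [(abs_le.mp h5).1, hB0 i]
  have hsum : d * ∑ i, w i * |G i (m + e i x)| ≤ C₁ := by
    have h1 := hx x
    rw [hA] at h1
    have h2 : ℓ x ≤ ‖ℓ'‖ * ‖x‖ := (le_abs_self _).trans (ℓ'.le_opNorm x)
    have h3 : ∑ i, (d * (w i * |G i (m + e i x)|) - w i * (4 * B i))
        ≤ ∑ i, w i * G i (m + e i x) * e i x := by
      refine Finset.sum_le_sum fun i _ => ?_
      have h4 := mul_le_mul_of_nonneg_left (hlow i (m + e i x)) (hw i).le
      rw [add_sub_cancel_left] at h4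
      linarith
    rw [Finset.sum_sub_distrib, ← Finset.mul_sum] at h3
    nlinarith [sq_nonneg (‖x‖ - ‖ℓ'‖ / 2)]
  have hbd : ∀ i, |G i (m + e i x)| < C₁ / (d * w i) + 1 := by
    intro i
    have h1 : w i * |G i (m + e i x)| ≤ ∑ j, w j * |G j (m + e j x)| :=
      Finset.single_le_sum (f := fun j => w j * |G j (m + e j x)|)
        (fun j _ => mul_nonneg (hw j).le (abs_nonneg _)) (Finset.mem_univ i)
    refine lt_of_le_of_lt ?_ (lt_add_one _)
    rw [le_div_iff₀ (mul_pos hd0 (hw i))]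
    nlinarith
  have hin : ∀ i, m + e i x ∈ Icc (-r) r := by
    intro i
    by_contra hcon
    rw [mem_Icc, not_and_or, not_le, not_le] at hcon
    have h1 := abs_lt.mp (hbd i)
    rcases hcon with h | h
    · simp only [hG, clip_of_le_neg h.le] at h1
      linarith [(hr i).2]
    · simp only [hG, clip_of_le hr0.le h.le] at h1
      linarith [(hr i).1]
  refine ⟨x, fun i => abs_lt.mpr (hsub (hin i)), fun y => ?_⟩
  rw [← hx y]
  congr 1
  exact Finset.sum_congr rfl fun i _ => by rw [hGr i _ (hin i)]

end InnerProduct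

/-- A finite-dimensional equation with a positive definite, possibly nonsymmetric bilinear form and
nodal barrier terms has exactly one solution. -/
theorem existsUnique_of_isBarrier {W ι : Type*} [AddCommGroup W] [Module ℝ W]
    [FiniteDimensional ℝ W] [Fintype ι] (A : W →ₗ[ℝ] W →ₗ[ℝ] ℝ) (hA : ∀ x, x ≠ 0 → 0 < A x x)
    (ℓ : W →ₗ[ℝ] ℝ) (w : ι → ℝ) (hw : ∀ i, 0 < w i) (e : ι → W →ₗ[ℝ] ℝ) {m : ℝ}
    (hm : |m| < 1) (g : ι → ℝ → ℝ) (hg : ∀ i, IsBarrier (g i)) :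
    ∃! x, (∀ i, |m + e i x| < 1) ∧ ∀ y, A x y + ∑ i, w i * g i (m + e i x) * e i y = ℓ y := by
  have hA0 : ∀ x, 0 ≤ A x x := fun x => by
    by_cases h : x = 0
    · simp [h]
    · exact (hA x h).le
  refine existsUnique_of_exists_of_unique ?_ ?_
  · -- The symmetric part of the form serves as the inner product.
    let core : InnerProductSpace.Core ℝ W :=
      { inner := fun x y => (A x y + A y x) / 2
        conj_inner_symm := fun x y => by simp [add_comm]
        re_inner_nonneg := fun x => by simpa using hA0 x
        add_left := fun x y z => by simp only [map_add, LinearMap.add_apply]; ring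
        smul_left := fun x y r => by
          simp only [map_smul, LinearMap.smul_apply, smul_eq_mul, conj_trivial]; ring
        definite := fun x hx => by
          by_contra h
          have := hA x h
          change (A x x + A x x) / 2 = 0 at hx
          linarith }
    let _ : NormedAddCommGroup W := core.toNormedAddCommGroup
    let _ : InnerProductSpace ℝ W := InnerProductSpace.ofCore core.toCore
    refine exists_solution_of_isBarrier A (fun x => ?_) ℓ w hw e hm g hg
    rw [← real_inner_self_eq_norm_sq]
    change A x x = (A x x + A x x) / 2
    ring
  · rintro x y ⟨hx1, hx⟩ ⟨hy1, hy⟩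
    by_contra hne
    have hpos := hA (x - y) (sub_ne_zero.mpr hne)
    have h1 := hx (x - y)
    have h2 := hy (x - y)
    have h3 : 0 ≤ ∑ i, (w i * g i (m + e i x) * e i (x - y)
        - w i * g i (m + e i y) * e i (x - y)) := by
      refine Finset.sum_nonneg fun i _ => ?_
      rw [← sub_mul, ← mul_sub, mul_assoc, map_sub]
      refine mul_nonneg (hw i).le ?_
      have ix := abs_lt.mp (hx1 i)
      have iy := abs_lt.mp (hy1 i)
      rcases le_total (e i y) (e i x) with h | h
      · exact mul_nonneg (sub_nonneg.mpr ((hg i).mono iy ix (by linarith))) (sub_nonneg.mpr h)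
      · exact mul_nonneg_of_nonpos_of_nonpos
          (sub_nonpos.mpr ((hg i).mono ix iy (by linarith))) (sub_nonpos.mpr h)
    rw [Finset.sum_sub_distrib] at h3
    have h4 : A (x - y) (x - y) = A x (x - y) - A y (x - y) := by
      rw [map_sub A, LinearMap.sub_apply]
    linarith

end Monotone

/-! ### The singular potential -/

section Potential

open Filter Topology

lemma hasDerivAt_Fv {s : ℝ} (hs : s ∈ Ioo (-1 : ℝ) 1) : HasDerivAt Fv (fv s) s := by
  have h1 : HasDerivAt (fun s : ℝ => 1 + s) 1 s := (hasDerivAt_id s).const_add 1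
  have h2 : HasDerivAt (fun s : ℝ => 1 - s) (-1) s := by
    simpa using (hasDerivAt_id s).const_sub 1
  have p1 : 1 + s ≠ 0 := by linarith [hs.1]
  have p2 : 1 - s ≠ 0 := by linarith [hs.2]
  have h := ((h1.mul (h1.log p1)).add (h2.mul (h2.log p2))).const_mul (1 / 2 : ℝ)
  refine HasDerivAt.congr_deriv (f := Fv) h ?_
  rw [fv]
  field_simp
  ring

lemma hasDerivAt_fv {s : ℝ} (hs : s ∈ Ioo (-1 : ℝ) 1) : HasDerivAt fv (1 - s ^ 2)⁻¹ s := by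
  have h1 : HasDerivAt (fun s : ℝ => 1 + s) 1 s := (hasDerivAt_id s).const_add 1
  have h2 : HasDerivAt (fun s : ℝ => 1 - s) (-1) s := by
    simpa using (hasDerivAt_id s).const_sub 1
  have p1 : 1 + s ≠ 0 := by linarith [hs.1]
  have p2 : 1 - s ≠ 0 := by linarith [hs.2]
  have h := ((h1.log p1).sub (h2.log p2)).const_mul (1 / 2 : ℝ)
  refine HasDerivAt.congr_deriv (f := fv) h ?_
  rw [show 1 - s ^ 2 = (1 + s) * (1 - s) by ring]
  field_simp
  ring

lemma fv_monotoneOn : MonotoneOn fv (Ioo (-1) 1) := by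
  intro s hs t ht hst
  have h1 := Real.log_le_log (by linarith [hs.1] : 0 < 1 + s) (by linarith : 1 + s ≤ 1 + t)
  have h2 := Real.log_le_log (by linarith [ht.2] : 0 < 1 - t) (by linarith : 1 - t ≤ 1 - s)
  rw [fv, fv]
  linarith

/-- On `(-ρ, ρ)` the derivative of `f_v` is at most `1 / (1 - ρ²)`. -/
lemma monotoneOn_linear_sub_fv {ρ : ℝ} (hρ1 : ρ < 1) :
    MonotoneOn (fun s => (1 - ρ ^ 2)⁻¹ * s - fv s) (Ioo (-ρ) ρ) := by
  have hsub : ∀ s ∈ Ioo (-ρ) ρ, s ∈ Ioo (-1 : ℝ) 1 := fun s hs =>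
    ⟨by linarith [hs.1], by linarith [hs.2]⟩
  have hder : ∀ s ∈ Ioo (-ρ) ρ, HasDerivAt (fun s => (1 - ρ ^ 2)⁻¹ * s - fv s)
      ((1 - ρ ^ 2)⁻¹ * 1 - (1 - s ^ 2)⁻¹) s := fun s hs =>
    ((hasDerivAt_id s).const_mul _).sub (hasDerivAt_fv (hsub s hs))
  refine monotoneOn_of_deriv_nonneg (convex_Ioo _ _)
    (fun s hs => (hder s hs).continuousAt.continuousWithinAt) ?_ ?_
  · rw [interior_Ioo]
    exact fun s hs => (hder s hs).differentiableAt.differentiableWithinAt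
  · rw [interior_Ioo]
    intro s hs
    rw [(hder s hs).deriv, mul_one, sub_nonneg]
    have h1 : s ^ 2 ≤ ρ ^ 2 := sq_le_sq' hs.1.le hs.2.le
    have h2 : ρ ^ 2 < 1 := by nlinarith [hs.1, hs.2]
    exact inv_anti₀ (by linarith) (by linarith)

/-- The difference quotient of `F` with base point `t`, completed by the derivative `f t`. -/
noncomputable def diffQuot (F f : ℝ → ℝ) (t s : ℝ) : ℝ :=
  if s = t then f t else (F s - F t) / (s - t)

lemma diffQuot_monotoneOn {F f : ℝ → ℝ} {a b : ℝ} (hF : ∀ s ∈ Ioo a b, HasDerivAt F (f s) s)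
    (hf : MonotoneOn f (Ioo a b)) {t : ℝ} (ht : t ∈ Ioo a b) :
    MonotoneOn (diffQuot F f t) (Ioo a b) := by
  have hconv : ConvexOn ℝ (Ioo a b) F := by
    refine MonotoneOn.convexOn_of_deriv (convex_Ioo a b)
      (fun s hs => (hF s hs).continuousAt.continuousWithinAt) ?_ ?_
    · rw [interior_Ioo]
      exact fun s hs => (hF s hs).differentiableAt.differentiableWithinAt
    · rw [interior_Ioo]
      intro s hs s' hs' h
      rw [(hF s hs).deriv, (hF s' hs').deriv]
      exact hf hs hs' h
  intro s hs s' hs' hss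
  simp only [diffQuot]
  split_ifs with h1 h2 h2
  · exact le_rfl
  · subst h1
    have := hconv.le_slope_of_hasDerivAt hs hs' (lt_of_le_of_ne hss (Ne.symm h2)) (hF s hs)
    rwa [slope_def_field] at this
  · subst h2
    have := hconv.slope_le_of_hasDerivAt hs hs' (lt_of_le_of_ne hss h1) (hF s' hs')
    rw [slope_def_field] at this
    rwa [← neg_sub (F s'), ← neg_sub s' s, neg_div_neg_eq]
  · exact hconv.secant_mono ht hs hs' h1 h2 hss

lemma quotFv_eq (s t : ℝ) : quotFv s t = diffQuot Fv fv t s := rfl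

lemma quotFv_monotoneOn {t : ℝ} (ht : t ∈ Ioo (-1 : ℝ) 1) :
    MonotoneOn (fun s => quotFv s t) (Ioo (-1) 1) :=
  diffQuot_monotoneOn (fun _ hs => hasDerivAt_Fv hs) fv_monotoneOn ht

/-- The analogue of `monotoneOn_linear_sub_fv` for the difference quotient, obtained by applying
`diffQuot_monotoneOn` to the convex function `K s² / 2 - F_v(s)`. -/
lemma monotoneOn_linear_sub_quotFv {ρ t : ℝ} (hρ1 : ρ < 1) (ht : t ∈ Ioo (-ρ) ρ) :
    MonotoneOn (fun s => (1 - ρ ^ 2)⁻¹ / 2 * s - quotFv s t) (Ioo (-ρ) ρ) := by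
  set K := (1 - ρ ^ 2)⁻¹ with hK
  have hsub : ∀ s ∈ Ioo (-ρ) ρ, s ∈ Ioo (-1 : ℝ) 1 := fun s hs =>
    ⟨by linarith [hs.1], by linarith [hs.2]⟩
  have hF : ∀ s ∈ Ioo (-ρ) ρ, HasDerivAt (fun s => K / 2 * s ^ 2 - Fv s) (K * s - fv s) s := by
    intro s hs
    refine (((hasDerivAt_pow 2 s).const_mul (K / 2)).sub
      (hasDerivAt_Fv (hsub s hs))).congr_deriv ?_
    push_cast
    ring
  have h := diffQuot_monotoneOn hF (monotoneOn_linear_sub_fv hρ1) ht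
  have heq : ∀ s, diffQuot (fun s => K / 2 * s ^ 2 - Fv s) (fun s => K * s - fv s) t s
      = K / 2 * s - quotFv s t + K / 2 * t := by
    intro s
    rw [quotFv_eq]
    simp only [diffQuot]
    split_ifs with h1
    · subst h1; ring
    · have : s - t ≠ 0 := sub_ne_zero.mpr h1
      field_simp
      ring
  intro s hs s' hs' hss
  have := h hs hs' hss
  rw [heq, heq] at this
  exact le_of_add_le_add_right this

lemma abs_sub_le_of_monotoneOn {g : ℝ → ℝ} {S : Set ℝ} {K : ℝ} (h1 : MonotoneOn g S)
    (h2 : MonotoneOn (fun s => K * s - g s) S) {s t : ℝ} (hs : s ∈ S) (ht : t ∈ S) :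
    |g s - g t| ≤ K * |s - t| := by
  wlog h : t ≤ s generalizing s t
  · rw [abs_sub_comm, abs_sub_comm s]
    exact this ht hs (le_of_not_ge h)
  have e1 := h1 ht hs h
  have e2 : K * t - g t ≤ K * s - g s := h2 ht hs h
  rw [abs_of_nonneg (sub_nonneg.mpr e1), abs_of_nonneg (sub_nonneg.mpr h)]
  linarith

lemma fv_neg (s : ℝ) : fv (-s) = -fv s := by
  rw [fv, fv, sub_neg_eq_add, ← sub_eq_add_neg]
  ring

lemma tendsto_fv : Tendsto fv (𝓝[<] 1) atTop := by
  have h1 : Tendsto (fun s : ℝ => 1 - s) (𝓝[<] 1) (𝓝[>] 0) := by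
    refine tendsto_nhdsWithin_iff.mpr ⟨?_, ?_⟩
    · have : Tendsto (fun s : ℝ => 1 - s) (𝓝 1) (𝓝 (1 - 1)) :=
        (continuous_const.sub continuous_id).tendsto 1
      rw [sub_self] at this
      exact this.mono_left nhdsWithin_le_nhds
    · filter_upwards [self_mem_nhdsWithin] with s hs
      exact sub_pos.mpr (mem_Iio.mp hs)
  have h2 := Real.tendsto_log_nhdsGT_zero.comp h1
  have h3 : Tendsto (fun s : ℝ => -Real.log (1 - s)) (𝓝[<] 1) atTop :=
    tendsto_neg_atBot_atTop.comp h2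
  have h4 : Tendsto (fun s : ℝ => 0 + -Real.log (1 - s)) (𝓝[<] 1) atTop := by simpa using h3
  refine (tendsto_atTop_mono' _ ?_ h3).const_mul_atTop (by norm_num : (0 : ℝ) < 1 / 2)
  filter_upwards [Ioo_mem_nhdsLT (zero_lt_one (α := ℝ))] with s hs
  have := Real.log_nonneg (by linarith [hs.1] : 1 ≤ 1 + s)
  linarith

lemma exists_between_abs {r t : ℝ} (hr : r < 1) (ht : |t| < 1) :
    ∃ ρ < 1, t ∈ Ioo (-ρ) ρ ∧ Icc (-r) r ⊆ Ioo (-ρ) ρ ∧ 0 ≤ (1 - ρ ^ 2)⁻¹ := by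
  obtain ⟨ρ, h1, h2⟩ := exists_between (max_lt hr ht)
  have h3 := (le_max_left r |t|).trans_lt h1
  have h4 := (le_max_right r |t|).trans_lt h1
  refine ⟨ρ, h2, abs_lt.mp h4, fun s hs => ⟨by linarith [hs.1], by linarith [hs.2]⟩, ?_⟩
  have h0 := (abs_nonneg t).trans_lt h4
  exact inv_nonneg.mpr (by nlinarith)

/-- The nonlinearity of the first-order step. -/
lemma isBarrier_fv : IsBarrier fv where
  mono := fv_monotoneOn
  lip r hr := by
    obtain ⟨ρ, hρ1, -, hsub, hK⟩ := exists_between_abs hr (by simp : |(0 : ℝ)| < 1)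
    exact ⟨_, hK, fun s hs t ht => abs_sub_le_of_monotoneOn
      (fv_monotoneOn.mono (Ioo_subset_Ioo (by linarith) hρ1.le)) (monotoneOn_linear_sub_fv hρ1)
      (hsub hs) (hsub ht)⟩
  top := tendsto_fv
  bot := by
    simp only [fv_neg]
    exact tendsto_neg_atTop_atBot.comp tendsto_fv

/-- The nonlinearity of the second-order step. The difference quotient stays bounded at `±1`; it is
the stabilizing term that blows up. -/
lemma isBarrier_quotFv {δ t : ℝ} (hδ : 0 < δ) (ht : |t| < 1) :
    IsBarrier (fun s => quotFv s t + δ * (fv s - fv t)) where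
  mono s hs s' hs' hss := by
    have h1 := quotFv_monotoneOn (abs_lt.mp ht) hs hs' hss
    have h2 := mul_le_mul_of_nonneg_left (fv_monotoneOn hs hs' hss) hδ.le
    simp only at h1 ⊢
    linarith
  lip r hr := by
    obtain ⟨ρ, hρ1, htρ, hsub, hK⟩ := exists_between_abs hr ht
    have hIoo : Ioo (-ρ) ρ ⊆ Ioo (-1 : ℝ) 1 := Ioo_subset_Ioo (by linarith) hρ1.le
    refine ⟨(1 - ρ ^ 2)⁻¹ / 2 + δ * (1 - ρ ^ 2)⁻¹, by positivity, fun s hs s' hs' => ?_⟩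
    have h1 := abs_sub_le_of_monotoneOn (fv_monotoneOn.mono hIoo) (monotoneOn_linear_sub_fv hρ1)
      (hsub hs) (hsub hs')
    have h2 := abs_sub_le_of_monotoneOn ((quotFv_monotoneOn (abs_lt.mp ht)).mono hIoo)
      (monotoneOn_linear_sub_quotFv hρ1 htρ) (hsub hs) (hsub hs')
    calc |quotFv s t + δ * (fv s - fv t) - (quotFv s' t + δ * (fv s' - fv t))|
        = |(quotFv s t - quotFv s' t) + δ * (fv s - fv s')| := by ring_nf
      _ ≤ |quotFv s t - quotFv s' t| + |δ * (fv s - fv s')| := abs_add_le _ _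
      _ ≤ (1 - ρ ^ 2)⁻¹ / 2 * |s - s'| + δ * ((1 - ρ ^ 2)⁻¹ * |s - s'|) := by
        rw [abs_mul, abs_of_pos hδ]
        gcongr
      _ = _ := by ring
  top := by
    have h1 : Tendsto (fun s => δ * (fv s - fv t)) (𝓝[<] 1) atTop :=
      (tendsto_atTop_add_const_right _ (-fv t) tendsto_fv).const_mul_atTop hδ
    refine tendsto_atTop_add_left_of_le' _ (quotFv 0 t) ?_ h1
    filter_upwards [Ioo_mem_nhdsLT (zero_lt_one (α := ℝ))] with s hs
    exact quotFv_monotoneOn (abs_lt.mp ht) (by simp) ⟨by linarith [hs.1], hs.2⟩ hs.1.le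
  bot := by
    have h0 : Tendsto (fun s => -fv s + -fv t) (𝓝[<] 1) atBot :=
      tendsto_atBot_add_const_right _ (-fv t) (tendsto_neg_atTop_atBot.comp tendsto_fv)
    have h1 : Tendsto (fun s => δ * (fv (-s) - fv t)) (𝓝[<] 1) atBot := by
      simp only [fv_neg]
      exact h0.const_mul_atBot hδ
    refine tendsto_atBot_add_left_of_ge' _ (quotFv 0 t) ?_ h1
    filter_upwards [Ioo_mem_nhdsLT (zero_lt_one (α := ℝ))] with s hs
    exact quotFv_monotoneOn (abs_lt.mp ht) ⟨by linarith [hs.2], by linarith [hs.1]⟩ (by simp)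
      (by linarith [hs.1])

lemma quotFv_mul_sub (s t : ℝ) : quotFv s t * (s - t) = Fv s - Fv t := by
  rw [quotFv]
  split_ifs with h
  · simp [h]
  · rw [div_mul_cancel₀ _ (sub_ne_zero.mpr h)]

lemma trunc_mem (s : ℝ) : trunc s ∈ Icc (-1 : ℝ) 1 :=
  ⟨le_max_left _ _, max_le (by norm_num) (min_le_left _ _)⟩

lemma Params.η_pos (P : Params) {s : ℝ} (hs : s ∈ Icc (-1 : ℝ) 1) : 0 < P.η s := by
  have h := div_pos P.η₂_pos P.η₁_pos
  rw [Params.η]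
  rcases eq_or_lt_of_le hs.1 with h1 | h1
  · rw [← h1]; norm_num
  · have h2 := mul_pos (by linarith : 0 < (1 + s) / 2) h
    linarith [hs.2]

lemma Params.M_pos (P : Params) {s : ℝ} (hs : s ∈ Icc (-1 : ℝ) 1) : 0 < P.M s :=
  P.m₁_pos.trans_le (P.M_bounds s hs).1

end Potential

/-! ### Abstract forms of the discrete systems -/

section Abstract

/-- A saddle point problem in finite dimensions with a definite form `D` on the primal space is
uniquely solvable if the constraint form `B` is injective in the multiplier. -/
theorem existsUnique_saddle {X Q : Type*} [AddCommGroup X] [Module ℝ X] [FiniteDimensional ℝ X]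
    [AddCommGroup Q] [Module ℝ Q] [FiniteDimensional ℝ Q]
    (D : X →ₗ[ℝ] X →ₗ[ℝ] ℝ) (hD : ∀ u, u ≠ 0 → 0 < D u u)
    (B : Q →ₗ[ℝ] X →ₗ[ℝ] ℝ) (hB : ∀ p, (∀ v, B p v = 0) → p = 0) (R : X →ₗ[ℝ] ℝ) :
    ∃! t : X × Q, (∀ v, D t.1 v + B t.2 v = R v) ∧ ∀ q, B q t.1 = 0 := by
  let Φ : X × Q →ₗ[ℝ] Module.Dual ℝ X × Module.Dual ℝ Q :=
    (D.coprod B).prod (B.flip ∘ₗ LinearMap.fst ℝ X Q)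
  have hinj : Function.Injective Φ := by
    rw [injective_iff_map_eq_zero]
    rintro ⟨u, p⟩ h
    have h1 : ∀ v, D u v + B p v = 0 := fun v => congrArg (fun L => L.1 v) h
    have h2 : ∀ q, B q u = 0 := fun q => congrArg (fun L => L.2 q) h
    have hu : u = 0 := by
      by_contra hu
      have := hD u hu
      have := h1 u
      rw [h2 p] at this
      linarith
    subst hu
    have hp : p = 0 := hB p fun v => by simpa using h1 v
    rw [hp]; rfl
  have hsurj : Function.Surjective Φ := by
    refine (LinearMap.injective_iff_surjective_of_finrank_eq_finrank ?_).mp hinj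
    rw [Module.finrank_prod, Module.finrank_prod, Subspace.dual_finrank_eq,
      Subspace.dual_finrank_eq]
  obtain ⟨t, ht⟩ := hsurj (R, 0)
  refine ⟨t, ⟨fun v => congrArg (fun L => L.1 v) ht, fun q => congrArg (fun L => L.2 q) ht⟩, ?_⟩
  rintro t' ⟨h1, h2⟩
  refine hinj (Eq.trans ?_ ht.symm)
  exact Prod.ext (LinearMap.ext h1) (LinearMap.ext h2)

/-- The nodal bilinear form with weights `ω`. -/
def nodalForm {Y ι : Type*} [AddCommGroup Y] [Module ℝ Y] [Fintype ι]
    (ω : ι → ℝ) (e : ι → Y →ₗ[ℝ] ℝ) : Y →ₗ[ℝ] Y →ₗ[ℝ] ℝ :=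
  ∑ i, ω i • (e i).smulRight (e i)

lemma nodalForm_apply {Y ι : Type*} [AddCommGroup Y] [Module ℝ Y] [Fintype ι]
    (ω : ι → ℝ) (e : ι → Y →ₗ[ℝ] ℝ) (u v : Y) :
    nodalForm ω e u v = ∑ i, ω i * (e i u * e i v) := by
  simp [nodalForm, LinearMap.sum_apply]

/-- The system solved in each time step: a phase equation, a chemical potential equation with nodal
barrier terms, and a linear equation for a velocity. Splitting the mean values off `φ₁` and `μ`
leaves one equation for the triple of unknowns; testing it with the solution itself, the coupling
terms cancel, so that its bilinear form is positive definite. -/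
theorem existsUnique_cahnHilliard {Y X ι : Type*} [AddCommGroup Y] [Module ℝ Y]
    [FiniteDimensional ℝ Y] [AddCommGroup X] [Module ℝ X] [FiniteDimensional ℝ X] [Fintype ι]
    [Nonempty ι] (ω : ι → ℝ) (hω : ∀ i, 0 < ω i) (e : ι → Y →ₗ[ℝ] ℝ) (one : Y)
    (he : ∀ i, e i one = 1) (K E : Y →ₗ[ℝ] Y →ₗ[ℝ] ℝ)
    (hK1 : ∀ v, K v one = 0) (hK1' : ∀ v, K one v = 0) (hK : ∀ v, 0 ≤ K v v)
    (hKd : ∀ v, K v v = 0 → ∃ a : ℝ, v = a • one)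
    (hE1 : ∀ v, E v one = 0) (hE1' : ∀ v, E one v = 0) (hE : ∀ v, 0 ≤ E v v)
    (hEd : ∀ v, E v v = 0 → ∃ a : ℝ, v = a • one)
    (C : X →ₗ[ℝ] Y →ₗ[ℝ] ℝ) (hC : ∀ u, C u one = 0)
    (D : X →ₗ[ℝ] X →ₗ[ℝ] ℝ) (hD : ∀ u, u ≠ 0 → 0 < D u u) {c : ℝ} (hc : 0 < c)
    (φ : Y) (hφ : |∑ i, ω i * e i φ| < ∑ i, ω i) (F H : Y →ₗ[ℝ] ℝ) (hF : F one = 0)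
    (R : X →ₗ[ℝ] ℝ) (g : ι → ℝ → ℝ) (hg : ∀ i, IsBarrier (g i)) :
    ∃! t : Y × Y × X, (∀ i, |e i t.1| < 1) ∧
      (∀ v, nodalForm ω e (t.1 - φ) v + K t.2.1 v - C t.2.2 v = F v) ∧
      (∀ ψ, nodalForm ω e t.2.1 ψ =
        ∑ i, ω i * (g i (e i t.1) * e i ψ) + H ψ + E t.1 ψ) ∧
      ∀ w, D t.2.2 w + c * C w t.2.1 = R w := by
  set S := nodalForm ω e with hS
  have hSsymm : ∀ u v, S u v = S v u := fun u v => by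
    simp only [hS, nodalForm_apply, mul_comm (e _ u)]
  have hSone : ∀ v, S one v = ∑ i, ω i * e i v := fun v => by
    simp [hS, nodalForm_apply, he]
  set a := S one one with ha
  have ha' : a = ∑ i, ω i := by rw [ha, hSone]; simp [he]
  have ha0 : 0 < a := by
    rw [ha']; exact Finset.sum_pos (fun i _ => hω i) Finset.univ_nonempty
  set V : Submodule ℝ Y := LinearMap.ker (S one) with hV
  have hVm : ∀ v : V, S one v.1 = 0 := fun v => v.2
  have hVm' : ∀ v : V, S v.1 one = 0 := fun v => by rw [hSsymm]; exact v.2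
  set m := S one φ / a with hm
  have hm1 : |m| < 1 := by
    rw [hm, abs_div, abs_of_pos ha0, div_lt_one ha0, hSone, ha']
    exact hφ
  have hdef : ∀ v : V, (∃ b : ℝ, v.1 = b • one) → v = 0 := by
    rintro v ⟨b, hb⟩
    have h := hVm v
    rw [hb, map_smul, smul_eq_mul] at h
    rw [(mul_eq_zero.mp h).resolve_right ha0.ne', zero_smul] at hb
    exact Subtype.ext hb
  let A : (V × V × X) →ₗ[ℝ] (V × V × X) →ₗ[ℝ] ℝ := LinearMap.mk₂ ℝ
    (fun x y => E x.1.1 y.1.1 - S x.2.1.1 y.1.1 + S x.1.1 y.2.1.1 + K x.2.1.1 y.2.1.1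
      - C x.2.2 y.2.1.1 + c⁻¹ * D x.2.2 y.2.2 + C y.2.2 x.2.1.1)
    (fun x x' y => by
      simp only [Prod.fst_add, Prod.snd_add, Submodule.coe_add, map_add, LinearMap.add_apply]
      ring)
    (fun r x y => by
      simp only [Prod.smul_fst, Prod.smul_snd, Submodule.coe_smul, map_smul, LinearMap.smul_apply,
        smul_eq_mul]
      ring)
    (fun x y y' => by
      simp only [Prod.fst_add, Prod.snd_add, Submodule.coe_add, map_add, LinearMap.add_apply]
      ring)
    (fun r x y => by
      simp only [Prod.smul_fst, Prod.smul_snd, Submodule.coe_smul, map_smul, LinearMap.smul_apply,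
        smul_eq_mul]
      ring)
  have hA : ∀ x y : V × V × X, A x y = E x.1.1 y.1.1 - S x.2.1.1 y.1.1 + S x.1.1 y.2.1.1
      + K x.2.1.1 y.2.1.1 - C x.2.2 y.2.1.1 + c⁻¹ * D x.2.2 y.2.2 + C y.2.2 x.2.1.1 :=
    fun x y => rfl
  have hApos : ∀ x, x ≠ 0 → 0 < A x x := by
    rintro ⟨ψ, ν, u⟩ hx
    rw [hA]
    simp only
    rw [hSsymm ν.1 ψ.1]
    have h1 := hE ψ.1
    have h2 := hK ν.1
    have h3 : 0 ≤ c⁻¹ * D u u := by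
      refine mul_nonneg (inv_pos.mpr hc).le ?_
      by_cases h : u = 0
      · simp [h]
      · exact (hD u h).le
    by_contra hcon
    refine hx (Prod.ext (hdef ψ (hEd _ (by linarith)))
      (Prod.ext (hdef ν (hKd _ (by linarith))) ?_))
    by_contra hu
    have := mul_pos (inv_pos.mpr hc) (hD u hu)
    linarith
  let ℓ : (V × V × X) →ₗ[ℝ] ℝ :=
    LinearMap.coprod (-(H ∘ₗ V.subtype))
      (LinearMap.coprod ((S (φ - m • one) + F) ∘ₗ V.subtype) (c⁻¹ • R))
  have hℓ : ∀ y : V × V × X, ℓ y = -H y.1.1 + (S (φ - m • one) y.2.1.1 + F y.2.1.1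
      + c⁻¹ * R y.2.2) := fun y => rfl
  obtain ⟨x, ⟨hx1, hx⟩, huniq⟩ := existsUnique_of_isBarrier A hApos ℓ ω hω
    (fun i => e i ∘ₗ V.subtype ∘ₗ LinearMap.fst ℝ V (V × X)) hm1 g hg
  -- The reduced equation splits into the three equations with mean-zero test functions.
  have hiff : ∀ x : V × V × X,
      (∀ y, A x y + ∑ i, ω i * g i (m + e i x.1.1) * e i y.1.1 = ℓ y) ↔
      (∀ χ : V, S x.2.1.1 χ.1 = ∑ i, ω i * (g i (m + e i x.1.1) * e i χ.1) + H χ.1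
        + E x.1.1 χ.1) ∧
      (∀ v : V, S (x.1.1 + m • one - φ) v.1 + K x.2.1.1 v.1 - C x.2.2 v.1 = F v.1) ∧
      ∀ w, D x.2.2 w + c * C w x.2.1.1 = R w := by
    intro x
    have hφ' : ∀ v : Y, S (x.1.1 + m • one - φ) v = S x.1.1 v - S (φ - m • one) v := fun v => by
      simp only [map_add, map_sub, map_smul, LinearMap.add_apply, LinearMap.sub_apply]; ring
    constructor
    · intro h
      refine ⟨fun χ => ?_, fun v => ?_, fun w => ?_⟩
      · have := h (χ, 0, 0)
        rw [hA, hℓ] at this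
        simp only [Submodule.coe_zero, map_zero, LinearMap.zero_apply, mul_zero, add_zero,
          sub_zero] at this
        simp only [mul_assoc] at this
        linarith
      · have := h (0, v, 0)
        rw [hA, hℓ] at this
        simp only [Submodule.coe_zero, map_zero, LinearMap.zero_apply, mul_zero, add_zero,
          sub_zero, Finset.sum_const_zero] at this
        rw [hφ']
        linarith
      · have := h (0, 0, w)
        rw [hA, hℓ] at this
        simp only [Submodule.coe_zero, map_zero, mul_zero, add_zero,
          sub_zero, Finset.sum_const_zero] at this
        field_simp at this
        linarith
    · rintro ⟨h1, h2, h3⟩ ⟨χ, v, w⟩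
      have e1 := h1 χ
      have e2 := h2 v
      have e3 := h3 w
      rw [hφ'] at e2
      rw [hA, hℓ]
      simp only [mul_assoc]
      rw [← e3, mul_add, inv_mul_cancel_left₀ hc.ne']
      linarith
  have hsplit : ∀ y : Y, ∃ (b : ℝ) (v : V), y = v.1 + b • one := by
    intro y
    refine ⟨S one y / a, ⟨y - (S one y / a) • one, ?_⟩, by simp⟩
    rw [hV, LinearMap.mem_ker, map_sub, map_smul, smul_eq_mul, ← ha, div_mul_cancel₀ _ ha0.ne',
      sub_self]
  have hmφ : S φ one = m * a := by rw [hSsymm, hm, div_mul_cancel₀ _ ha0.ne']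
  have hem : ∀ (v : V) i, e i (v.1 + m • one) = m + e i v.1 := fun v i => by
    rw [map_add, map_smul, he, smul_eq_mul, mul_one, add_comm]
  obtain ⟨hx2, hx3, hx4⟩ := (hiff x).mp hx
  set b := (∑ i, ω i * g i (m + e i x.1.1) + H one) / a with hb
  refine ⟨(x.1.1 + m • one, x.2.1.1 + b • one, x.2.2), ⟨fun i => ?_, fun y => ?_, fun y => ?_,
    fun w => ?_⟩, ?_⟩
  · rw [hem]; exact hx1 i
  · obtain ⟨r, v, rfl⟩ := hsplit y
    have h1 := hx3 v
    have h2 : S (x.1.1 + m • one - φ) one = 0 := by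
      rw [map_sub, map_add, map_smul, LinearMap.sub_apply, LinearMap.add_apply,
        LinearMap.smul_apply, hmφ, hVm' x.1, smul_eq_mul, ← ha]
      ring
    simp only [map_add, map_smul, LinearMap.add_apply, LinearMap.smul_apply, smul_eq_mul, hK1,
      hK1', hC, hF, mul_zero, add_zero] at h1 ⊢
    rw [h2, mul_zero, add_zero]
    exact h1
  · obtain ⟨r, v, rfl⟩ := hsplit y
    have h1 := hx2 v
    simp only [hem]
    simp only [map_add, map_smul, LinearMap.add_apply, LinearMap.smul_apply, smul_eq_mul, hE1,
      hE1', he, mul_zero, mul_one, add_zero, hVm, hVm', zero_add, h1, mul_add,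
      Finset.sum_add_distrib]
    have h2 : b * a = ∑ i, ω i * g i (m + e i x.1.1) + H one := div_mul_cancel₀ _ ha0.ne'
    have h3 : ∑ i, ω i * (g i (m + e i x.1.1) * r) = (∑ i, ω i * g i (m + e i x.1.1)) * r := by
      rw [Finset.sum_mul]; simp only [mul_assoc]
    rw [h3, ← ha]
    linear_combination r * h2
  · have := hx4 w
    simpa [hC] using this
  · -- Every solution has the mean value of `φ`, hence comes from the reduced equation.
    rintro ⟨φ₁, μ, u⟩ ⟨h1, h2, h3, h4⟩
    simp only at h1 h2 h3 h4
    obtain ⟨r, ψ, rfl⟩ := hsplit φ₁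
    obtain ⟨s, ν, rfl⟩ := hsplit μ
    have hr : r = m := by
      have := h2 one
      rw [hK1, hC, hF, map_sub, map_add, map_smul, LinearMap.sub_apply, LinearMap.add_apply,
        LinearMap.smul_apply, hmφ, hVm' ψ, smul_eq_mul, ← ha] at this
      have : (r - m) * a = 0 := by linarith
      exact sub_eq_zero.mp ((mul_eq_zero.mp this).resolve_right ha0.ne')
    subst r
    simp only [hem] at h1 h3
    have hsol : (ψ, ν, u) = x := by
      refine huniq (ψ, ν, u) ⟨h1, (hiff (ψ, ν, u)).mpr ⟨fun χ => ?_, fun v => ?_, fun w => ?_⟩⟩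
      · have := h3 χ.1
        simpa [hVm, hE1'] using this
      · have := h2 v.1
        simpa [hK1'] using this
      · have := h4 w
        simpa [hC] using this
    have hs : s = b := by
      have := h3 one
      simp only [map_add, map_smul, LinearMap.add_apply, LinearMap.smul_apply, smul_eq_mul, hE1,
        he, mul_one, mul_zero, add_zero, hVm', zero_add, ← ha] at this
      rw [hb, ← hsol, ← this, mul_div_cancel_right₀ _ ha0.ne']
    rw [← hsol, hs]

end Abstract

/-! ### Bounded functions and piecewise derivatives -/

section Calculus

variable (G : RectGrid)

/-- The Lebesgue measure on the domain. -/
noncomputable abbrev RectGrid.vol : Measure (ℝ × ℝ) := volume.restrict G.dom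

instance RectGrid.isFiniteMeasure_vol : IsFiniteMeasure G.vol :=
  ⟨by rw [Measure.restrict_apply_univ]; exact G.isCompact_dom.measure_lt_top⟩

/-- The algebra of essentially bounded functions on the domain. All factors of the integrands of the
scheme belong to it, so that all integrals converge and every form is a linear functional applied
to a product. -/
noncomputable def RectGrid.bdd : Subalgebra ℝ (ℝ × ℝ → ℝ) where
  carrier := {f | MemLp f ⊤ G.vol}
  mul_mem' hf hg := MemLp.mul' (p := ⊤) (q := ⊤) (r := ⊤) hg hf
  add_mem' hf hg := MemLp.add hf hg
  algebraMap_mem' r := memLp_top_const r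

lemma RectGrid.mem_bdd {f : ℝ × ℝ → ℝ} : f ∈ G.bdd ↔ MemLp f ⊤ G.vol := Iff.rfl

lemma RectGrid.integrable_bdd (f : G.bdd) : Integrable f.1 G.vol :=
  ((G.mem_bdd).mp f.2).integrable le_top

/-- The integral over the domain, as a linear functional on bounded functions. -/
noncomputable def RectGrid.integ : G.bdd →ₗ[ℝ] ℝ where
  toFun f := ∫ z in G.dom, f.1 z
  map_add' f g := integral_add (G.integrable_bdd f) (G.integrable_bdd g)
  map_smul' r _ := integral_const_mul r _

lemma RectGrid.integ_nonneg_of_ae {f : G.bdd} (h : ∀ᵐ z ∂G.vol, 0 ≤ f.1 z) : 0 ≤ G.integ f :=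
  integral_nonneg_of_ae h

lemma RectGrid.mem_bdd_of_continuousOn {f : ℝ × ℝ → ℝ} (hf : ContinuousOn f G.dom) :
    f ∈ G.bdd := by
  obtain ⟨C, hC⟩ := G.isCompact_dom.exists_bound_of_continuousOn hf
  exact MemLp.of_bound (hf.aestronglyMeasurable G.isCompact_dom.measurableSet) C
    ((ae_restrict_mem G.isCompact_dom.measurableSet).mono hC)

variable {G}

/-- A finite element function as a bounded function. -/
noncomputable def femBdd {m : ℕ} : femSpace G m →ₗ[ℝ] G.bdd where
  toFun f := ⟨f.1, G.mem_bdd_of_continuousOn f.2.1⟩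
  map_add' _ _ := rfl
  map_smul' _ _ := rfl

variable (G) in
/-- The interior of the cell `c`. -/
def RectGrid.openCell (c : Fin G.nx × Fin G.ny) : Set (ℝ × ℝ) :=
  Ioo (G.x c.1.castSucc) (G.x c.1.succ) ×ˢ Ioo (G.y c.2.castSucc) (G.y c.2.succ)

variable (G) in
/-- The union of the interiors of all cells. -/
def RectGrid.interiors : Set (ℝ × ℝ) := ⋃ c, G.openCell c

lemma RectGrid.x_lt (i : Fin G.nx) : G.x i.castSucc < G.x i.succ :=
  G.x_mono Fin.castSucc_lt_succ

lemma RectGrid.y_lt (j : Fin G.ny) : G.y j.castSucc < G.y j.succ :=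
  G.y_mono Fin.castSucc_lt_succ

lemma RectGrid.isOpen_openCell (c) : IsOpen (G.openCell c) := isOpen_Ioo.prod isOpen_Ioo

lemma RectGrid.openCell_subset_cell (c) : G.openCell c ⊆ G.cell c :=
  Set.prod_mono Ioo_subset_Icc_self Ioo_subset_Icc_self

lemma RectGrid.openCell_ae_eq_cell (c) : G.openCell c =ᵐ[volume] G.cell c :=
  Measure.set_prod_ae_eq Ioo_ae_eq_Icc Ioo_ae_eq_Icc

lemma RectGrid.closure_openCell (c) : closure (G.openCell c) = G.cell c := by
  rw [openCell, closure_prod_eq, closure_Ioo (G.x_lt _).ne, closure_Ioo (G.y_lt _).ne, cell]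

lemma RectGrid.ae_mem_interiors : ∀ᵐ z ∂G.vol, z ∈ G.interiors := by
  rw [RectGrid.vol, G.dom_eq_iUnion, ae_restrict_iUnion_iff]
  intro c
  rw [← Measure.restrict_congr_set (G.openCell_ae_eq_cell c)]
  filter_upwards [ae_restrict_mem (G.isOpen_openCell c).measurableSet] with z hz
  exact mem_iUnion.mpr ⟨c, hz⟩

/-- The polynomial with which a finite element function agrees on a cell. -/
lemma exists_cellPoly {m : ℕ} (f : femSpace G m) (c) : ∃ P : ℝ × ℝ → ℝ, ContDiff ℝ 1 P ∧
    (∀ z ∈ G.cell c, f.1 z = P z) ∧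
    ∀ z ∈ G.openCell c, f.1 =ᶠ[nhds z] P := by
  obtain ⟨a, ha⟩ := f.2.2.2 c
  refine ⟨fun z => ∑ i, ∑ j, a i j * (z.1 ^ (i : ℕ) * z.2 ^ (j : ℕ)), by fun_prop, ha, ?_⟩
  intro z hz
  filter_upwards [(G.isOpen_openCell c).mem_nhds hz] with w hw
  exact ha w (G.openCell_subset_cell c hw)

lemma differentiableAt_of_mem_interiors {m : ℕ} (f : femSpace G m) {z : ℝ × ℝ}
    (hz : z ∈ G.interiors) : DifferentiableAt ℝ f.1 z := by
  obtain ⟨c, hc⟩ := mem_iUnion.mp hz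
  obtain ⟨P, hP, -, h⟩ := exists_cellPoly f c
  exact ((hP.differentiable one_ne_zero) z).congr_of_eventuallyEq (h z hc)

open Classical in
/-- The directional derivative of a finite element function in the interiors of the cells, extended
by zero. In contrast to `fderiv`, which takes junk values on the grid lines, it is linear in `f`
everywhere. -/
noncomputable def dirDeriv {m : ℕ} (e : ℝ × ℝ) : femSpace G m →ₗ[ℝ] G.bdd where
  toFun f := ⟨fun z => if z ∈ G.interiors then fderiv ℝ f.1 z e else 0, by
    have hae : (fun z => if z ∈ G.interiors then fderiv ℝ f.1 z e else 0)
        =ᵐ[G.vol] fun z => fderiv ℝ f.1 z e := by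
      filter_upwards [G.ae_mem_interiors] with z hz
      rw [if_pos hz]
    refine (memLp_congr_ae hae).mpr ?_
    have hmeas : AEStronglyMeasurable (fun z => fderiv ℝ f.1 z e) G.vol := by
      have := (fderiv_mul_integrableOn f.2 (g := fun _ => 1) continuousOn_const e)
      simpa using this.aestronglyMeasurable
    have hcell : ∀ c, ∃ C : ℝ, ∀ z ∈ G.openCell c, ‖fderiv ℝ f.1 z e‖ ≤ C := by
      intro c
      obtain ⟨P, hP, -, h⟩ := exists_cellPoly f c
      obtain ⟨C, hC⟩ := (isCompact_Icc.prod isCompact_Icc :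
        IsCompact (G.cell c)).exists_bound_of_continuousOn (f := fun z => fderiv ℝ P z e)
        ((hP.continuous_fderiv one_ne_zero).clm_apply continuous_const).continuousOn
      refine ⟨C, fun z hz => ?_⟩
      rw [(h z hz).fderiv_eq]
      exact hC z (G.openCell_subset_cell c hz)
    choose C hC using hcell
    refine MemLp.of_bound hmeas (∑ c, |C c|) ?_
    filter_upwards [G.ae_mem_interiors] with z hz
    obtain ⟨c, hc⟩ := mem_iUnion.mp hz
    refine ((hC c z hc).trans (le_abs_self _)).trans ?_
    exact Finset.single_le_sum (f := fun c => |C c|) (fun _ _ => abs_nonneg _)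
      (Finset.mem_univ c)⟩
  map_add' f g := by
    ext z
    by_cases hz : z ∈ G.interiors
    · have := fderiv_add (differentiableAt_of_mem_interiors f hz)
        (differentiableAt_of_mem_interiors g hz)
      simp [hz, this]
    · simp [hz]
  map_smul' r f := by
    ext z
    by_cases hz : z ∈ G.interiors
    · have := fderiv_const_smul (differentiableAt_of_mem_interiors f hz) r
      simp [hz, this]
    · simp [hz]

lemma dirDeriv_apply {m : ℕ} (e : ℝ × ℝ) (f : femSpace G m) {z : ℝ × ℝ} (hz : z ∈ G.interiors) :
    (dirDeriv e f).1 z = fderiv ℝ f.1 z e := if_pos hz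

lemma dirDeriv_ae {m : ℕ} (e : ℝ × ℝ) (f : femSpace G m) :
    (fun z => fderiv ℝ f.1 z e) =ᵐ[G.vol] (dirDeriv e f).1 := by
  filter_upwards [G.ae_mem_interiors] with z hz
  rw [dirDeriv_apply e f hz]

/-- The partial derivative in the first variable. -/
noncomputable abbrev dX {m : ℕ} : femSpace G m →ₗ[ℝ] G.bdd := dirDeriv (1, 0)

/-- The partial derivative in the second variable. -/
noncomputable abbrev dY {m : ℕ} : femSpace G m →ₗ[ℝ] G.bdd := dirDeriv (0, 1)

lemma fderiv_ext_zero {L : ℝ × ℝ →L[ℝ] ℝ} (h1 : L (1, 0) = 0) (h2 : L (0, 1) = 0) : L = 0 := by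
  ext <;> simp [h1, h2]

/-- A continuous function that is constant on every cell is constant, because the domain is
connected and the function takes finitely many values. -/
lemma eq_of_const_on_cells {m : ℕ} (f : femSpace G m)
    (h : ∀ c, ∃ a, ∀ z ∈ G.cell c, f.1 z = a) : ∃ a, ∀ z ∈ G.dom, f.1 z = a := by
  choose a ha using h
  have hfin : (f.1 '' G.dom).Countable := by
    refine ((Set.finite_range a).subset ?_).countable
    rintro _ ⟨z, hz, rfl⟩
    rw [G.dom_eq_iUnion] at hz
    obtain ⟨c, hc⟩ := mem_iUnion.mp hz
    exact ⟨c, (ha c z hc).symm⟩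
  have hconn : IsPreconnected (f.1 '' G.dom) :=
    (isPreconnected_Icc.prod isPreconnected_Icc).image f.1 f.2.1
  have hsub := hfin.isTotallyDisconnected _ subset_rfl hconn
  by_cases hne : G.dom.Nonempty
  · obtain ⟨z₀, hz₀⟩ := hne
    exact ⟨f.1 z₀, fun z hz => hsub (mem_image_of_mem _ hz) (mem_image_of_mem _ hz₀)⟩
  · exact ⟨0, fun z hz => absurd ⟨z, hz⟩ hne⟩

lemma eq_const_of_dirDeriv_eq_zero {m : ℕ} (f : femSpace G m)
    (h1 : ∀ᵐ z ∂G.vol, (dX f).1 z = 0) (h2 : ∀ᵐ z ∂G.vol, (dY f).1 z = 0) :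
    ∃ a, ∀ z ∈ G.dom, f.1 z = a := by
  refine eq_of_const_on_cells f fun c => ?_
  obtain ⟨P, hP, hPc, hPn⟩ := exists_cellPoly f c
  have hsub : G.openCell c ⊆ G.dom := (G.openCell_subset_cell c).trans (G.cell_subset c)
  have hsubI : G.openCell c ⊆ G.interiors := subset_iUnion _ c
  have key : ∀ e : ℝ × ℝ, (∀ᵐ z ∂G.vol, (dirDeriv e f).1 z = 0) →
      ∀ z ∈ G.openCell c, fderiv ℝ P z e = 0 := by
    intro e he
    have h0 : (fun z => fderiv ℝ P z e) =ᵐ[volume.restrict (G.openCell c)] fun _ => 0 := by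
      filter_upwards [ae_restrict_of_ae_restrict_of_subset hsub he,
        ae_restrict_mem (G.isOpen_openCell c).measurableSet] with z hz hzc
      rw [← (hPn z hzc).fderiv_eq, ← dirDeriv_apply e f (hsubI hzc), hz]
    exact Measure.eqOn_open_of_ae_eq h0 (G.isOpen_openCell c)
      ((hP.continuous_fderiv one_ne_zero).clm_apply continuous_const).continuousOn
      continuousOn_const
  have hder : ∀ z ∈ G.openCell c, fderiv ℝ P z = 0 := fun z hz =>
    fderiv_ext_zero (key _ h1 z hz) (key _ h2 z hz)
  have hconn : IsPreconnected (G.openCell c) := isPreconnected_Ioo.prod isPreconnected_Ioo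
  obtain ⟨a, ha⟩ := (G.isOpen_openCell c).exists_is_const_of_fderiv_eq_zero hconn
    (hP.differentiable one_ne_zero).differentiableOn hder
  refine ⟨a, fun z hz => ?_⟩
  rw [hPc z hz]
  have : EqOn P (fun _ => a) (closure (G.openCell c)) :=
    Set.EqOn.closure (fun z hz => ha z hz) hP.continuous continuous_const
  rw [G.closure_openCell] at this
  exact this hz

variable (G) in
/-- The constant function `1` on the domain as a finite element function. -/
noncomputable def femOne (m : ℕ) : femSpace G m :=
  ⟨G.dom.indicator fun _ => 1,
    (continuousOn_const (c := (1 : ℝ))).congr fun z hz => by simp [hz],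
    fun z hz => by simp [hz],
    fun c => ⟨fun i j => if i = 0 ∧ j = 0 then 1 else 0, fun z hz => by
      rw [indicator_of_mem (G.cell_subset c hz), Finset.sum_eq_single 0, Finset.sum_eq_single 0]
      · simp
      · intro j _ hj; simp [hj]
      · simp
      · intro i _ hi; simp [hi]
      · simp⟩⟩

lemma femOne_apply {m : ℕ} {z : ℝ × ℝ} (hz : z ∈ G.dom) : (femOne G m).1 z = 1 :=
  indicator_of_mem hz (fun _ => (1 : ℝ))

lemma eq_smul_femOne {m : ℕ} (f : femSpace G m) {a : ℝ} (h : ∀ z ∈ G.dom, f.1 z = a) :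
    f = a • femOne G m := by
  ext z
  by_cases hz : z ∈ G.dom
  · simp [h z hz, femOne_apply hz]
  · rw [f.2.2.1 z hz, (a • femOne G m).2.2.1 z hz]

lemma RectGrid.interiors_subset_dom : G.interiors ⊆ interior G.dom :=
  iUnion_subset fun c => (interior_maximal ((G.openCell_subset_cell c).trans (G.cell_subset c))
    (G.isOpen_openCell c))

lemma dirDeriv_femOne (m : ℕ) (e : ℝ × ℝ) : dirDeriv e (femOne G m) = 0 := by
  ext z
  by_cases hz : z ∈ G.interiors
  · rw [dirDeriv_apply e _ hz]
    have : (femOne G m).1 =ᶠ[nhds z] fun _ => 1 := by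
      filter_upwards [isOpen_interior.mem_nhds (G.interiors_subset_dom hz)] with w hw
      exact femOne_apply (interior_subset hw)
    rw [this.fderiv_eq]
    simp
  · exact if_neg hz

end Calculus

/-! ### Integration by parts -/

section Parts

variable {G : RectGrid}

/-- Fundamental theorem of calculus on horizontal lines: the integral over a rectangle of the
derivative in the first variable of a function that vanishes on the vertical sides is zero. The
derivative need not exist on finitely many grid lines. -/
lemma integral_eq_zero_of_hasDerivAt_fst {g F : ℝ × ℝ → ℝ} {a b c d : ℝ} (hab : a ≤ b)
    {S T : Set ℝ} (hS : S.Countable) (hT : T.Countable)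
    (hg : IntegrableOn g (Icc a b ×ˢ Icc c d))
    (hF : ∀ y ∈ Icc c d, ContinuousOn (fun x => F (x, y)) (Icc a b))
    (h0 : ∀ y ∈ Icc c d, F (a, y) = 0 ∧ F (b, y) = 0)
    (hd : ∀ y ∈ Icc c d, y ∉ T → ∀ x ∈ Icc a b, x ∉ S →
      HasDerivAt (fun x => F (x, y)) (g (x, y)) x) :
    ∫ z in Icc a b ×ˢ Icc c d, g z = 0 := by
  have hprod : (volume : Measure (ℝ × ℝ)).restrict (Icc a b ×ˢ Icc c d)
      = ((volume : Measure ℝ).restrict (Icc a b)).prod (volume.restrict (Icc c d)) := by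
    rw [Measure.prod_restrict]; rfl
  rw [IntegrableOn, hprod] at hg
  rw [hprod, integral_prod_symm _ hg]
  refine integral_eq_zero_of_ae ?_
  have hTae : ∀ᵐ y ∂(volume.restrict (Icc c d) : Measure ℝ), y ∉ T :=
    ae_restrict_of_ae (measure_eq_zero_iff_ae_notMem.mp (hT.measure_zero volume))
  filter_upwards [hg.prod_left_ae, ae_restrict_mem measurableSet_Icc, hTae] with y hy hyI hyT
  have hint : IntervalIntegrable (fun x => g (x, y)) volume a b := by
    rw [intervalIntegrable_iff_integrableOn_Icc_of_le hab]
    exact hy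
  have h := integral_eq_of_hasDerivAt_off_countable (fun x => F (x, y)) (fun x => g (x, y)) hS
    (by rw [uIcc_of_le hab]; exact hF y hyI)
    (fun x hx => by
      rw [min_eq_left hab, max_eq_right hab] at hx
      exact hd y hyI hyT x (Ioo_subset_Icc_self hx.1) hx.2) hint
  rw [(h0 y hyI).1, (h0 y hyI).2, sub_zero, intervalIntegral.integral_of_le hab] at h
  rw [integral_Icc_eq_integral_Ioc]
  exact h

lemma integral_eq_zero_of_hasDerivAt_snd {g F : ℝ × ℝ → ℝ} {a b c d : ℝ} (hcd : c ≤ d)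
    {S T : Set ℝ} (hS : S.Countable) (hT : T.Countable)
    (hg : IntegrableOn g (Icc a b ×ˢ Icc c d))
    (hF : ∀ x ∈ Icc a b, ContinuousOn (fun y => F (x, y)) (Icc c d))
    (h0 : ∀ x ∈ Icc a b, F (x, c) = 0 ∧ F (x, d) = 0)
    (hd : ∀ x ∈ Icc a b, x ∉ S → ∀ y ∈ Icc c d, y ∉ T →
      HasDerivAt (fun y => F (x, y)) (g (x, y)) y) :
    ∫ z in Icc a b ×ˢ Icc c d, g z = 0 := by
  rw [Measure.volume_eq_prod, ← setIntegral_prod_swap]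
  exact integral_eq_zero_of_hasDerivAt_fst (F := F ∘ Prod.swap) hcd hT hS hg.swap hF h0 hd

lemma RectGrid.mem_interiors {z : ℝ × ℝ} (hz : z ∈ G.dom) (hx : z.1 ∉ range G.x)
    (hy : z.2 ∉ range G.y) : z ∈ G.interiors := by
  rw [G.dom_eq_iUnion] at hz
  obtain ⟨c, ⟨h1, h2⟩, h3, h4⟩ := mem_iUnion.mp hz
  refine mem_iUnion.mpr ⟨c, ⟨lt_of_le_of_ne h1 ?_, lt_of_le_of_ne h2 ?_⟩,
    lt_of_le_of_ne h3 ?_, lt_of_le_of_ne h4 ?_⟩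
  · exact fun h => hx ⟨_, h⟩
  · exact fun h => hx ⟨_, h.symm⟩
  · exact fun h => hy ⟨_, h⟩
  · exact fun h => hy ⟨_, h.symm⟩

lemma RectGrid.x_zero_lt : G.x 0 < G.x (Fin.last G.nx) :=
  G.x_mono (by have := G.nx_pos; rw [Fin.lt_def]; simpa using this)

lemma RectGrid.y_zero_lt : G.y 0 < G.y (Fin.last G.ny) :=
  G.y_mono (by have := G.ny_pos; rw [Fin.lt_def]; simpa using this)

lemma RectGrid.mem_frontier_dom {z : ℝ × ℝ} : z ∈ frontier G.dom ↔ z ∈ G.dom ∧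
    (z.1 = G.x 0 ∨ z.1 = G.x (Fin.last G.nx) ∨ z.2 = G.y 0 ∨ z.2 = G.y (Fin.last G.ny)) := by
  rw [dom, frontier_prod_eq, isClosed_Icc.closure_eq, isClosed_Icc.closure_eq,
    frontier_Icc G.x_zero_lt.le, frontier_Icc G.y_zero_lt.le]
  have hx := G.x_zero_lt.le
  have hy := G.y_zero_lt.le
  simp only [mem_union, mem_prod, mem_insert_iff, mem_singleton_iff, mem_Icc]
  constructor
  · rintro (⟨h1, h2 | h2⟩ | ⟨h1 | h1, h2⟩) <;> simp [h1, h2, hx, hy]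
  · rintro ⟨⟨h1, h2⟩, h3 | h3 | h3 | h3⟩ <;> simp [h1, h2, h3]

/-- The first component of a velocity field. -/
noncomputable def velX {k : ℕ} : velSpace G k →ₗ[ℝ] femSpace G k where
  toFun v := ⟨v.1.1, v.2.1⟩
  map_add' _ _ := rfl
  map_smul' _ _ := rfl

/-- The second component of a velocity field. -/
noncomputable def velY {k : ℕ} : velSpace G k →ₗ[ℝ] femSpace G k where
  toFun v := ⟨v.1.2, v.2.2.1⟩
  map_add' _ _ := rfl
  map_smul' _ _ := rfl

lemma hasDerivAt_fst {m : ℕ} (f : femSpace G m) {x y : ℝ} (hz : (x, y) ∈ G.interiors) :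
    HasDerivAt (fun x => f.1 (x, y)) ((dX f).1 (x, y)) x := by
  rw [dirDeriv_apply _ f hz]
  exact (differentiableAt_of_mem_interiors f hz).hasFDerivAt.comp_hasDerivAt x
    ((hasDerivAt_id x).prodMk (hasDerivAt_const x y))

lemma hasDerivAt_snd {m : ℕ} (f : femSpace G m) {x y : ℝ} (hz : (x, y) ∈ G.interiors) :
    HasDerivAt (fun y => f.1 (x, y)) ((dY f).1 (x, y)) y := by
  rw [dirDeriv_apply _ f hz]
  exact (differentiableAt_of_mem_interiors f hz).hasFDerivAt.comp_hasDerivAt y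
    ((hasDerivAt_const y x).prodMk (hasDerivAt_id y))

/-- Integration by parts for a velocity that vanishes on the boundary. -/
lemma integ_dX_add_integ_dY {k m : ℕ} (u : velSpace G k) (q : femSpace G m) :
    G.integ ((dX (velX u) + dY (velY u)) * femBdd q)
      = -G.integ (femBdd (velX u) * dX q + femBdd (velY u) * dY q) := by
  have hx : G.integ (dX (velX u) * femBdd q + femBdd (velX u) * dX q) = 0 := by
    refine integral_eq_zero_of_hasDerivAt_fst (F := fun z => u.1.1 z * q.1 z) G.x_zero_lt.le
      (finite_range G.x).countable (finite_range G.y).countable (G.integrable_bdd _) ?_ ?_ ?_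
    · intro y hy
      exact (u.2.1.1.mul q.2.1).comp (f := fun x => (x, y)) (by fun_prop) fun x hx => ⟨hx, hy⟩
    · intro y hy
      rw [(u.2.2.2 _ (G.mem_frontier_dom.mpr
          ⟨⟨left_mem_Icc.mpr G.x_zero_lt.le, hy⟩, by simp⟩)).1,
        (u.2.2.2 _ (G.mem_frontier_dom.mpr
          ⟨⟨right_mem_Icc.mpr G.x_zero_lt.le, hy⟩, by simp⟩)).1]
      simp
    · intro y hy hyT x hx hxS
      have hz := G.mem_interiors (z := (x, y)) ⟨hx, hy⟩ hxS hyT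
      exact (hasDerivAt_fst (velX u) hz).mul (hasDerivAt_fst q hz)
  have hy : G.integ (dY (velY u) * femBdd q + femBdd (velY u) * dY q) = 0 := by
    refine integral_eq_zero_of_hasDerivAt_snd (F := fun z => u.1.2 z * q.1 z) G.y_zero_lt.le
      (finite_range G.x).countable (finite_range G.y).countable (G.integrable_bdd _) ?_ ?_ ?_
    · intro x hx
      exact (u.2.2.1.1.mul q.2.1).comp (f := fun y => (x, y)) (by fun_prop) fun y hy => ⟨hx, hy⟩
    · intro x hx
      rw [(u.2.2.2 _ (G.mem_frontier_dom.mpr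
          ⟨⟨hx, left_mem_Icc.mpr G.y_zero_lt.le⟩, by simp⟩)).2,
        (u.2.2.2 _ (G.mem_frontier_dom.mpr
          ⟨⟨hx, right_mem_Icc.mpr G.y_zero_lt.le⟩, by simp⟩)).2]
      simp
    · intro x hx hxS y hy hyT
      have hz := G.mem_interiors (z := (x, y)) ⟨hx, hy⟩ hxS hyT
      exact (hasDerivAt_snd (velY u) hz).mul (hasDerivAt_snd q hz)
  simp only [add_mul, map_add] at hx hy ⊢
  linarith

end Parts

/-! ### The bilinear forms of the scheme -/

section Forms

variable {G : RectGrid}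

/-- The form `(a ∇p, ∇q)`. -/
noncomputable def gradForm {k m : ℕ} (a : G.bdd) : femSpace G k →ₗ[ℝ] femSpace G m →ₗ[ℝ] ℝ :=
  LinearMap.mk₂ ℝ (fun p q => G.integ (a * (dX p * dX q + dY p * dY q)))
    (fun p p' q => by simp only [map_add, mul_add, add_mul]; ring)
    (fun r p q => by simp only [map_smul, smul_mul_assoc, mul_smul_comm, ← smul_add])
    (fun p q q' => by simp only [map_add, mul_add]; ring)
    (fun r p q => by simp only [map_smul, mul_smul_comm, ← smul_add])

lemma gradForm_apply {k m : ℕ} (a : G.bdd) (p : femSpace G k) (q : femSpace G m) :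
    gradForm a p q = G.integ (a * (dX p * dX q + dY p * dY q)) := rfl

/-- The form `(a u, v)` for scalar finite element functions. -/
noncomputable def massForm {k m : ℕ} (a : G.bdd) : femSpace G k →ₗ[ℝ] femSpace G m →ₗ[ℝ] ℝ :=
  LinearMap.mk₂ ℝ (fun p q => G.integ (a * (femBdd p * femBdd q)))
    (fun p p' q => by simp only [map_add, mul_add, add_mul])
    (fun r p q => by simp only [map_smul, smul_mul_assoc, mul_smul_comm])
    (fun p q q' => by simp only [map_add, mul_add])
    (fun r p q => by simp only [map_smul, mul_smul_comm])

/-- The form `(a u, ∇q)` for velocities `u`. -/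
noncomputable def transForm {k m : ℕ} (a : G.bdd) : velSpace G k →ₗ[ℝ] femSpace G m →ₗ[ℝ] ℝ :=
  LinearMap.mk₂ ℝ (fun u q => G.integ (a * (femBdd (velX u) * dX q + femBdd (velY u) * dY q)))
    (fun p p' q => by simp only [map_add, mul_add, add_mul]; ring)
    (fun r p q => by simp only [map_smul, smul_mul_assoc, mul_smul_comm, ← smul_add])
    (fun p q q' => by simp only [map_add, mul_add]; ring)
    (fun r p q => by simp only [map_smul, mul_smul_comm, ← smul_add])

lemma transForm_apply {k m : ℕ} (a : G.bdd) (u : velSpace G k) (q : femSpace G m) :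
    transForm a u q = G.integ (a * (femBdd (velX u) * dX q + femBdd (velY u) * dY q)) := rfl

/-- The `L²` inner product of velocities. -/
noncomputable def velForm {k : ℕ} : velSpace G k →ₗ[ℝ] velSpace G k →ₗ[ℝ] ℝ :=
  (massForm 1).compl₁₂ velX velX + (massForm 1).compl₁₂ velY velY

/-- The viscous form `(a ∇u, ∇v)` for velocities. -/
noncomputable def viscForm {k : ℕ} (a : G.bdd) : velSpace G k →ₗ[ℝ] velSpace G k →ₗ[ℝ] ℝ :=
  (gradForm a).compl₁₂ velX velX + (gradForm a).compl₁₂ velY velY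

/-- The form `((w · ∇) u, v)` for velocities. -/
noncomputable def convForm {k : ℕ} (w : velSpace G k) :
    velSpace G k →ₗ[ℝ] velSpace G k →ₗ[ℝ] ℝ :=
  LinearMap.mk₂ ℝ (fun u v =>
      transForm (femBdd (velX v)) w (velX u) + transForm (femBdd (velY v)) w (velY u))
    (fun p p' q => by simp only [map_add]; ring)
    (fun r p q => by simp only [map_smul, smul_add])
    (fun p q q' => by simp only [transForm_apply, map_add, add_mul]; ring)
    (fun r p q => by simp only [transForm_apply, map_smul, smul_mul_assoc, smul_add])

/-- The skew-symmetric convection form. -/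
noncomputable def skewForm {k : ℕ} (w : velSpace G k) :
    velSpace G k →ₗ[ℝ] velSpace G k →ₗ[ℝ] ℝ :=
  (1 / 2 : ℝ) • (convForm w - (convForm w).flip)

lemma skewForm_self {k : ℕ} (w u : velSpace G k) : skewForm w u u = 0 := by
  simp [skewForm]

/-! The forms of the scheme, which are defined by integrals of expressions containing `fderiv`,
are the bilinear forms above. -/

lemma ip_eq_integ {f g : ℝ × ℝ → ℝ} (F : G.bdd) (h : (fun z => f z * g z) =ᵐ[G.vol] F.1) :
    ip G f g = G.integ F := integral_congr_ae h

lemma ip_eq_massForm {k m : ℕ} (f : femSpace G k) (g : femSpace G m) :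
    ip G f.1 g.1 = massForm 1 f g :=
  ip_eq_integ (1 * (femBdd f * femBdd g)) (Filter.Eventually.of_forall fun _ => (one_mul _).symm)

lemma ipVec_eq_velForm {k : ℕ} (u v : velSpace G k) : ipVec G u.1 v.1 = velForm u v :=
  congrArg₂ (· + ·) (ip_eq_massForm (velX u) (velX v)) (ip_eq_massForm (velY u) (velY v))

lemma ipVec_scal_grad {k m : ℕ} (a : G.bdd) (p : femSpace G k) (q : femSpace G m) :
    ipVec G (scal a.1 (grad p.1)) (grad q.1) = gradForm a p q := by
  rw [gradForm_apply, mul_add, map_add]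
  refine congrArg₂ (· + ·) (ip_eq_integ _ ?_) (ip_eq_integ _ ?_)
  · filter_upwards [dirDeriv_ae (1, 0) p, dirDeriv_ae (1, 0) q] with z h1 h2
    exact (congrArg₂ (fun s t => a.1 z * s * t) h1 h2).trans (mul_assoc _ _ _)
  · filter_upwards [dirDeriv_ae (0, 1) p, dirDeriv_ae (0, 1) q] with z h1 h2
    exact (congrArg₂ (fun s t => a.1 z * s * t) h1 h2).trans (mul_assoc _ _ _)

lemma ipVec_grad {k m : ℕ} (p : femSpace G k) (q : femSpace G m) :
    ipVec G (grad p.1) (grad q.1) = gradForm 1 p q := by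
  rw [← ipVec_scal_grad]
  have : scal (1 : G.bdd).1 (grad p.1) = grad p.1 := Prod.ext (one_mul _) (one_mul _)
  rw [this]

lemma ipGradVec_eq {k : ℕ} (a : G.bdd) (u v : velSpace G k) :
    ipGradVec G a.1 u.1 v.1 = viscForm a u v :=
  congrArg₂ (· + ·) (ipVec_scal_grad a (velX u) (velX v)) (ipVec_scal_grad a (velY u) (velY v))

lemma ipVec_scal_vel {k m : ℕ} (a : G.bdd) (u : velSpace G k) (q : femSpace G m) :
    ipVec G (scal a.1 u.1) (grad q.1) = transForm a u q := by
  rw [transForm_apply, mul_add, map_add]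
  refine congrArg₂ (· + ·) (ip_eq_integ _ ?_) (ip_eq_integ _ ?_)
  · filter_upwards [dirDeriv_ae (1, 0) q] with z h1
    exact (congrArg (fun t => a.1 z * u.1.1 z * t) h1).trans (mul_assoc _ _ _)
  · filter_upwards [dirDeriv_ae (0, 1) q] with z h1
    exact (congrArg (fun t => a.1 z * u.1.2 z * t) h1).trans (mul_assoc _ _ _)

lemma ip_comm (f g : ℝ × ℝ → ℝ) : ip G f g = ip G g f := by
  simp only [ip, mul_comm]

lemma ipVec_comm (u v : (ℝ × ℝ → ℝ) × (ℝ × ℝ → ℝ)) : ipVec G u v = ipVec G v u :=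
  congrArg₂ (· + ·) (ip_comm _ _) (ip_comm _ _)

lemma ipVec_scal_comm (a : ℝ × ℝ → ℝ) (u v : (ℝ × ℝ → ℝ) × (ℝ × ℝ → ℝ)) :
    ipVec G (scal a u) v = ipVec G (scal a v) u := by
  simp only [ipVec, ip, scal]
  congr 2 <;> ext z <;> ring

lemma ipVec_grad_vel {k m : ℕ} (q : femSpace G m) (v : velSpace G k) :
    ipVec G (grad q.1) v.1 = transForm 1 v q := by
  rw [ipVec_comm, ← ipVec_scal_vel]
  have : scal (1 : G.bdd).1 v.1 = v.1 := Prod.ext (one_mul _) (one_mul _)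
  rw [this]

lemma ipVec_scal_grad_vel {k m : ℕ} (a : G.bdd) (q : femSpace G m) (v : velSpace G k) :
    ipVec G (scal a.1 (grad q.1)) v.1 = transForm a v q := by
  rw [ipVec_scal_comm, ipVec_scal_vel]

lemma ipVec_conv {k : ℕ} (w u v : velSpace G k) :
    ipVec G (conv w.1 u.1) v.1 = convForm w u v := by
  have h : ∀ p q : femSpace G k, ip G (fun z => w.1.1 z * (grad p.1).1 z
      + w.1.2 z * (grad p.1).2 z) q.1 = transForm (femBdd q) w p := by
    intro p q
    refine ip_eq_integ _ ?_
    filter_upwards [dirDeriv_ae (1, 0) p, dirDeriv_ae (0, 1) p] with z h1 h2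
    exact (congrArg₂ (fun s t => (w.1.1 z * s + w.1.2 z * t) * q.1 z) h1 h2).trans (mul_comm _ _)
  exact congrArg₂ (· + ·) (h (velX u) (velX v)) (h (velY u) (velY v))

lemma triForm_eq {k : ℕ} (w u v : velSpace G k) : triForm G w.1 u.1 v.1 = skewForm w u v := by
  rw [triForm, ipVec_conv, ipVec_conv]
  rfl

/-- The divergence is tested with `q` by integrating by parts. -/
lemma ip_divg {k m : ℕ} (u : velSpace G k) (q : femSpace G m) :
    ip G (divg u.1) q.1 = -transForm 1 u q := by
  rw [transForm_apply, one_mul, ← integ_dX_add_integ_dY]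
  refine ip_eq_integ _ ?_
  filter_upwards [dirDeriv_ae (1, 0) (velX u), dirDeriv_ae (0, 1) (velY u)] with z h1 h2
  exact congrArg₂ (fun s t => (s + t) * q.1 z) h1 h2

/-! Positivity of the forms. -/

lemma gradForm_self_nonneg {k : ℕ} {a : G.bdd} (ha : ∀ᵐ z ∂G.vol, 0 ≤ a.1 z)
    (p : femSpace G k) : 0 ≤ gradForm a p p := by
  refine G.integ_nonneg_of_ae ?_
  filter_upwards [ha] with z hz
  exact mul_nonneg hz (add_nonneg (mul_self_nonneg _) (mul_self_nonneg _))

/-- A finite element function whose weighted gradient norm vanishes is constant. -/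
lemma exists_eq_smul_femOne {k : ℕ} {a : G.bdd} (ha : ∀ᵐ z ∂G.vol, 0 < a.1 z)
    {p : femSpace G k} (hp : gradForm a p p = 0) : ∃ r : ℝ, p = r • femOne G k := by
  have h0 : 0 ≤ᵐ[G.vol] (a * (dX p * dX p + dY p * dY p)).1 := by
    filter_upwards [ha] with z hz
    exact mul_nonneg hz.le (add_nonneg (mul_self_nonneg _) (mul_self_nonneg _))
  have h1 := (integral_eq_zero_iff_of_nonneg_ae h0 (G.integrable_bdd _)).mp hp
  have h2 : ∀ᵐ z ∂G.vol, (dX p).1 z = 0 ∧ (dY p).1 z = 0 := by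
    filter_upwards [ha, h1] with z hz hz1
    have h3 : a.1 z * ((dX p).1 z * (dX p).1 z + (dY p).1 z * (dY p).1 z) = 0 := hz1
    have h4 := (mul_eq_zero.mp h3).resolve_left hz.ne'
    have h5 := mul_self_nonneg ((dX p).1 z)
    have h6 := mul_self_nonneg ((dY p).1 z)
    exact ⟨mul_self_eq_zero.mp (by linarith), mul_self_eq_zero.mp (by linarith)⟩
  obtain ⟨r, hr⟩ := eq_const_of_dirDeriv_eq_zero p (h2.mono fun _ h => h.1)
    (h2.mono fun _ h => h.2)
  exact ⟨r, eq_smul_femOne p hr⟩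

lemma gradForm_femOne_left {k m : ℕ} (a : G.bdd) (p : femSpace G m) :
    gradForm a (femOne G k) p = 0 := by
  simp [gradForm_apply, dirDeriv_femOne]

lemma gradForm_femOne_right {k m : ℕ} (a : G.bdd) (p : femSpace G m) :
    gradForm a p (femOne G k) = 0 := by
  simp [gradForm_apply, dirDeriv_femOne]

lemma transForm_femOne {k m : ℕ} (a : G.bdd) (u : velSpace G k) :
    transForm a u (femOne G m) = 0 := by
  simp [transForm_apply, dirDeriv_femOne]

lemma velForm_comm {k : ℕ} (u v : velSpace G k) : velForm u v = velForm v u := by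
  rw [← ipVec_eq_velForm, ipVec_comm, ipVec_eq_velForm]

lemma velForm_self_pos {k : ℕ} {u : velSpace G k} (hu : u ≠ 0) : 0 < velForm u u := by
  rw [← ipVec_eq_velForm]
  have h1 := ip_self_nonneg G u.1.1
  have h2 := ip_self_nonneg G u.1.2
  rw [ipVec]
  by_contra h
  exact hu (Subtype.ext (Prod.ext (eq_zero_of_ip_self u.2.1 (by linarith))
    (eq_zero_of_ip_self u.2.2.1 (by linarith))))

lemma viscForm_self_nonneg {k : ℕ} {a : G.bdd} (ha : ∀ᵐ z ∂G.vol, 0 ≤ a.1 z)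
    (u : velSpace G k) : 0 ≤ viscForm a u u :=
  add_nonneg (gradForm_self_nonneg ha _) (gradForm_self_nonneg ha _)

end Forms

/-! ### Quadrature on the grid -/

section Quadrature

open Polynomial

variable {G : RectGrid}

/-- A finite element function on a cell, as a polynomial in the first variable with coefficients
depending on the second one, together with its derivative in the first variable. -/
lemma exists_slicePoly {m : ℕ} (f : femSpace G m) (c : Fin G.nx × Fin G.ny) :
    ∃ p : Fin (m + 1) → ℝ[X], (∀ l, (p l).natDegree ≤ m) ∧
      (∀ z ∈ G.cell c, f.1 z = ∑ l, (p l).eval z.1 * z.2 ^ (l : ℕ)) ∧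
      ∀ z ∈ G.openCell c, (dX f).1 z = ∑ l, (derivative (p l)).eval z.1 * z.2 ^ (l : ℕ) := by
  obtain ⟨a, ha⟩ := f.2.2.2 c
  set p : Fin (m + 1) → ℝ[X] := fun l => ∑ i : Fin (m + 1), C (a i l) * X ^ (i : ℕ) with hp
  have hval : ∀ z ∈ G.cell c, f.1 z = ∑ l, (p l).eval z.1 * z.2 ^ (l : ℕ) := by
    intro z hz
    rw [ha z hz, Finset.sum_comm]
    refine Finset.sum_congr rfl fun l _ => ?_
    simp only [hp, eval_finsetSum, eval_mul, eval_C, eval_pow, eval_X, Finset.sum_mul, mul_assoc]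
  refine ⟨p, fun l => ?_, hval, ?_⟩
  · refine natDegree_sum_le_of_forall_le _ _ fun i _ => ?_
    exact (natDegree_C_mul_X_pow_le _ _).trans (by omega)
  · rintro ⟨x, y⟩ hz
    have h1 := hasDerivAt_fst f (mem_iUnion.mpr ⟨c, hz⟩ : (x, y) ∈ G.interiors)
    refine h1.unique ?_
    have h2 : HasDerivAt (fun x => ∑ l, (p l).eval x * y ^ (l : ℕ))
        (∑ l, (derivative (p l)).eval x * y ^ (l : ℕ)) x :=
      HasDerivAt.fun_sum fun l _ => ((p l).hasDerivAt x).mul_const _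
    refine h2.congr_of_eventuallyEq ?_
    filter_upwards [isOpen_Ioo.mem_nhds hz.1] with w hw
    exact hval (w, y) ⟨Ioo_subset_Icc_self hw, Ioo_subset_Icc_self hz.2⟩

lemma RectGrid.disjoint_openCell : Pairwise (Function.onFun Disjoint G.openCell) := by
  have hI : ∀ {n : ℕ} {x : Fin (n + 1) → ℝ}, StrictMono x → ∀ {i j : Fin n}, i < j →
      Disjoint (Ioo (x i.castSucc) (x i.succ)) (Ioo (x j.castSucc) (x j.succ)) := by
    intro n x hx i j hij
    rw [Set.disjoint_left]
    intro t ht ht'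
    have : x i.succ ≤ x j.castSucc := hx.monotone (Fin.succ_le_castSucc_iff.mpr hij)
    linarith [ht.2, ht'.1]
  rintro ⟨i, j⟩ ⟨i', j'⟩ hne
  refine Set.disjoint_prod.mpr ?_
  rcases lt_trichotomy i i' with h | h | h
  · exact Or.inl (hI G.x_mono h)
  · subst h
    right
    rcases lt_trichotomy j j' with h | h | h
    · exact hI G.y_mono h
    · subst h; exact absurd rfl hne
    · exact (hI G.y_mono h).symm
  · exact Or.inl (hI G.x_mono h).symm

lemma RectGrid.dom_ae_eq_interiors : G.dom =ᵐ[volume] G.interiors := by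
  rw [G.dom_eq_iUnion]
  exact Filter.EventuallyEq.countable_iUnion fun c => (G.openCell_ae_eq_cell c).symm

lemma RectGrid.integral_dom_eq_sum {F : ℝ × ℝ → ℝ} (hF : IntegrableOn F G.dom) :
    ∫ z in G.dom, F z = ∑ c, ∫ z in G.openCell c, F z := by
  rw [setIntegral_congr_set G.dom_ae_eq_interiors, interiors, integral_iUnion_fintype
    (fun c => (G.isOpen_openCell c).measurableSet) G.disjoint_openCell]
  exact fun c => hF.mono_set ((G.openCell_subset_cell c).trans (G.cell_subset c))

lemma integral_openCell_mul {k : ℕ} (hk : 1 ≤ k) (c : Fin G.nx × Fin G.ny) {p q : ℝ[X]}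
    (hp : p.natDegree ≤ 2 * k - 1) (hq : q.natDegree ≤ 2 * k - 1) :
    ∫ z in G.openCell c, p.eval z.1 * q.eval z.2 = ∑ s ∈ glNodes k, ∑ t ∈ glNodes k,
      (G.cellArea c * glWeight k s * glWeight k t)
        * (p.eval (G.node c s t).1 * q.eval (G.node c s t).2) := by
  rw [RectGrid.openCell, Measure.volume_eq_prod, setIntegral_prod_mul
    (fun x => p.eval x) (fun y => q.eval y),
    ← integral_Ioc_eq_integral_Ioo, ← integral_Ioc_eq_integral_Ioo,
    ← intervalIntegral.integral_of_le (G.x_lt _).le,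
    ← intervalIntegral.integral_of_le (G.y_lt _).le, integral_eq_sum_glNodes hk hp,
    integral_eq_sum_glNodes hk hq, mul_mul_mul_comm, Finset.sum_mul_sum, Finset.mul_sum]
  refine Finset.sum_congr rfl fun s _ => ?_
  rw [Finset.mul_sum]
  refine Finset.sum_congr rfl fun t _ => ?_
  simp only [RectGrid.cellArea, RectGrid.node]
  ring

/-- Tensor-product Gauss-Lobatto quadrature on a cell is exact on polynomials of degree at most
`2 k - 1` in each variable. -/
lemma integral_openCell_sum_mul {k : ℕ} (hk : 1 ≤ k) (c : Fin G.nx × Fin G.ny) {ι : Type*}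
    [Fintype ι] {p q : ι → ℝ[X]} (hp : ∀ l, (p l).natDegree ≤ 2 * k - 1)
    (hq : ∀ l, (q l).natDegree ≤ 2 * k - 1) :
    ∫ z in G.openCell c, ∑ l, (p l).eval z.1 * (q l).eval z.2 =
      ∑ s ∈ glNodes k, ∑ t ∈ glNodes k, (G.cellArea c * glWeight k s * glWeight k t)
        * ∑ l, (p l).eval (G.node c s t).1 * (q l).eval (G.node c s t).2 := by
  have hint : ∀ l ∈ Finset.univ, Integrable (fun z : ℝ × ℝ => (p l).eval z.1 * (q l).eval z.2)
      (volume.restrict (G.openCell c)) := by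
    intro l _
    refine IntegrableOn.mono_set (t := G.cell c) ?_ (G.openCell_subset_cell c)
    exact Continuous.continuousOn (((p l).continuous.comp continuous_fst).mul
      ((q l).continuous.comp continuous_snd)) |>.integrableOn_compact
      (isCompact_Icc.prod isCompact_Icc)
  rw [integral_finsetSum _ hint]
  simp only [Finset.mul_sum]
  rw [Finset.sum_congr rfl fun l _ => integral_openCell_mul hk c (hp l) (hq l), Finset.sum_comm]
  exact Finset.sum_congr rfl fun s _ => Finset.sum_comm

lemma RectGrid.node_mem_cell {k : ℕ} (hk : 1 ≤ k) (c : Fin G.nx × Fin G.ny) {s t : ℝ}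
    (hs : s ∈ glNodes k) (ht : t ∈ glNodes k) : G.node c s t ∈ G.cell c := by
  have hs' := glNodes_subset_Icc hk hs
  have ht' := glNodes_subset_Icc hk ht
  have hx := (G.x_lt c.1).le
  have hy := (G.y_lt c.2).le
  refine ⟨⟨?_, ?_⟩, ?_, ?_⟩ <;> simp only [node] <;> nlinarith [hs'.1, hs'.2, ht'.1, ht'.2]

variable (G) in
/-- The index type of the Gauss-Lobatto nodes; nodes shared by several cells occur repeatedly. -/
abbrev RectGrid.NodeIdx (k : ℕ) : Type :=
  (Fin G.nx × Fin G.ny) × (glNodes k) × (glNodes k)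

variable (G) in
/-- The node with a given index. -/
def RectGrid.pt {k : ℕ} (j : G.NodeIdx k) : ℝ × ℝ := G.node j.1 j.2.1 j.2.2

variable (G) in
/-- The quadrature weight of a node. -/
noncomputable def RectGrid.wt {k : ℕ} (j : G.NodeIdx k) : ℝ :=
  G.cellArea j.1 * glWeight k j.2.1 * glWeight k j.2.2

instance (k : ℕ) : Nonempty (G.NodeIdx k) :=
  ⟨(⟨0, G.nx_pos⟩, ⟨0, G.ny_pos⟩), ⟨0, zero_mem_glNodes k⟩, ⟨0, zero_mem_glNodes k⟩⟩

lemma RectGrid.wt_pos {k : ℕ} (hk : 1 ≤ k) (j : G.NodeIdx k) : 0 < G.wt j :=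
  mul_pos (mul_pos (mul_pos (sub_pos.mpr (G.x_lt _)) (sub_pos.mpr (G.y_lt _)))
    (glWeight_pos hk j.2.1.2)) (glWeight_pos hk j.2.2.2)

lemma RectGrid.pt_mem_cell {k : ℕ} (hk : 1 ≤ k) (j : G.NodeIdx k) : G.pt j ∈ G.cell j.1 :=
  G.node_mem_cell hk _ j.2.1.2 j.2.2.2

lemma RectGrid.pt_mem_dom {k : ℕ} (hk : 1 ≤ k) (j : G.NodeIdx k) : G.pt j ∈ G.dom :=
  G.cell_subset _ (G.pt_mem_cell hk j)

lemma RectGrid.mem_nodes_iff {k : ℕ} {z : ℝ × ℝ} :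
    z ∈ G.nodes k ↔ ∃ j : G.NodeIdx k, G.pt j = z := by
  constructor
  · rintro ⟨c, s, hs, t, ht, rfl⟩
    exact ⟨(c, ⟨s, hs⟩, ⟨t, ht⟩), rfl⟩
  · rintro ⟨j, rfl⟩
    exact ⟨j.1, j.2.1, j.2.1.2, j.2.2, j.2.2.2, rfl⟩

lemma lumped_eq_sum (k : ℕ) (f g : ℝ × ℝ → ℝ) :
    lumped G k f g = ∑ j : G.NodeIdx k, G.wt j * (f (G.pt j) * g (G.pt j)) := by
  rw [Fintype.sum_prod_type]
  simp only [Fintype.sum_prod_type (α₁ := glNodes k)]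
  refine Finset.sum_congr rfl fun c _ => ?_
  rw [← Finset.sum_coe_sort]
  refine Finset.sum_congr rfl fun s _ => ?_
  rw [← Finset.sum_coe_sort]
  rfl

/-- Evaluation at a node. -/
def nodeEval {k : ℕ} (j : G.NodeIdx k) : femSpace G k →ₗ[ℝ] ℝ where
  toFun f := f.1 (G.pt j)
  map_add' _ _ := rfl
  map_smul' _ _ := rfl

lemma nodeEval_apply {k : ℕ} (j : G.NodeIdx k) (f : femSpace G k) :
    nodeEval j f = f.1 (G.pt j) := rfl

lemma nodeEval_femOne {k : ℕ} (hk : 1 ≤ k) (j : G.NodeIdx k) : nodeEval j (femOne G k) = 1 :=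
  femOne_apply (m := k) (G.pt_mem_dom hk j)

lemma lumped_eq_nodalForm {k : ℕ} (u v : femSpace G k) :
    lumped G k u.1 v.1 = nodalForm G.wt nodeEval u v := by
  rw [lumped_eq_sum, nodalForm_apply]
  rfl

/-- Mass lumping preserves integrals of finite element functions. -/
lemma integral_eq_sum_wt {k : ℕ} (hk : 1 ≤ k) (f : femSpace G k) :
    ∫ z in G.dom, f.1 z = ∑ j : G.NodeIdx k, G.wt j * f.1 (G.pt j) := by
  rw [G.integral_dom_eq_sum (integrableOn_of_mem_femSpace f.2)]
  have hR := lumped_eq_sum (G := G) k f.1 (fun _ => 1)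
  simp only [mul_one] at hR
  rw [← hR, lumped]
  refine Finset.sum_congr rfl fun c _ => ?_
  obtain ⟨p, hp, hval, -⟩ := exists_slicePoly f c
  have h1 : ∫ z in G.openCell c, f.1 z = ∫ z in G.openCell c,
      ∑ l, (p l).eval z.1 * (X ^ (l : ℕ) : ℝ[X]).eval z.2 := by
    refine setIntegral_congr_fun (G.isOpen_openCell c).measurableSet fun z hz => ?_
    simp only [eval_pow, eval_X]
    exact hval z (G.openCell_subset_cell c hz)
  rw [h1, integral_openCell_sum_mul hk c (fun l => (hp l).trans (by omega))
    fun l => by rw [natDegree_X_pow]; omega]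
  refine Finset.sum_congr rfl fun s hs => Finset.sum_congr rfl fun t ht => ?_
  rw [hval _ (G.node_mem_cell hk c hs ht)]
  simp only [eval_pow, eval_X, mul_one]

lemma volume_dom_toReal {k : ℕ} (hk : 1 ≤ k) :
    (volume G.dom).toReal = ∑ j : G.NodeIdx k, G.wt j := by
  have h := integral_eq_sum_wt hk (femOne G k)
  simp only [femOne_apply (m := k) (G.pt_mem_dom hk _), mul_one] at h
  rw [← h, setIntegral_congr_fun (g := fun _ => (1 : ℝ)) G.isCompact_dom.measurableSet
    fun z hz => femOne_apply (m := k) hz]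
  simp [Measure.real]

end Quadrature

/-! ### Injectivity of the discrete gradient -/

section InfSup

open Polynomial

/-- A one-dimensional conforming test function of degree `k` on the grid `x`, vanishing at the end
points of the grid. -/
structure IsTest {n : ℕ} (x : Fin (n + 1) → ℝ) (k : ℕ) (A : ℝ → ℝ) : Prop where
  cont : Continuous A
  poly : ∀ i : Fin n, ∃ p : ℝ[X], p.natDegree ≤ k ∧
    ∀ t ∈ Icc (x i.castSucc) (x i.succ), A t = p.eval t
  left : A (x 0) = 0
  right : A (x (Fin.last n)) = 0

/-- A polynomial on `[a, b]`, extended by zero. -/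
noncomputable def bump (a b : ℝ) (p : ℝ[X]) : ℝ → ℝ := (Icc a b).indicator fun t => p.eval t

lemma bump_of_mem {a b t : ℝ} (p : ℝ[X]) (ht : t ∈ Icc a b) : bump a b p t = p.eval t :=
  indicator_of_mem ht _

lemma bump_eq_zero_of_le {a b t : ℝ} {p : ℝ[X]} (ha : p.eval a = 0) (ht : t ≤ a) :
    bump a b p t = 0 := by
  by_cases h : t ∈ Icc a b
  · rw [bump_of_mem p h, le_antisymm ht h.1, ha]
  · exact indicator_of_notMem h _

lemma bump_eq_zero_of_ge {a b t : ℝ} {p : ℝ[X]} (hb : p.eval b = 0) (ht : b ≤ t) :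
    bump a b p t = 0 := by
  by_cases h : t ∈ Icc a b
  · rw [bump_of_mem p h, le_antisymm h.2 ht, hb]
  · exact indicator_of_notMem h _

lemma isTest_bump {n : ℕ} {x : Fin (n + 1) → ℝ} (hx : StrictMono x) {k : ℕ} {i i' : Fin n}
    (hii : i ≤ i') {p : ℝ[X]} (hp : p.natDegree ≤ k) (ha : p.eval (x i.castSucc) = 0)
    (hb : p.eval (x i'.succ) = 0) : IsTest x k (bump (x i.castSucc) (x i'.succ) p) where
  cont := by
    have hlt : x i.castSucc < x i'.succ := hx (Fin.castSucc_lt_succ_iff.mpr hii)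
    refine continuous_indicator (fun t ht => ?_) p.continuous.continuousOn
    rw [frontier_Icc hlt.le] at ht
    rcases ht with rfl | rfl
    · exact ha
    · exact hb
  poly l := by
    rcases lt_or_ge l i with h | h
    · refine ⟨0, by simp, fun t ht => ?_⟩
      rw [eval_zero]
      exact bump_eq_zero_of_le ha (ht.2.trans (hx.monotone (Fin.succ_le_castSucc_iff.mpr h)))
    · rcases lt_or_ge i' l with h' | h'
      · refine ⟨0, by simp, fun t ht => ?_⟩
        rw [eval_zero]
        exact bump_eq_zero_of_ge hb ((hx.monotone (Fin.succ_le_castSucc_iff.mpr h')).trans ht.1)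
      · refine ⟨p, hp, fun t ht => bump_of_mem p ⟨?_, ?_⟩⟩
        · exact (hx.monotone (Fin.castSucc_le_castSucc_iff.mpr h)).trans ht.1
        · exact ht.2.trans (hx.monotone (Fin.succ_le_succ_iff.mpr h'))
  left := bump_eq_zero_of_le ha (hx.monotone (Fin.zero_le _))
  right := bump_eq_zero_of_ge hb (hx.monotone (Fin.le_last _))

/-- The image of the reference point `s` in the `i`-th interval of a one-dimensional grid. -/
def node1 {n : ℕ} (x : Fin (n + 1) → ℝ) (i : Fin n) (s : ℝ) : ℝ :=
  x i.castSucc + s * (x i.succ - x i.castSucc)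

lemma node1_zero {n : ℕ} (x : Fin (n + 1) → ℝ) (i : Fin n) : node1 x i 0 = x i.castSucc := by
  simp [node1]

lemma node1_one {n : ℕ} (x : Fin (n + 1) → ℝ) (i : Fin n) : node1 x i 1 = x i.succ := by
  simp [node1]

lemma node1_inj {n : ℕ} {x : Fin (n + 1) → ℝ} (hx : StrictMono x) {i : Fin n} {s t : ℝ}
    (h : node1 x i s = node1 x i t) : s = t :=
  mul_right_cancel₀ (sub_pos.mpr (hx Fin.castSucc_lt_succ)).ne' (add_left_cancel h)

lemma node1_mem_Icc {n : ℕ} {x : Fin (n + 1) → ℝ} (hx : StrictMono x) (i : Fin n) {s : ℝ}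
    (hs : s ∈ Icc (0 : ℝ) 1) : node1 x i s ∈ Icc (x i.castSucc) (x i.succ) := by
  have h := hx (Fin.castSucc_lt_succ (i := i))
  rw [node1]
  constructor <;> nlinarith [hs.1, hs.2]

lemma node1_mem_Ioo {n : ℕ} {x : Fin (n + 1) → ℝ} (hx : StrictMono x) (i : Fin n) {s : ℝ}
    (hs : s ∈ Ioo (0 : ℝ) 1) : node1 x i s ∈ Ioo (x i.castSucc) (x i.succ) := by
  have h := hx (Fin.castSucc_lt_succ (i := i))
  rw [node1]
  constructor <;> nlinarith [hs.1, hs.2]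

/-- The interior bubble that vanishes at all nodes except the `s`-th one of the `i`-th interval. -/
lemma exists_isTest_interior {n : ℕ} {x : Fin (n + 1) → ℝ} (hx : StrictMono x) {k : ℕ}
    (hk : 1 ≤ k) (i : Fin n) {s : ℝ} (hs : s ∈ glInner k) :
    ∃ A, IsTest x k A ∧ A (node1 x i s) ≠ 0 ∧
      (∀ t, t ∉ Ioo (x i.castSucc) (x i.succ) → A t = 0) ∧
      ∀ j, ∀ t ∈ glNodes k, node1 x j t ≠ node1 x i s → A (node1 x j t) = 0 := by
  set a := x i.castSucc with ha
  set b := x i.succ with hb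
  have hab : a < b := hx Fin.castSucc_lt_succ
  set p : ℝ[X] := (X - C a) * (X - C b) * ∏ t ∈ (glInner k).erase s, (X - C (node1 x i t)) with hp
  have hpa : p.eval a = 0 := by simp [hp]
  have hpb : p.eval b = 0 := by simp [hp]
  have hdeg : p.natDegree ≤ k := by
    refine natDegree_mul_le.trans ?_
    have h1 : ((X - C a) * (X - C b)).natDegree ≤ 2 :=
      natDegree_mul_le.trans (by rw [natDegree_X_sub_C, natDegree_X_sub_C])
    have h2 : (∏ t ∈ (glInner k).erase s, (X - C (node1 x i t))).natDegree
        = ((glInner k).erase s).card := by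
      simp [natDegree_prod_of_monic, monic_X_sub_C]
    have h3 := Finset.card_pos.mpr ⟨s, hs⟩
    rw [Finset.card_erase_of_mem hs, card_glInner hk] at h2
    rw [card_glInner hk] at h3
    omega
  have hzero : ∀ t, t ∉ Ioo a b → bump a b p t = 0 := by
    intro t ht
    rw [mem_Ioo, not_and_or, not_lt, not_lt] at ht
    exact ht.elim (bump_eq_zero_of_le hpa) (bump_eq_zero_of_ge hpb)
  have hnode := node1_mem_Ioo hx i (glInner_subset_Ioo hk hs)
  refine ⟨bump a b p, isTest_bump hx le_rfl hdeg hpa hpb, ?_, hzero, fun j t ht hne => ?_⟩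
  · rw [bump_of_mem p (Ioo_subset_Icc_self hnode), hp, eval_mul, eval_mul, eval_prod]
    simp only [eval_sub, eval_X, eval_C]
    refine mul_ne_zero (mul_ne_zero (sub_pos.mpr hnode.1).ne' (sub_neg.mpr hnode.2).ne) ?_
    refine Finset.prod_ne_zero_iff.mpr fun t ht h => ?_
    exact (Finset.mem_erase.mp ht).1 (node1_inj hx (sub_eq_zero.mp h)).symm
  · have hmem := node1_mem_Icc hx j (glNodes_subset_Icc hk ht)
    rcases lt_trichotomy j i with h | rfl | h
    · exact hzero _ fun h' => absurd (hmem.2.trans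
        (hx.monotone (Fin.succ_le_castSucc_iff.mpr h))) (not_le.mpr h'.1)
    · rcases mem_glNodes_cases ht with rfl | rfl | ht'
      · rw [node1_zero]; exact hzero _ fun h' => lt_irrefl _ h'.1
      · rw [node1_one]; exact hzero _ fun h' => lt_irrefl _ h'.2
      · rw [bump_of_mem p hmem, hp, eval_mul, eval_prod, Finset.prod_eq_zero
          (Finset.mem_erase.mpr ⟨fun h => hne (by rw [h]), ht'⟩) (by simp), mul_zero]
    · exact hzero _ fun h' => absurd ((hx.monotone (Fin.succ_le_castSucc_iff.mpr h)).trans hmem.1)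
        (not_le.mpr h'.2)

/-- The quadratic bubble on the union of two adjacent intervals. -/
lemma exists_isTest_edge {n : ℕ} {x : Fin (n + 1) → ℝ} (hx : StrictMono x) {k : ℕ}
    (hk : 2 ≤ k) {i i' : Fin n} (hii : i.succ = i'.castSucc) :
    ∃ A, IsTest x k A ∧ A (x i.succ) ≠ 0 ∧ ∀ j, j ≠ i.succ → A (x j) = 0 := by
  set a := x i.castSucc with ha
  set b := x i'.succ with hb
  set p : ℝ[X] := (X - C a) * (X - C b) with hp
  have hpa : p.eval a = 0 := by simp [hp]
  have hpb : p.eval b = 0 := by simp [hp]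
  have hdeg : p.natDegree ≤ k :=
    (natDegree_mul_le.trans (by rw [natDegree_X_sub_C, natDegree_X_sub_C])).trans hk
  have hv := congrArg Fin.val hii
  simp only [Fin.val_succ, Fin.val_castSucc] at hv
  have h1 : a < x i.succ := hx Fin.castSucc_lt_succ
  have h2 : x i.succ < b := by rw [hii]; exact hx Fin.castSucc_lt_succ
  refine ⟨bump a b p, isTest_bump hx (Fin.le_def.mpr (by omega)) hdeg hpa hpb, ?_,
    fun j hj => ?_⟩
  · rw [bump_of_mem p ⟨h1.le, h2.le⟩, hp]
    simpa using ⟨(sub_pos.mpr h1).ne', (sub_neg.mpr h2).ne⟩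
  · rcases lt_or_gt_of_ne hj with h | h
    · refine bump_eq_zero_of_le hpa (hx.monotone ?_)
      rw [Fin.lt_def, Fin.val_succ] at h
      rw [Fin.le_def, Fin.val_castSucc]
      omega
    · refine bump_eq_zero_of_ge hpb (hx.monotone ?_)
      rw [Fin.lt_def, Fin.val_succ] at h
      rw [Fin.le_def, Fin.val_succ]
      omega

variable {G : RectGrid}

lemma eval_eq_sum_fin {k : ℕ} {p : ℝ[X]} (hp : p.natDegree ≤ k) (t : ℝ) :
    p.eval t = ∑ i : Fin (k + 1), p.coeff i * t ^ (i : ℕ) := by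
  rw [eval_eq_sum_range' (Nat.lt_succ_of_le hp)]
  exact (Fin.sum_univ_eq_sum_range (fun i => p.coeff i * t ^ i) (k + 1)).symm

/-- The tensor product of two one-dimensional test functions is a finite element function. -/
noncomputable def tensor {k : ℕ} {A B : ℝ → ℝ} (hA : IsTest G.x k A) (hB : IsTest G.y k B) :
    femSpace G k :=
  ⟨G.dom.indicator fun z => A z.1 * B z.2, by
    refine ContinuousOn.congr (f := fun z => A z.1 * B z.2) ?_ fun z hz => indicator_of_mem hz _
    exact ((hA.cont.comp continuous_fst).mul (hB.cont.comp continuous_snd)).continuousOn,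
    fun z hz => indicator_of_notMem hz _, fun c => by
    obtain ⟨p, hp, hpA⟩ := hA.poly c.1
    obtain ⟨q, hq, hqB⟩ := hB.poly c.2
    refine ⟨fun i j => p.coeff i * q.coeff j, fun z hz => ?_⟩
    rw [indicator_of_mem (G.cell_subset c hz), hpA _ hz.1, hqB _ hz.2, eval_eq_sum_fin hp,
      eval_eq_sum_fin hq, Finset.sum_mul_sum]
    exact Finset.sum_congr rfl fun i _ => Finset.sum_congr rfl fun j _ => by ring⟩

lemma tensor_apply {k : ℕ} {A B : ℝ → ℝ} (hA : IsTest G.x k A) (hB : IsTest G.y k B)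
    {z : ℝ × ℝ} (hz : z ∈ G.dom) : (tensor hA hB).1 z = A z.1 * B z.2 :=
  indicator_of_mem hz fun z => A z.1 * B z.2

lemma tensor_frontier {k : ℕ} {A B : ℝ → ℝ} (hA : IsTest G.x k A) (hB : IsTest G.y k B)
    {z : ℝ × ℝ} (hz : z ∈ frontier G.dom) : (tensor hA hB).1 z = 0 := by
  obtain ⟨h1, h2⟩ := G.mem_frontier_dom.mp hz
  rw [tensor_apply hA hB h1]
  rcases h2 with h | h | h | h <;> rw [h] <;> simp [hA.left, hA.right, hB.left, hB.right]

/-- The slice of a finite element function along a horizontal line is a polynomial on each cell. -/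
lemma exists_slice {m : ℕ} (f : femSpace G m) (c : Fin G.nx × Fin G.ny) {y : ℝ}
    (hy : y ∈ Icc (G.y c.2.castSucc) (G.y c.2.succ)) : ∃ S : ℝ[X], S.natDegree ≤ m ∧
      ∀ x ∈ Icc (G.x c.1.castSucc) (G.x c.1.succ), f.1 (x, y) = S.eval x := by
  obtain ⟨p, hp, hval, -⟩ := exists_slicePoly f c
  refine ⟨∑ l : Fin (m + 1), C (y ^ (l : ℕ)) * p l, natDegree_sum_le_of_forall_le _ _ fun l _ =>
    (natDegree_C_mul_le _ _).trans (hp l), fun x hx => ?_⟩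
  rw [hval (x, y) ⟨hx, hy⟩, eval_finsetSum]
  refine Finset.sum_congr rfl fun l _ => ?_
  rw [eval_mul, eval_C, mul_comm]

lemma deriv_slice {f : ℝ × ℝ → ℝ} {S : ℝ[X]} {a b x y : ℝ} (hx : x ∈ Ioo a b)
    (h : ∀ x ∈ Icc a b, f (x, y) = S.eval x) :
    deriv (fun x => f (x, y)) x = (derivative S).eval x := by
  refine HasDerivAt.deriv ((S.hasDerivAt x).congr_of_eventuallyEq ?_)
  filter_upwards [isOpen_Ioo.mem_nhds hx] with w hw
  exact h w (Ioo_subset_Icc_self hw)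

/-- Testing `∂ₓ q` with the product of the interior bubble at a node `ξ` and a test function `B`,
the exactness of the quadrature leaves a quadrature sum over the vertical line through `ξ`. -/
lemma integral_interior_mul {k : ℕ} (hk : 1 ≤ k) (q : femSpace G (k - 1)) (i : Fin G.nx) {s : ℝ}
    (hs : s ∈ glInner k) {A B : ℝ → ℝ} (hA : IsTest G.x k A) (hB : IsTest G.y k B)
    (hA0 : ∀ t, t ∉ Ioo (G.x i.castSucc) (G.x i.succ) → A t = 0)
    (hA1 : ∀ j, ∀ t ∈ glNodes k, node1 G.x j t ≠ node1 G.x i s → A (node1 G.x j t) = 0) :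
    ∫ z in G.dom, A z.1 * B z.2 * (dX q).1 z =
      (G.x i.succ - G.x i.castSucc) * glWeight k s * A (node1 G.x i s) *
        ∑ j, ∑ t ∈ glNodes k, (G.y j.succ - G.y j.castSucc) * glWeight k t *
          (B (node1 G.y j t) * deriv (fun x => q.1 (x, node1 G.y j t)) (node1 G.x i s)) := by
  have hint : IntegrableOn (fun z => A z.1 * B z.2 * (dX q).1 z) G.dom := by
    have := G.integrable_bdd (⟨fun z => A z.1 * B z.2, G.mem_bdd_of_continuousOn
      ((hA.cont.comp continuous_fst).mul (hB.cont.comp continuous_snd)).continuousOn⟩ * dX q)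
    exact this
  rw [G.integral_dom_eq_sum hint, Fintype.sum_prod_type, Finset.sum_eq_single i]
  · rw [Finset.mul_sum]
    refine Finset.sum_congr rfl fun j _ => ?_
    obtain ⟨p, hp, hval, hder⟩ := exists_slicePoly q (i, j)
    obtain ⟨a, ha, haA⟩ := hA.poly i
    obtain ⟨b, hb, hbB⟩ := hB.poly j
    have h1 : ∫ z in G.openCell (i, j), A z.1 * B z.2 * (dX q).1 z =
        ∫ z in G.openCell (i, j), ∑ l : Fin (k - 1 + 1), (a * derivative (p l)).eval z.1
          * (b * X ^ (l : ℕ)).eval z.2 := by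
      refine setIntegral_congr_fun (G.isOpen_openCell _).measurableSet fun z hz => ?_
      have hz' := G.openCell_subset_cell _ hz
      simp only [hder z hz, haA _ hz'.1, hbB _ hz'.2, Finset.mul_sum, eval_mul, eval_pow, eval_X]
      exact Finset.sum_congr rfl fun l _ => by ring
    have hdp : ∀ l, (a * derivative (p l)).natDegree ≤ 2 * k - 1 := fun l => by
      have := natDegree_derivative_le (p l)
      have := hp l
      exact natDegree_mul_le.trans (by omega)
    have hdq : ∀ l : Fin (k - 1 + 1), (b * X ^ (l : ℕ)).natDegree ≤ 2 * k - 1 := fun l => by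
      have := natDegree_X_pow_le (R := ℝ) (l : ℕ)
      exact natDegree_mul_le.trans (by omega)
    rw [h1, integral_openCell_sum_mul hk _ hdp hdq,
      Finset.sum_eq_single_of_mem s (glInner_subset_glNodes k hs), Finset.mul_sum]
    · refine Finset.sum_congr rfl fun t ht => ?_
      have hy : node1 G.y j t ∈ Icc (G.y j.castSucc) (G.y j.succ) :=
        node1_mem_Icc G.y_mono j (glNodes_subset_Icc hk ht)
      have hx : node1 G.x i s ∈ Ioo (G.x i.castSucc) (G.x i.succ) :=
        node1_mem_Ioo G.x_mono i (glInner_subset_Ioo hk hs)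
      have hd : deriv (fun x => q.1 (x, node1 G.y j t)) (node1 G.x i s) =
          ∑ l, (derivative (p l)).eval (node1 G.x i s) * node1 G.y j t ^ (l : ℕ) := by
        rw [deriv_slice (S := ∑ l : Fin (k - 1 + 1), C (node1 G.y j t ^ (l : ℕ)) * p l) hx]
        · rw [derivative_sum, eval_finsetSum]
          refine Finset.sum_congr rfl fun l _ => ?_
          rw [derivative_C_mul, eval_mul, eval_C, mul_comm]
        · intro x hx
          rw [hval (x, node1 G.y j t) ⟨hx, hy⟩, eval_finsetSum]
          refine Finset.sum_congr rfl fun l _ => ?_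
          rw [eval_mul, eval_C, mul_comm]
      rw [hd, haA _ (Ioo_subset_Icc_self hx), hbB _ hy, RectGrid.cellArea]
      have hn : G.node (i, j) s t = (node1 G.x i s, node1 G.y j t) := rfl
      rw [hn]
      simp only [eval_mul, eval_pow, eval_X, Finset.mul_sum]
      exact Finset.sum_congr rfl fun l _ => by ring
    · intro s' hs' hne
      refine Finset.sum_eq_zero fun t _ => ?_
      have hz : a.eval (node1 G.x i s') = 0 := by
        rw [← haA _ (node1_mem_Icc G.x_mono i (glNodes_subset_Icc hk hs'))]
        exact hA1 i s' hs' fun h => hne (node1_inj G.x_mono h)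
      rw [Finset.sum_eq_zero, mul_zero]
      intro l _
      have hn : (G.node (i, j) s' t).1 = node1 G.x i s' := rfl
      rw [hn, eval_mul, hz, zero_mul, zero_mul]
  · intro i' _ hne
    refine Finset.sum_eq_zero fun j _ => ?_
    rw [setIntegral_congr_fun (g := fun _ => (0 : ℝ)) (G.isOpen_openCell _).measurableSet,
      integral_zero]
    intro z hz
    have : A z.1 = 0 := by
      refine hA0 _ fun h => ?_
      rcases lt_or_gt_of_ne hne with hlt | hlt
      · have := G.x_mono.monotone (Fin.succ_le_castSucc_iff.mpr hlt)
        exact absurd (hz.1.2.trans_le this) (not_lt.mpr h.1.le)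
      · have := G.x_mono.monotone (Fin.succ_le_castSucc_iff.mpr hlt)
        exact absurd (h.2.trans_le this) (not_lt.mpr hz.1.1.le)
    simp [this]
  · intro h; exact absurd (Finset.mem_univ i) h

/-- If `∂ₓ q` is orthogonal to all tensor-product test functions, then `q` is constant in each cell
along the horizontal lines through interior nodes and along interior horizontal grid lines. -/
lemma const_on_lines {k : ℕ} (hk : 2 ≤ k) (q : femSpace G (k - 1))
    (H : ∀ A B, IsTest G.x k A → IsTest G.y k B →
      ∫ z in G.dom, A z.1 * B z.2 * (dX q).1 z = 0) (i : Fin G.nx) {y : ℝ}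
    (hy : (∃ j, ∃ t ∈ glInner k, y = node1 G.y j t) ∨
      ∃ j j' : Fin G.ny, j.succ = j'.castSucc ∧ y = G.y j.succ) :
    ∀ x ∈ Icc (G.x i.castSucc) (G.x i.succ), ∀ x' ∈ Icc (G.x i.castSucc) (G.x i.succ),
      q.1 (x, y) = q.1 (x', y) := by
  have hk1 : 1 ≤ k := by omega
  -- The derivative vanishes wherever a single node can be isolated by a test function.
  have key : ∀ s ∈ glInner k, ∀ (B : ℝ → ℝ) (y : ℝ), IsTest G.y k B → B y ≠ 0 →
      (∃ j, ∃ t ∈ glNodes k, node1 G.y j t = y) →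
      (∀ j, ∀ t ∈ glNodes k, node1 G.y j t ≠ y →
        B (node1 G.y j t) * deriv (fun x => q.1 (x, node1 G.y j t)) (node1 G.x i s) = 0) →
      deriv (fun x => q.1 (x, y)) (node1 G.x i s) = 0 := by
    intro s hs B y hB hBy hex hz
    obtain ⟨A, hA, hA0, hA1, hA2⟩ := exists_isTest_interior G.x_mono hk1 i hs
    have h := H A B hA hB
    rw [integral_interior_mul hk1 q i hs hA hB hA1 hA2] at h
    have hc : (G.x i.succ - G.x i.castSucc) * glWeight k s * A (node1 G.x i s) ≠ 0 :=
      mul_ne_zero (mul_pos (sub_pos.mpr (G.x_lt i))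
        (glWeight_pos hk1 (glInner_subset_glNodes k hs))).ne' hA0
    have h2 := (mul_eq_zero.mp h).resolve_left hc
    classical
    have h3 : ∀ j, ∀ t ∈ glNodes k, (G.y j.succ - G.y j.castSucc) * glWeight k t *
        (B (node1 G.y j t) * deriv (fun x => q.1 (x, node1 G.y j t)) (node1 G.x i s)) =
        (if node1 G.y j t = y then (G.y j.succ - G.y j.castSucc) * glWeight k t else 0) *
        (B y * deriv (fun x => q.1 (x, y)) (node1 G.x i s)) := by
      intro j t ht
      split_ifs with hjt
      · rw [hjt]
      · rw [hz j t ht hjt]; ring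
    rw [Finset.sum_congr rfl fun j _ => Finset.sum_congr rfl (h3 j)] at h2
    simp only [← Finset.sum_mul] at h2
    have hnn : ∀ j, ∀ t ∈ glNodes k, 0 ≤
        (if node1 G.y j t = y then (G.y j.succ - G.y j.castSucc) * glWeight k t else 0) := by
      intro j t ht
      split_ifs
      · exact (mul_pos (sub_pos.mpr (G.y_lt j)) (glWeight_pos hk1 ht)).le
      · exact le_rfl
    obtain ⟨j, t, ht, hjt⟩ := hex
    have hpos : 0 < ∑ j, ∑ t ∈ glNodes k,
        (if node1 G.y j t = y then (G.y j.succ - G.y j.castSucc) * glWeight k t else 0) := by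
      refine Finset.sum_pos' (fun j _ => Finset.sum_nonneg (hnn j)) ⟨j, Finset.mem_univ j, ?_⟩
      refine Finset.sum_pos' (hnn j) ⟨t, ht, ?_⟩
      rw [if_pos hjt]
      exact mul_pos (sub_pos.mpr (G.y_lt j)) (glWeight_pos hk1 ht)
    exact (mul_eq_zero.mp ((mul_eq_zero.mp h2).resolve_left hpos.ne')).resolve_left hBy
  have hinner : ∀ s ∈ glInner k, ∀ j, ∀ t ∈ glInner k,
      deriv (fun x => q.1 (x, node1 G.y j t)) (node1 G.x i s) = 0 := by
    intro s hs j t ht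
    obtain ⟨B, hB, hB0, -, hB2⟩ := exists_isTest_interior G.y_mono hk1 j ht
    exact key s hs B _ hB hB0 ⟨j, t, glInner_subset_glNodes k ht, rfl⟩
      fun j' t' ht' hne => by rw [hB2 j' t' ht' hne, zero_mul]
  have hder : ∀ s ∈ glInner k, deriv (fun x => q.1 (x, y)) (node1 G.x i s) = 0 := by
    intro s hs
    rcases hy with ⟨j, t, ht, rfl⟩ | ⟨j, j', hjj, rfl⟩
    · exact hinner s hs j t ht
    · obtain ⟨B, hB, hB0, hB1⟩ := exists_isTest_edge G.y_mono hk hjj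
      refine key s hs B _ hB hB0 ⟨j, 1, one_mem_glNodes k, node1_one _ _⟩
        fun l t ht hne => ?_
      rcases mem_glNodes_cases ht with rfl | rfl | ht'
      · rw [node1_zero] at hne ⊢
        rw [hB1 _ fun h => hne (by rw [h]), zero_mul]
      · rw [node1_one] at hne ⊢
        rw [hB1 _ fun h => hne (by rw [h]), zero_mul]
      · rw [hinner s hs l t ht', mul_zero]
  obtain ⟨j, hyj⟩ : ∃ j : Fin G.ny, y ∈ Icc (G.y j.castSucc) (G.y j.succ) := by
    rcases hy with ⟨j, t, ht, rfl⟩ | ⟨j, j', -, rfl⟩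
    · exact ⟨j, node1_mem_Icc G.y_mono j (glNodes_subset_Icc hk1 (glInner_subset_glNodes k ht))⟩
    · exact ⟨j, (G.y_lt j).le, le_rfl⟩
  obtain ⟨S, hS, hSval⟩ := exists_slice q (i, j) hyj
  have hS0 : derivative S = 0 := by
    have hinj : Set.InjOn (node1 G.x i) (glInner k) := fun s _ t _ h => node1_inj G.x_mono h
    refine eq_zero_of_natDegree_lt_card_of_eval_eq_zero' _
      ((glInner k).image (node1 G.x i)) (fun x hx => ?_) ?_
    · obtain ⟨s, hs, rfl⟩ := Finset.mem_image.mp hx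
      rw [← deriv_slice (node1_mem_Ioo G.x_mono i (glInner_subset_Ioo hk1 hs)) hSval]
      exact hder s hs
    · rw [Finset.card_image_of_injOn hinj, card_glInner hk1]
      have := natDegree_derivative_le S
      omega
  intro x hx x' hx'
  rw [hSval x hx, hSval x' hx', eq_C_of_derivative_eq_zero hS0, eval_C, eval_C]

/-! Exchanging the two coordinates. -/

/-- The grid with the two coordinates exchanged. -/
def RectGrid.swap (G : RectGrid) : RectGrid where
  nx := G.ny
  ny := G.nx
  nx_pos := G.ny_pos
  ny_pos := G.nx_pos
  x := G.y
  y := G.x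
  x_mono := G.y_mono
  y_mono := G.x_mono

lemma RectGrid.swap_mem_dom {z : ℝ × ℝ} : z.swap ∈ G.dom ↔ z ∈ G.swap.dom := by
  simp only [dom, swap, mem_prod, Prod.fst_swap, Prod.snd_swap]
  exact and_comm

/-- A finite element function with the two coordinates exchanged. -/
def femSwap {m : ℕ} (f : femSpace G m) : femSpace G.swap m :=
  ⟨f.1 ∘ Prod.swap, f.2.1.comp continuous_swap.continuousOn fun z hz => G.swap_mem_dom.mpr hz,
    fun z hz => f.2.2.1 _ fun h => hz (G.swap_mem_dom.mp h), fun c => by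
    obtain ⟨a, ha⟩ := f.2.2.2 (c.2, c.1)
    refine ⟨fun i j => a j i, fun z hz => ?_⟩
    rw [Function.comp_apply, ha z.swap ⟨hz.2, hz.1⟩, Finset.sum_comm]
    exact Finset.sum_congr rfl fun i _ => Finset.sum_congr rfl fun j _ => by
      rw [Prod.fst_swap, Prod.snd_swap, mul_comm (z.2 ^ _)]⟩

lemma RectGrid.swap_mem_interiors {z : ℝ × ℝ} (hz : z ∈ G.swap.interiors) :
    z.swap ∈ G.interiors := by
  obtain ⟨c, hc⟩ := mem_iUnion.mp hz
  exact mem_iUnion.mpr ⟨(c.2, c.1), hc.2, hc.1⟩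

lemma dX_femSwap {m : ℕ} (f : femSpace G m) {z : ℝ × ℝ} (hz : z ∈ G.swap.interiors) :
    (dX (femSwap f)).1 z = (dY f).1 z.swap :=
  (hasDerivAt_fst (femSwap f) (x := z.1) (y := z.2) hz).unique
    (hasDerivAt_snd f (G.swap_mem_interiors hz))

lemma integral_swap_dX {m : ℕ} (q : femSpace G m) (A B : ℝ → ℝ) :
    ∫ z in G.swap.dom, A z.1 * B z.2 * (dX (femSwap q)).1 z
      = ∫ z in G.dom, B z.1 * A z.2 * (dY q).1 z := by
  have h1 : ∫ z in G.swap.dom, A z.1 * B z.2 * (dX (femSwap q)).1 z =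
      ∫ z in G.swap.dom, (fun z : ℝ × ℝ => B z.1 * A z.2 * (dY q).1 z) z.swap := by
    refine integral_congr_ae ?_
    filter_upwards [G.swap.ae_mem_interiors] with z hz
    rw [dX_femSwap q hz, Prod.fst_swap, Prod.snd_swap, mul_comm (A z.1)]
  rw [h1, RectGrid.dom, Measure.volume_eq_prod]
  exact setIntegral_prod_swap _ _ (fun z : ℝ × ℝ => B z.1 * A z.2 * (dY q).1 z)

/-- A velocity with vanishing second component. -/
noncomputable def tensorFst {k : ℕ} {A B : ℝ → ℝ} (hA : IsTest G.x k A) (hB : IsTest G.y k B) :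
    velSpace G k :=
  ⟨((tensor hA hB).1, 0), (tensor hA hB).2, zero_mem _, fun _ hz =>
    ⟨tensor_frontier hA hB hz, rfl⟩⟩

/-- A velocity with vanishing first component. -/
noncomputable def tensorSnd {k : ℕ} {A B : ℝ → ℝ} (hA : IsTest G.x k A) (hB : IsTest G.y k B) :
    velSpace G k :=
  ⟨(0, (tensor hA hB).1), zero_mem _, (tensor hA hB).2, fun _ hz =>
    ⟨rfl, tensor_frontier hA hB hz⟩⟩

lemma transForm_tensorFst {k m : ℕ} {A B : ℝ → ℝ} (hA : IsTest G.x k A) (hB : IsTest G.y k B)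
    (q : femSpace G m) :
    transForm 1 (tensorFst hA hB) q = ∫ z in G.dom, A z.1 * B z.2 * (dX q).1 z := by
  refine setIntegral_congr_fun G.isCompact_dom.measurableSet fun z hz => ?_
  change 1 * ((tensor hA hB).1 z * (dX q).1 z + 0 * (dY q).1 z) = _
  rw [tensor_apply hA hB hz]
  ring

lemma transForm_tensorSnd {k m : ℕ} {A B : ℝ → ℝ} (hA : IsTest G.x k A) (hB : IsTest G.y k B)
    (q : femSpace G m) :
    transForm 1 (tensorSnd hA hB) q = ∫ z in G.dom, A z.1 * B z.2 * (dY q).1 z := by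
  refine setIntegral_congr_fun G.isCompact_dom.measurableSet fun z hz => ?_
  change 1 * (0 * (dX q).1 z + (tensor hA hB).1 z * (dY q).1 z) = _
  rw [tensor_apply hA hB hz]
  ring

/-- A function on a cell is constant if it is constant along the horizontal lines through interior
nodes, along the vertical lines through interior nodes, and along one vertical side: on every
horizontal line its degree is smaller than the number of these vertical lines. -/
lemma const_on_cell {k : ℕ} (hk : 2 ≤ k) (q : femSpace G (k - 1)) (c : Fin G.nx × Fin G.ny)
    (hx : ∀ t ∈ glInner k, ∀ x ∈ Icc (G.x c.1.castSucc) (G.x c.1.succ),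
      ∀ x' ∈ Icc (G.x c.1.castSucc) (G.x c.1.succ),
        q.1 (x, node1 G.y c.2 t) = q.1 (x', node1 G.y c.2 t))
    {e : ℝ} (he : e = 0 ∨ e = 1)
    (hy : ∀ s ∈ insert e (glInner k), ∀ y ∈ Icc (G.y c.2.castSucc) (G.y c.2.succ),
      ∀ y' ∈ Icc (G.y c.2.castSucc) (G.y c.2.succ),
        q.1 (node1 G.x c.1 s, y) = q.1 (node1 G.x c.1 s, y')) :
    ∃ a, ∀ z ∈ G.cell c, q.1 z = a := by
  have hk1 : 1 ≤ k := by omega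
  have heN : e ∈ glNodes k := by
    rcases he with rfl | rfl
    · exact zero_mem_glNodes k
    · exact one_mem_glNodes k
  have heI : e ∉ glInner k := fun h => by
    have := glInner_subset_Ioo hk1 h
    rcases he with rfl | rfl
    · exact lt_irrefl _ this.1
    · exact lt_irrefl _ this.2
  have hsub : ∀ s ∈ insert e (glInner k), node1 G.x c.1 s ∈ Icc (G.x c.1.castSucc) (G.x c.1.succ) :=
    fun s hs => node1_mem_Icc G.x_mono _ (glNodes_subset_Icc hk1
      ((Finset.insert_subset heN (glInner_subset_glNodes k)) hs))
  obtain ⟨t, ht⟩ : (glInner k).Nonempty := by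
    rw [← Finset.card_pos, card_glInner hk1]; omega
  have htI := node1_mem_Icc G.y_mono c.2 (glNodes_subset_Icc hk1 (glInner_subset_glNodes k ht))
  set a := q.1 (node1 G.x c.1 e, node1 G.y c.2 t) with ha
  refine ⟨a, ?_⟩
  rintro ⟨x, y⟩ ⟨hxI, hyI⟩
  obtain ⟨S, hS, hSval⟩ := exists_slice q c hyI
  have hinj : Set.InjOn (node1 G.x c.1) (insert e (glInner k) : Finset ℝ) :=
    fun s _ t _ h => node1_inj G.x_mono h
  have h0 : S - C a = 0 := by
    refine eq_zero_of_natDegree_lt_card_of_eval_eq_zero' _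
      ((insert e (glInner k)).image (node1 G.x c.1)) (fun x' hx' => ?_) ?_
    · obtain ⟨s, hs, rfl⟩ := Finset.mem_image.mp hx'
      rw [eval_sub, eval_C, ← hSval _ (hsub s hs), hy s hs y hyI _ htI,
        hx t ht _ (hsub s hs) _ (hsub e (Finset.mem_insert_self _ _)), sub_self]
    · rw [Finset.card_image_of_injOn hinj, Finset.card_insert_of_notMem heI, card_glInner hk1,
        natDegree_sub_C]
      omega
  rw [hSval x hxI, sub_eq_zero.mp h0, eval_C]

/-- On a grid with at least two columns every cell has a vertical side in the interior. -/
lemma exists_interior_side {n : ℕ} (hn : 2 ≤ n) (x : Fin (n + 1) → ℝ) (i : Fin n) :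
    ∃ e : ℝ, (e = 0 ∨ e = 1) ∧ ∃ j j' : Fin n, j.succ = j'.castSucc ∧ node1 x i e = x j.succ := by
  by_cases h : (i : ℕ) + 1 < n
  · exact ⟨1, Or.inr rfl, i, ⟨i + 1, h⟩, by ext; simp, node1_one x i⟩
  · refine ⟨0, Or.inl rfl, ⟨i - 1, by omega⟩, i, ?_, ?_⟩
    · ext
      simp only [Fin.val_succ, Fin.val_castSucc]
      omega
    · rw [node1_zero]
      congr 1
      ext
      simp only [Fin.val_succ, Fin.val_castSucc]
      omega

lemma const_on_cells {k : ℕ} (hk : 2 ≤ k) (hn : 2 ≤ G.nx) (q : femSpace G (k - 1))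
    (HX : ∀ A B, IsTest G.x k A → IsTest G.y k B →
      ∫ z in G.dom, A z.1 * B z.2 * (dX q).1 z = 0)
    (HY : ∀ A B, IsTest G.x k A → IsTest G.y k B →
      ∫ z in G.dom, A z.1 * B z.2 * (dY q).1 z = 0) (c : Fin G.nx × Fin G.ny) :
    ∃ a, ∀ z ∈ G.cell c, q.1 z = a := by
  have hY := const_on_lines (G := G.swap) hk (femSwap q) fun A B hA hB => by
    rw [integral_swap_dX]
    exact HY B A hB hA
  obtain ⟨e, he, j, j', hjj, hej⟩ := exists_interior_side hn G.x c.1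
  refine const_on_cell hk q c (fun t ht => const_on_lines hk q HX c.1 (Or.inl ⟨c.2, t, ht, rfl⟩))
    he fun s hs y hy y' hy' => ?_
  rcases Finset.mem_insert.mp hs with rfl | hs
  · exact hY c.2 (Or.inr ⟨j, j', hjj, hej⟩) y hy y' hy'
  · exact hY c.2 (Or.inl ⟨c.1, s, hs, rfl⟩) y hy y' hy'

/-- On a grid with at least two cells, a mean-zero pressure whose discrete gradient vanishes is
zero. -/
theorem eq_zero_of_transForm_eq_zero {k : ℕ} (hk : 1 ≤ k) (hG : 2 ≤ G.nx * G.ny)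
    (q : meanZeroSpace G (k - 1))
    (h : ∀ v : velSpace G k, transForm 1 v (⟨q.1, q.2.1⟩ : femSpace G (k - 1)) = 0) : q = 0 := by
  set f : femSpace G (k - 1) := ⟨q.1, q.2.1⟩ with hf
  have hcells : ∀ c, ∃ a, ∀ z ∈ G.cell c, f.1 z = a := by
    rcases Nat.lt_or_ge 1 k with hk2 | hk1
    · have HX : ∀ A B, IsTest G.x k A → IsTest G.y k B →
          ∫ z in G.dom, A z.1 * B z.2 * (dX f).1 z = 0 := fun A B hA hB => by
        rw [← transForm_tensorFst hA hB, h]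
      have HY : ∀ A B, IsTest G.x k A → IsTest G.y k B →
          ∫ z in G.dom, A z.1 * B z.2 * (dY f).1 z = 0 := fun A B hA hB => by
        rw [← transForm_tensorSnd hA hB, h]
      rcases Nat.lt_or_ge 1 G.nx with hn | hn
      · exact const_on_cells hk2 hn f HX HY
      · have hny : 2 ≤ G.swap.nx := by
          have hx1 : G.nx = 1 := le_antisymm hn G.nx_pos
          rw [hx1, one_mul] at hG
          exact hG
        have hsw := const_on_cells (G := G.swap) hk2 hny (femSwap f)
          (fun A B hA hB => by rw [integral_swap_dX]; exact HY B A hB hA)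
          (fun A B hA hB => by
            have h1 := integral_swap_dX (G := G.swap) (femSwap f) B A
            rw [← h1]
            exact HX B A hB hA)
        rintro ⟨i, j⟩
        obtain ⟨a, ha⟩ := hsw (j, i)
        exact ⟨a, fun z hz => ha z.swap ⟨hz.2, hz.1⟩⟩
    · intro c
      have hk0 : k - 1 = 0 := by omega
      obtain ⟨a, ha⟩ := q.2.1.2.2 c
      refine ⟨∑ i, ∑ j, a i j, fun z hz => ?_⟩
      rw [hf]
      refine (ha z hz).trans (Finset.sum_congr rfl fun i _ => Finset.sum_congr rfl fun j _ => ?_)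
      have hi : (i : ℕ) = 0 := by omega
      have hj : (j : ℕ) = 0 := by omega
      rw [hi, hj]; simp
  obtain ⟨a, ha⟩ := eq_of_const_on_cells f hcells
  have hmean : ∫ z in G.dom, f.1 z = 0 := q.2.2
  rw [setIntegral_congr_fun (g := fun _ => a) G.isCompact_dom.measurableSet ha, setIntegral_const,
    smul_eq_mul] at hmean
  have hvol : volume.real G.dom ≠ 0 := by
    have : volume.real G.dom = ∑ j : G.NodeIdx k, G.wt j := volume_dom_toReal hk
    rw [this]
    exact (Finset.sum_pos (fun j _ => G.wt_pos hk j) Finset.univ_nonempty).ne'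
  have ha0 := (mul_eq_zero.mp hmean).resolve_left hvol
  refine Subtype.ext ?_
  ext z
  by_cases hz : z ∈ G.dom
  · exact (ha z hz).trans ha0
  · exact f.2.2.1 z hz

end InfSup

/-! ### Unique solvability of a single time step -/

section Steps

variable {G : RectGrid} {k : ℕ} (P : Params)

lemma measurable_trunc : Measurable trunc :=
  (measurable_const.max (measurable_const.min measurable_id) :
    Measurable fun s : ℝ => max (-1) (min 1 s))

lemma aemeasurable_fem {m : ℕ} (f : femSpace G m) : AEMeasurable f.1 G.vol :=
  (f.2.1.aestronglyMeasurable G.isCompact_dom.measurableSet).aemeasurable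

/-- The mobility evaluated at a function with values in `[-1, 1]`. -/
noncomputable def mobility (g : ℝ × ℝ → ℝ) (hg : AEMeasurable g G.vol)
    (hI : ∀ᵐ z ∂G.vol, g z ∈ Icc (-1 : ℝ) 1) : G.bdd :=
  ⟨fun z => P.M (g z), by
    refine MemLp.of_bound (P.M_meas.comp_aemeasurable hg).aestronglyMeasurable P.m₂ ?_
    filter_upwards [hI] with z hz
    rw [Real.norm_eq_abs, abs_of_pos (P.M_pos hz)]
    exact (P.M_bounds _ hz).2⟩

lemma mobility_pos {g : ℝ × ℝ → ℝ} (hg : AEMeasurable g G.vol)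
    (hI : ∀ᵐ z ∂G.vol, g z ∈ Icc (-1 : ℝ) 1) : ∀ᵐ z ∂G.vol, 0 < (mobility P g hg hI).1 z := by
  filter_upwards [hI] with z hz using P.M_pos hz

/-- The viscosity evaluated at a function with values in `[-1, 1]`. -/
noncomputable def viscosity (g : ℝ × ℝ → ℝ) (hg : AEMeasurable g G.vol)
    (hI : ∀ᵐ z ∂G.vol, g z ∈ Icc (-1 : ℝ) 1) : G.bdd :=
  ⟨fun z => P.η (g z), by
    have hη : Measurable P.η := by unfold Params.η; fun_prop
    refine MemLp.of_bound (hη.comp_aemeasurable hg).aestronglyMeasurable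
      (1 + P.η₂ / P.η₁) ?_
    filter_upwards [hI] with z hz
    rw [Real.norm_eq_abs, abs_of_pos (P.η_pos hz), Params.η]
    have := (div_pos P.η₂_pos P.η₁_pos).le
    nlinarith [hz.1, hz.2]⟩

lemma viscosity_pos {g : ℝ × ℝ → ℝ} (hg : AEMeasurable g G.vol)
    (hI : ∀ᵐ z ∂G.vol, g z ∈ Icc (-1 : ℝ) 1) : ∀ᵐ z ∂G.vol, 0 < (viscosity P g hg hI).1 z := by
  filter_upwards [hI] with z hz using P.η_pos hz

/-- The mobility at the truncation of a finite element function. -/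
noncomputable def truncMobility {m : ℕ} (f : femSpace G m) : G.bdd :=
  mobility P (fun z => trunc (f.1 z)) (measurable_trunc.comp_aemeasurable (aemeasurable_fem f))
    (ae_of_all _ fun _ => trunc_mem _)

/-- The viscosity at the truncation of a finite element function. -/
noncomputable def truncViscosity {m : ℕ} (f : femSpace G m) : G.bdd :=
  viscosity P (fun z => trunc (f.1 z)) (measurable_trunc.comp_aemeasurable (aemeasurable_fem f))
    (ae_of_all _ fun _ => trunc_mem _)

lemma ip_fn {m : ℕ} (f : femSpace G k) (g : femSpace G m) :
    ip G (fun z => P.fn (f.1 z)) g.1 = -P.θc * massForm 1 f g := by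
  have h := ip_eq_massForm ((-P.θc) • f) g
  rw [map_smul] at h
  exact h

/-- The inclusion of the mean-zero functions. -/
def meanIncl {m : ℕ} : meanZeroSpace G m →ₗ[ℝ] femSpace G m where
  toFun q := ⟨q.1, q.2.1⟩
  map_add' _ _ := rfl
  map_smul' _ _ := rfl

instance finiteDimensional_meanZeroSpace (m : ℕ) : FiniteDimensional ℝ (meanZeroSpace G m) :=
  Module.Finite.of_injective (meanIncl (G := G) (m := m)) fun _ _ h =>
    Subtype.ext (congrArg (fun f : femSpace G m => f.1) h)

/-- Orthogonality to the gradients of mean-zero functions suffices, since constants have gradient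
zero. -/
lemma transForm_eq_zero_of_meanZero (hk : 1 ≤ k) {m : ℕ} {u : velSpace G k}
    (h : ∀ q : meanZeroSpace G m, transForm 1 u (meanIncl q) = 0) (q : femSpace G m) :
    transForm 1 u q = 0 := by
  have hvol : volume.real G.dom ≠ 0 := by
    have : volume.real G.dom = ∑ j : G.NodeIdx k, G.wt j := volume_dom_toReal hk
    rw [this]
    exact (Finset.sum_pos (fun j _ => G.wt_pos hk j) Finset.univ_nonempty).ne'
  set a := (∫ z in G.dom, q.1 z) / volume.real G.dom with ha
  have hmem : (q - a • femOne G m).1 ∈ meanZeroSpace G m := by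
    refine ⟨(q - a • femOne G m).2, ?_⟩
    have h1 : ∫ z in G.dom, (q - a • femOne G m).1 z = ∫ z in G.dom, (q.1 z - a) := by
      refine setIntegral_congr_fun G.isCompact_dom.measurableSet fun z hz => ?_
      change q.1 z - a * (femOne G m).1 z = _
      rw [femOne_apply hz, mul_one]
    rw [h1, integral_sub (integrableOn_of_mem_femSpace q.2) (integrable_const a),
      setIntegral_const, smul_eq_mul, ha, mul_div_cancel₀ _ hvol, sub_self]
  have h2 := h ⟨_, hmem⟩
  have h3 : meanIncl ⟨_, hmem⟩ = q - a • femOne G m := rfl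
  rw [h3, map_sub, map_smul, transForm_femOne, smul_zero, sub_zero] at h2
  exact h2

/-- The pairing `(∇p, v)` of pressures and velocities. -/
noncomputable def presForm : meanZeroSpace G (k - 1) →ₗ[ℝ] velSpace G k →ₗ[ℝ] ℝ :=
  (transForm 1).flip ∘ₗ meanIncl

lemma presForm_apply (p : meanZeroSpace G (k - 1)) (v : velSpace G k) :
    presForm p v = transForm 1 v (meanIncl p) := rfl

lemma ipVec_grad_presForm (p : meanZeroSpace G (k - 1)) (v : velSpace G k) :
    ipVec G (grad p.1) v.1 = presForm p v := ipVec_grad_vel (meanIncl p) v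

lemma nodeBound_iff {φ : femSpace G k} :
    (∀ z ∈ G.nodes k, |φ.1 z| < 1) ↔ ∀ j : G.NodeIdx k, |nodeEval j φ| < 1 := by
  constructor
  · exact fun h j => h _ (RectGrid.mem_nodes_iff.mpr ⟨j, rfl⟩)
  · intro h z hz
    obtain ⟨j, rfl⟩ := RectGrid.mem_nodes_iff.mp hz
    exact h j

/-- A velocity-pressure system, with an incompressibility condition tested with all functions in
`Y_h^{k-1}`. -/
lemma existsUnique_velocity_pressure (hk : 1 ≤ k) (hG : 2 ≤ G.nx * G.ny)
    (D : velSpace G k →ₗ[ℝ] velSpace G k →ₗ[ℝ] ℝ) (hD : ∀ u, u ≠ 0 → 0 < D u u) {a : ℝ}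
    (ha : 0 < a) (R : velSpace G k →ₗ[ℝ] ℝ) :
    ∃! t : velSpace G k × meanZeroSpace G (k - 1),
      (∀ v, D t.1 v + a * presForm t.2 v = R v) ∧
      ∀ q : femSpace G (k - 1), transForm 1 t.1 q = 0 := by
  have h := existsUnique_saddle D hD (a • presForm) (fun p hp => by
    refine eq_zero_of_transForm_eq_zero hk hG p fun v => ?_
    have := hp v
    rw [LinearMap.smul_apply, LinearMap.smul_apply, smul_eq_mul] at this
    exact (mul_eq_zero.mp this).resolve_left ha.ne') R
  refine (existsUnique_congr fun t => and_congr Iff.rfl ?_).mp h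
  constructor
  · refine fun h => transForm_eq_zero_of_meanZero hk fun q => ?_
    have := h q
    rw [LinearMap.smul_apply, LinearMap.smul_apply, smul_eq_mul] at this
    exact (mul_eq_zero.mp this).resolve_left ha.ne'
  · intro h q
    rw [LinearMap.smul_apply, LinearMap.smul_apply, presForm_apply, h, smul_zero]

/-- The abstract system of `existsUnique_cahnHilliard` on a grid, with mobility `aM`. The space `X`
contains the velocities that are coupled to the phase variable: it is trivial in the first-order
step. -/
lemma existsUnique_phase (hk : 1 ≤ k) {X : Type*} [AddCommGroup X] [Module ℝ X]
    [FiniteDimensional ℝ X] {aM : G.bdd} (haM : ∀ᵐ z ∂G.vol, 0 < aM.1 z) {δ κ c : ℝ} (hδ : 0 < δ)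
    (hκ : 0 < κ) (hc : 0 < c) (C : X →ₗ[ℝ] femSpace G k →ₗ[ℝ] ℝ)
    (hC : ∀ u, C u (femOne G k) = 0) (D : X →ₗ[ℝ] X →ₗ[ℝ] ℝ) (hD : ∀ u, u ≠ 0 → 0 < D u u)
    (φ : femSpace G k)
    (hφ : |∑ j : G.NodeIdx k, G.wt j * φ.1 (G.pt j)| < ∑ j : G.NodeIdx k, G.wt j)
    (F H : femSpace G k →ₗ[ℝ] ℝ) (hF : F (femOne G k) = 0) (R : X →ₗ[ℝ] ℝ)
    (g : G.NodeIdx k → ℝ → ℝ) (hg : ∀ j, IsBarrier (g j)) :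
    ∃! t : femSpace G k × femSpace G k × X, (∀ z ∈ G.nodes k, |t.1.1 z| < 1) ∧
      (∀ v, nodalForm G.wt nodeEval (t.1 - φ) v + δ * gradForm aM t.2.1 v - C t.2.2 v = F v) ∧
      (∀ ψ, nodalForm G.wt nodeEval t.2.1 ψ =
        ∑ j, G.wt j * (g j (nodeEval j t.1) * nodeEval j ψ) + H ψ + κ * gradForm 1 t.1 ψ) ∧
      ∀ w, D t.2.2 w + c * C w t.2.1 = R w := by
  have hpos : ∀ {r : ℝ} {a : G.bdd}, 0 < r → (∀ᵐ z ∂G.vol, 0 < a.1 z) →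
      (∀ v : femSpace G k, 0 ≤ (r • gradForm a) v v) ∧
      ∀ v : femSpace G k, (r • gradForm a) v v = 0 → ∃ b : ℝ, v = b • femOne G k := by
    intro r a hr ha
    refine ⟨fun v => mul_nonneg hr.le (gradForm_self_nonneg (ha.mono fun _ h => h.le) v),
      fun v hv => exists_eq_smul_femOne ha ((mul_eq_zero.mp hv).resolve_left hr.ne')⟩
  have h1 : ∀ᵐ z ∂G.vol, 0 < (1 : G.bdd).1 z := ae_of_all _ fun _ => one_pos
  have h := existsUnique_cahnHilliard G.wt (G.wt_pos hk) nodeEval (femOne G k)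
    (nodeEval_femOne hk) (δ • gradForm aM) (κ • gradForm 1)
    (fun v => by simp [gradForm_femOne_right]) (fun v => by simp [gradForm_femOne_left])
    (hpos hδ haM).1 (hpos hδ haM).2
    (fun v => by simp [gradForm_femOne_right]) (fun v => by simp [gradForm_femOne_left])
    (hpos hκ h1).1 (hpos hκ h1).2 C hC D hD hc φ hφ F H hF R g hg
  refine (existsUnique_congr fun t => and_congr nodeBound_iff.symm ?_).mp h
  exact Iff.rfl

/-- The first-order step has exactly one solution that satisfies the bound at the nodes. -/
theorem existsUnique_firstOrderStep (hk : 1 ≤ k) (hG : 2 ≤ G.nx * G.ny) {δt : ℝ} (hδt : 0 < δt)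
    (φ₀ : femSpace G k) (u₀ : velSpace G k) (hφ₀ : ∀ᵐ z ∂G.vol, |φ₀.1 z| ≤ 1)
    (hmean : |∑ j : G.NodeIdx k, G.wt j * φ₀.1 (G.pt j)| < ∑ j : G.NodeIdx k, G.wt j) :
    ∃! t : femSpace G k × femSpace G k × velSpace G k × meanZeroSpace G (k - 1),
      FirstOrderStep P G k δt φ₀ u₀ t.1 t.2.1 t.2.2.1 t.2.2.2 ∧
        ∀ z ∈ G.nodes k, |t.1.1 z| < 1 := by
  have hI : ∀ᵐ z ∂G.vol, φ₀.1 z ∈ Icc (-1 : ℝ) 1 := hφ₀.mono fun z hz => abs_le.mp hz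
  set aM := mobility P φ₀.1 (aemeasurable_fem φ₀) hI with haM
  set aη := viscosity P φ₀.1 (aemeasurable_fem φ₀) hI with haη
  obtain ⟨⟨φ₁, μ₁, _⟩, ⟨hb, hphase, hchem, _⟩, huniq⟩ := existsUnique_phase (X := PUnit.{1}) hk
    (mobility_pos P (aemeasurable_fem φ₀) hI) hδt (pow_pos P.ε_pos 2) one_pos 0 (fun _ => rfl) 0
    (fun u hu => absurd (Subsingleton.elim u 0) hu) φ₀ hmean (δt • transForm (femBdd φ₀) u₀)
    ((-P.θc) • massForm 1 φ₀) (by simp [transForm_femOne]) 0 (fun _ => fv)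
    (fun _ => isBarrier_fv)
  set D : velSpace G k →ₗ[ℝ] velSpace G k →ₗ[ℝ] ℝ :=
    velForm + (δt / P.Re) • viscForm aη + δt • skewForm u₀ with hD
  have hDpos : ∀ u, u ≠ 0 → 0 < D u u := by
    intro u hu
    have h1 := velForm_self_pos hu
    have h2 := mul_nonneg (div_pos hδt P.Re_pos).le (viscForm_self_nonneg
      ((viscosity_pos P (aemeasurable_fem φ₀) hI).mono fun _ h => h.le) u)
    simp only [hD, LinearMap.add_apply, LinearMap.smul_apply, smul_eq_mul, skewForm_self, mul_zero,
      add_zero]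
    exact add_pos_of_pos_of_nonneg h1 h2
  obtain ⟨⟨u₁, p₁⟩, ⟨hmom, hdiv⟩, huniq'⟩ := existsUnique_velocity_pressure hk hG D hDpos hδt
    (velForm u₀ - (δt * (P.ε⁻¹ / P.We)) • (transForm (femBdd φ₀)).flip μ₁)
  have eqphase : ∀ φ₁ μ₁ : femSpace G k, (∀ v : femSpace G k, lumped G k (φ₁.1 - φ₀.1) v.1
      + δt * ipVec G (scal (fun z => P.M (φ₀.1 z)) (grad μ₁.1)) (grad v.1)
      - δt * ipVec G (scal φ₀.1 u₀.1) (grad v.1) = 0) ↔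
      ∀ v, nodalForm G.wt nodeEval (φ₁ - φ₀) v + δt * gradForm aM μ₁ v - 0
        = (δt • transForm (femBdd φ₀) u₀) v := by
    refine fun φ₁ μ₁ => forall_congr' fun v => ?_
    have e1 : lumped G k (φ₁.1 - φ₀.1) v.1 = nodalForm G.wt nodeEval (φ₁ - φ₀) v :=
      lumped_eq_nodalForm (φ₁ - φ₀) v
    have e2 := ipVec_scal_grad aM μ₁ v
    have e3 := ipVec_scal_vel (femBdd φ₀) u₀ v
    rw [e1, show ipVec G (scal (fun z => P.M (φ₀.1 z)) (grad μ₁.1)) (grad v.1) = _ from e2,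
      show ipVec G (scal φ₀.1 u₀.1) (grad v.1) = _ from e3, sub_eq_zero, sub_zero]
    rfl
  have eqchem : ∀ φ₁ μ₁ : femSpace G k, (∀ ψ : femSpace G k, lumped G k μ₁.1 ψ.1 =
      lumped G k (fun z => fv (φ₁.1 z)) ψ.1 + ip G (fun z => P.fn (φ₀.1 z)) ψ.1
        + P.ε ^ 2 * ipVec G (grad φ₁.1) (grad ψ.1)) ↔
      ∀ ψ, nodalForm G.wt nodeEval μ₁ ψ =
        ∑ j, G.wt j * (fv (nodeEval j φ₁) * nodeEval j ψ) + ((-P.θc) • massForm 1 φ₀) ψ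
          + P.ε ^ 2 * gradForm 1 φ₁ ψ := by
    refine fun φ₁ μ₁ => forall_congr' fun ψ => ?_
    rw [lumped_eq_nodalForm, lumped_eq_sum, ip_fn, ipVec_grad]
    rfl
  have eqmom : ∀ (μ₁ : femSpace G k) (u₁ : velSpace G k) (p₁ : meanZeroSpace G (k - 1)),
      (∀ v : velSpace G k, ipVec G (u₁.1 - u₀.1) v.1
        + δt / P.Re * ipGradVec G (fun z => P.η (φ₀.1 z)) u₁.1 v.1
        + δt * triForm G u₀.1 u₁.1 v.1 = -δt * ipVec G (grad p₁.1) v.1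
          - δt * (P.ε⁻¹ / P.We) * ipVec G (scal φ₀.1 (grad μ₁.1)) v.1) ↔
      ∀ v, D u₁ v + δt * presForm p₁ v
        = velForm u₀ v - δt * (P.ε⁻¹ / P.We) * transForm (femBdd φ₀) v μ₁ := by
    refine fun μ₁ u₁ p₁ => forall_congr' fun v => ?_
    have e1 : ipVec G (u₁.1 - u₀.1) v.1 = velForm (u₁ - u₀) v := ipVec_eq_velForm (u₁ - u₀) v
    have e2 : ipGradVec G (fun z => P.η (φ₀.1 z)) u₁.1 v.1 = viscForm aη u₁ v :=
      ipGradVec_eq aη u₁ v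
    have e3 : ipVec G (scal φ₀.1 (grad μ₁.1)) v.1 = transForm (femBdd φ₀) v μ₁ :=
      ipVec_scal_grad_vel (femBdd φ₀) μ₁ v
    rw [e1, e2, e3, triForm_eq, ipVec_grad_presForm]
    simp only [hD, map_sub, LinearMap.add_apply, LinearMap.sub_apply, LinearMap.smul_apply,
      smul_eq_mul]
    constructor <;> intro h <;> linarith
  have eqdiv : ∀ u₁ : velSpace G k, (∀ q : femSpace G (k - 1), ip G (divg u₁.1) q.1 = 0) ↔
      ∀ q : femSpace G (k - 1), transForm 1 u₁ q = 0 := by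
    refine fun u₁ => forall_congr' fun q => ?_
    rw [ip_divg, neg_eq_zero]
  refine ⟨(φ₁, μ₁, u₁, p₁), ⟨⟨(eqphase _ _).mpr hphase, (eqchem _ _).mpr hchem,
    (eqmom _ _ _).mpr hmom, (eqdiv _).mpr hdiv⟩, hb⟩, ?_⟩
  rintro ⟨φ₁', μ₁', u₁', p₁'⟩ ⟨hstep, hb'⟩
  have h1 := huniq (φ₁', μ₁', PUnit.unit) ⟨hb', (eqphase _ _).mp hstep.phase,
    (eqchem _ _).mp hstep.chem, fun _ => by simp⟩
  have hφ : φ₁' = φ₁ := congrArg Prod.fst h1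
  have hμ : μ₁' = μ₁ := congrArg (fun t => t.2.1) h1
  subst hφ hμ
  have h2 := huniq' (u₁', p₁') ⟨(eqmom _ _ _).mp hstep.momentum, (eqdiv _).mp hstep.incompressible⟩
  rw [h2]

/-- The equations of the second-order step in terms of the bilinear forms. -/
structure SecondOrderForms (P : Params) (G : RectGrid) (k : ℕ) (δt : ℝ) (φ φt : femSpace G k)
    (u ut : velSpace G k) (p : meanZeroSpace G (k - 1)) (φ₁ μ : femSpace G k)
    (ubar : velSpace G k) (p₁ : meanZeroSpace G (k - 1)) (u₁ : velSpace G k) : Prop where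
  phase : ∀ v, nodalForm G.wt nodeEval (φ₁ - φ) v + δt * gradForm (truncMobility P φt) μ v
    - δt * transForm (femBdd φt) ubar v = 0
  chem : ∀ ψ, nodalForm G.wt nodeEval μ ψ =
    ∑ j, G.wt j * ((quotFv (nodeEval j φ₁) (nodeEval j φ)
        + δt * (fv (nodeEval j φ₁) - fv (nodeEval j φ))) * nodeEval j ψ)
      + (-P.θc * massForm 1 φt ψ + P.ε ^ 2 / 2 * gradForm 1 φ ψ) + P.ε ^ 2 / 2 * gradForm 1 φ₁ ψ
  momentum : ∀ v, 2 * velForm ubar v + δt / P.Re * viscForm (truncViscosity P φt) ubar v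
    + δt * skewForm ut ubar v + P.ε⁻¹ / P.We * (δt * transForm (femBdd φt) v μ)
      = 2 * velForm u v - δt * presForm p v
  projection : ∀ v, velForm u₁ v + δt / 2 * presForm p₁ v
    = 2 * velForm ubar v - velForm u v + δt / 2 * presForm p v
  incompressible : ∀ q : femSpace G (k - 1), transForm 1 u₁ q = 0

lemma secondOrderStep_iff {δt : ℝ} {φ' φ : femSpace G k} {u' u : velSpace G k}
    {p : meanZeroSpace G (k - 1)} {φ₁ μ : femSpace G k} {ubar : velSpace G k}
    {p₁ : meanZeroSpace G (k - 1)} {u₁ : velSpace G k} :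
    SecondOrderStep P G k δt φ' φ u' u p φ₁ μ ubar p₁ u₁ ↔
      SecondOrderForms P G k δt φ (extrap φ' φ) u (extrap u' u) p φ₁ μ ubar p₁ u₁ := by
  set φt := extrap φ' φ with hφt
  set ut := extrap u' u with hut
  have hphase : ∀ v : femSpace G k, lumped G k (φ₁.1 - φ.1) v.1
      + δt * ipVec G (scal (fun z => P.M (trunc (φt.1 z))) (grad μ.1)) (grad v.1)
      - δt * ipVec G (scal φt.1 ubar.1) (grad v.1) =
      nodalForm G.wt nodeEval (φ₁ - φ) v + δt * gradForm (truncMobility P φt) μ v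
        - δt * transForm (femBdd φt) ubar v := by
    intro v
    have e1 : lumped G k (φ₁.1 - φ.1) v.1 = nodalForm G.wt nodeEval (φ₁ - φ) v :=
      lumped_eq_nodalForm (φ₁ - φ) v
    have e2 : ipVec G (scal (fun z => P.M (trunc (φt.1 z))) (grad μ.1)) (grad v.1) = _ :=
      ipVec_scal_grad (truncMobility P φt) μ v
    have e3 : ipVec G (scal φt.1 ubar.1) (grad v.1) = _ := ipVec_scal_vel (femBdd φt) ubar v
    rw [e1, e2, e3]
  have hchem : ∀ ψ : femSpace G k, lumped G k (fun z => quotFv (φ₁.1 z) (φ.1 z)) ψ.1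
        + ip G (fun z => P.fn (φt.1 z)) ψ.1
        + P.ε ^ 2 * ipVec G (grad ((1 / 2 : ℝ) • (φ₁ + φ)).1) (grad ψ.1)
        + δt * lumped G k (fun z => fv (φ₁.1 z) - fv (φ.1 z)) ψ.1 =
      ∑ j, G.wt j * ((quotFv (nodeEval j φ₁) (nodeEval j φ)
        + δt * (fv (nodeEval j φ₁) - fv (nodeEval j φ))) * nodeEval j ψ)
      + (-P.θc * massForm 1 φt ψ + P.ε ^ 2 / 2 * gradForm 1 φ ψ)
      + P.ε ^ 2 / 2 * gradForm 1 φ₁ ψ := by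
    intro ψ
    rw [lumped_eq_sum, lumped_eq_sum, ip_fn, ipVec_grad, map_smul, map_add, LinearMap.smul_apply,
      LinearMap.add_apply, smul_eq_mul]
    have e1 : ∑ j, G.wt j * ((quotFv (nodeEval j φ₁) (nodeEval j φ)
        + δt * (fv (nodeEval j φ₁) - fv (nodeEval j φ))) * nodeEval j ψ) =
        ∑ j : G.NodeIdx k, G.wt j * (quotFv (φ₁.1 (G.pt j)) (φ.1 (G.pt j)) * ψ.1 (G.pt j))
        + δt * ∑ j : G.NodeIdx k, G.wt j * ((fv (φ₁.1 (G.pt j)) - fv (φ.1 (G.pt j)))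
          * ψ.1 (G.pt j)) := by
      rw [Finset.mul_sum, ← Finset.sum_add_distrib]
      refine Finset.sum_congr rfl fun j _ => ?_
      simp only [nodeEval_apply]
      ring
    rw [e1]
    ring
  have hmom : ∀ v : velSpace G k, (ipVec G ((2 : ℝ) • ubar.1) v.1
      + δt / P.Re * ipGradVec G (fun z => P.η (trunc (φt.1 z))) ubar.1 v.1
      + δt * triForm G ut.1 ubar.1 v.1 =
    -δt * ipVec G (grad p.1) v.1 + ipVec G ((2 : ℝ) • u.1) v.1
      - δt * (P.ε⁻¹ / P.We) * ipVec G (scal φt.1 (grad μ.1)) v.1) ↔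
    2 * velForm ubar v + δt / P.Re * viscForm (truncViscosity P φt) ubar v
      + δt * skewForm ut ubar v + P.ε⁻¹ / P.We * (δt * transForm (femBdd φt) v μ)
        = 2 * velForm u v - δt * presForm p v := by
    intro v
    have e1 : ∀ w : velSpace G k, ipVec G ((2 : ℝ) • w.1) v.1 = 2 * velForm w v := fun w => by
      have := ipVec_eq_velForm ((2 : ℝ) • w) v
      rwa [map_smul] at this
    have e2 : ipGradVec G (fun z => P.η (trunc (φt.1 z))) ubar.1 v.1 = _ :=
      ipGradVec_eq (truncViscosity P φt) ubar v
    have e3 : ipVec G (scal φt.1 (grad μ.1)) v.1 = _ := ipVec_scal_grad_vel (femBdd φt) μ v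
    rw [e1, e1, e2, e3, triForm_eq, ipVec_grad_presForm]
    constructor <;> intro h <;> linarith
  have hproj : ∀ (v : velSpace G k) (q : femSpace G (k - 1)),
      ipVec G (u₁.1 - ((2 : ℝ) • ubar.1 - u.1)) v.1
      + δt / 2 * ipVec G (grad (p₁ - p).1) v.1 + ip G (divg u₁.1) q.1 =
      (velForm u₁ v + δt / 2 * presForm p₁ v
        - (2 * velForm ubar v - velForm u v + δt / 2 * presForm p v)) - transForm 1 u₁ q := by
    intro v q
    have e1 : ipVec G (u₁.1 - ((2 : ℝ) • ubar.1 - u.1)) v.1 = _ :=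
      ipVec_eq_velForm (u₁ - ((2 : ℝ) • ubar - u)) v
    rw [e1, ip_divg, ipVec_grad_presForm]
    simp only [map_sub, map_smul, LinearMap.sub_apply, LinearMap.smul_apply, smul_eq_mul]
    ring
  constructor
  · rintro ⟨h1, h2, h3, h4⟩
    refine ⟨fun v => (hphase v).symm.trans (h1 v), fun ψ => ?_, fun v => (hmom v).mp (h3 v),
      fun v => ?_, fun q => ?_⟩
    · rw [← hchem, ← h2, lumped_eq_nodalForm]
    · have := (hproj v 0).symm.trans (h4 v 0)
      rw [map_zero, sub_zero] at this
      linarith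
    · have := (hproj 0 q).symm.trans (h4 0 q)
      simpa using this
  · rintro ⟨h1, h2, h3, h4, h5⟩
    refine ⟨fun v => (hphase v).trans (h1 v), fun ψ => ?_, fun v => (hmom v).mpr (h3 v),
      fun v q => (hproj v q).trans ?_⟩
    · rw [lumped_eq_nodalForm, h2]
      exact (hchem ψ).symm
    · rw [h4, h5]; ring

lemma abs_sum_wt_lt (hk : 1 ≤ k) {φ : femSpace G k} (hφ : ∀ z ∈ G.nodes k, |φ.1 z| < 1) :
    |∑ j : G.NodeIdx k, G.wt j * φ.1 (G.pt j)| < ∑ j : G.NodeIdx k, G.wt j := by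
  refine (Finset.abs_sum_le_sum_abs _ _).trans_lt
    (Finset.sum_lt_sum_of_nonempty Finset.univ_nonempty fun j _ => ?_)
  rw [abs_mul, abs_of_pos (G.wt_pos hk j)]
  exact mul_lt_of_lt_one_right (G.wt_pos hk j) (nodeBound_iff.mp hφ j)

/-- The second-order step has exactly one solution that satisfies the bound at the nodes. -/
theorem existsUnique_secondOrderStep (hk : 1 ≤ k) (hG : 2 ≤ G.nx * G.ny) {δt : ℝ} (hδt : 0 < δt)
    (φ' φ : femSpace G k) (u' u : velSpace G k) (p : meanZeroSpace G (k - 1))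
    (hφ : ∀ z ∈ G.nodes k, |φ.1 z| < 1) :
    ∃! t : femSpace G k × femSpace G k × velSpace G k × meanZeroSpace G (k - 1) × velSpace G k,
      SecondOrderStep P G k δt φ' φ u' u p t.1 t.2.1 t.2.2.1 t.2.2.2.1 t.2.2.2.2 ∧
        ∀ z ∈ G.nodes k, |t.1.1 z| < 1 := by
  simp only [secondOrderStep_iff]
  set φt := extrap φ' φ with hφt
  set ut := extrap u' u with hut
  set D : velSpace G k →ₗ[ℝ] velSpace G k →ₗ[ℝ] ℝ :=
    (2 : ℝ) • velForm + (δt / P.Re) • viscForm (truncViscosity P φt) + δt • skewForm ut with hD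
  have hDpos : ∀ u, u ≠ 0 → 0 < D u u := by
    intro u hu
    have h1 := velForm_self_pos hu
    have h2 := mul_nonneg (div_pos hδt P.Re_pos).le (viscForm_self_nonneg
      ((viscosity_pos P (measurable_trunc.comp_aemeasurable (aemeasurable_fem φt))
        (ae_of_all _ fun _ => trunc_mem _)).mono fun _ h => h.le) u)
    simp only [hD, LinearMap.add_apply, LinearMap.smul_apply, smul_eq_mul, skewForm_self, mul_zero,
      add_zero]
    exact add_pos_of_pos_of_nonneg (by linarith) h2
  obtain ⟨⟨φ₁, μ, ubar⟩, ⟨hb, hphase, hchem, hmom⟩, huniq⟩ := existsUnique_phase hk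
    (mobility_pos P (measurable_trunc.comp_aemeasurable (aemeasurable_fem φt))
      (ae_of_all _ fun _ => trunc_mem _)) hδt (half_pos (pow_pos P.ε_pos 2))
    (div_pos (inv_pos.mpr P.ε_pos) P.We_pos) (δt • transForm (femBdd φt))
    (fun u => by simp [transForm_femOne]) D hDpos φ (abs_sum_wt_lt hk hφ) 0
    ((-P.θc) • massForm 1 φt + (P.ε ^ 2 / 2) • gradForm 1 φ) rfl
    ((2 : ℝ) • velForm u - δt • presForm p)
    (fun j s => quotFv s (nodeEval j φ) + δt * (fv s - fv (nodeEval j φ)))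
    (fun j => isBarrier_quotFv hδt (nodeBound_iff.mp hφ j))
  obtain ⟨⟨u₁, p₁⟩, ⟨hproj, hdiv⟩, huniq'⟩ := existsUnique_velocity_pressure hk hG velForm
    (fun _ => velForm_self_pos) (half_pos hδt)
    ((2 : ℝ) • velForm ubar - velForm u + (δt / 2) • presForm p)
  refine ⟨(φ₁, μ, ubar, p₁, u₁), ⟨⟨hphase, hchem, hmom, hproj, hdiv⟩, hb⟩, ?_⟩
  rintro ⟨φ₁', μ', ubar', p₁', u₁'⟩ ⟨⟨h1, h2, h3, h4, h5⟩, hb'⟩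
  have e1 := huniq (φ₁', μ', ubar') ⟨hb', h1, h2, h3⟩
  simp only [Prod.mk.injEq] at e1
  obtain ⟨rfl, rfl, rfl⟩ := e1
  have e2 := huniq' (u₁', p₁') ⟨h4, h5⟩
  simp only [Prod.mk.injEq] at e2
  obtain ⟨rfl, rfl⟩ := e2
  rfl

end Steps

/-! ### The energy law -/

section Energy

variable {G : RectGrid} {k : ℕ} {P : Params}

lemma massForm_one_comm (p q : femSpace G k) : massForm 1 p q = massForm 1 q p := by
  rw [← ip_eq_massForm, ip_comm, ip_eq_massForm]

lemma gradForm_one_comm (p q : femSpace G k) : gradForm 1 p q = gradForm 1 q p := by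
  rw [← ipVec_grad, ipVec_comm, ipVec_grad]

lemma massForm_one_self_nonneg (p : femSpace G k) : 0 ≤ massForm 1 p p := by
  rw [← ip_eq_massForm]
  exact ip_self_nonneg G p.1

/-- The part of the energy that depends on the phase variable, without the factor
`1 / (ε We)`; `φ'` is the phase variable at the previous time level. -/
noncomputable def phaseEnergy (P : Params) (φ' φ : femSpace G k) : ℝ :=
  ∑ j : G.NodeIdx k, G.wt j * Fv (nodeEval j φ) - P.θc / 2 * massForm 1 φ φ
    + P.ε ^ 2 / 2 * gradForm 1 φ φ + P.θc / 4 * massForm 1 (φ - φ') (φ - φ')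

lemma Trajectory.energy_eq (S : Trajectory G k) (P : Params) (δt : ℝ) (n : ℕ) :
    S.energy P δt n = P.ε⁻¹ / P.We * phaseEnergy P (S.φ (n - 1)) (S.φ n)
      + 1 / 2 * velForm (S.u n) (S.u n)
      + δt ^ 2 / 8 * velForm (discreteGrad G k (S.p n)) (discreteGrad G k (S.p n)) := by
  have e1 : lumped G k (fun z => Fv ((S.φ n).1 z)) (fun _ => 1)
      = ∑ j : G.NodeIdx k, G.wt j * Fv (nodeEval j (S.φ n)) := by
    rw [lumped_eq_sum]
    simp only [mul_one, nodeEval_apply]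
  have e2 : ip G (fun z => P.Fn ((S.φ n).1 z)) (fun _ => 1)
      = -(P.θc / 2) * massForm 1 (S.φ n) (S.φ n) := by
    rw [← ip_eq_massForm, ip, ip, ← integral_const_mul]
    refine integral_congr_ae (ae_of_all _ fun z => ?_)
    simp only [Params.Fn]
    ring
  rw [Trajectory.energy, e1, e2, ipVec_grad, ip_eq_massForm, ipVec_eq_velForm, ipVec_eq_velForm,
    phaseEnergy, one_div, mul_inv, ← div_eq_mul_inv]
  ring

lemma Trajectory.dissipation_eq (S : Trajectory G k) (P : Params) (δt : ℝ) (n : ℕ) :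
    S.dissipation P δt n =
      P.ε⁻¹ / P.We * (δt * gradForm (truncMobility P (extrap (S.φ (n - 1)) (S.φ n))) (S.μ n)
        (S.μ n))
      + δt / P.Re * viscForm (truncViscosity P (extrap (S.φ (n - 1)) (S.φ n))) (S.ubar n)
        (S.ubar n) := by
  set φt := extrap (S.φ (n - 1)) (S.φ n) with hφt
  have e1 : ∀ g : (ℝ × ℝ → ℝ) × (ℝ × ℝ → ℝ),
      ipVec G (scal (fun z => Real.sqrt (P.M (trunc (φt.1 z)))) g)
        (scal (fun z => Real.sqrt (P.M (trunc (φt.1 z)))) g)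
      = ipVec G (scal (fun z => P.M (trunc (φt.1 z))) g) g := by
    intro g
    have h : ∀ f : ℝ × ℝ → ℝ, ip G (fun z => Real.sqrt (P.M (trunc (φt.1 z))) * f z)
        (fun z => Real.sqrt (P.M (trunc (φt.1 z))) * f z)
        = ip G (fun z => P.M (trunc (φt.1 z)) * f z) f := by
      intro f
      refine integral_congr_ae (ae_of_all _ fun z => ?_)
      have := Real.mul_self_sqrt (P.M_pos (trunc_mem (φt.1 z))).le
      linear_combination f z ^ 2 * this
    exact congrArg₂ (· + ·) (h g.1) (h g.2)
  have e2 : ipVec G (scal (fun z => P.M (trunc (φt.1 z))) (grad (S.μ n).1)) (grad (S.μ n).1) = _ :=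
    ipVec_scal_grad (truncMobility P φt) (S.μ n) (S.μ n)
  have e3 : ipGradVec G (fun z => P.η (trunc (φt.1 z))) (S.ubar n).1 (S.ubar n).1 = _ :=
    ipGradVec_eq (truncViscosity P φt) (S.ubar n) (S.ubar n)
  have e4 : δt / (P.ε * P.We) = P.ε⁻¹ / P.We * δt := by
    rw [div_eq_mul_inv, mul_inv]; ring
  rw [Trajectory.dissipation]
  simp only [← hφt]
  rw [e1, e2, e3, e4, mul_assoc]

lemma velForm_discreteGrad (v : velSpace G k) (p : meanZeroSpace G (k - 1)) :
    velForm v (discreteGrad G k p) = presForm p v := by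
  rw [← ipVec_eq_velForm, discreteGrad_spec, ipVec_comm, ipVec_grad_presForm]

/-- The chemical potential, tested with the increment of the phase variable, controls the increment
of the energy: the convex part of the potential contributes its exact increment, the regularizing
term is nonnegative since `f_v` is monotone, and the extrapolation error of the concave part is
absorbed by the last term of the energy. -/
lemma phaseEnergy_sub_le (hk : 1 ≤ k) {δt : ℝ} (hδt : 0 < δt) {φ' φ φ₁ μ : femSpace G k}
    (hφ : ∀ z ∈ G.nodes k, |φ.1 z| < 1) (hφ₁ : ∀ z ∈ G.nodes k, |φ₁.1 z| < 1)
    (hchem : nodalForm G.wt nodeEval μ (φ₁ - φ) =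
      ∑ j, G.wt j * ((quotFv (nodeEval j φ₁) (nodeEval j φ)
          + δt * (fv (nodeEval j φ₁) - fv (nodeEval j φ))) * nodeEval j (φ₁ - φ))
        + (-P.θc * massForm 1 (extrap φ' φ) (φ₁ - φ) + P.ε ^ 2 / 2 * gradForm 1 φ (φ₁ - φ))
        + P.ε ^ 2 / 2 * gradForm 1 φ₁ (φ₁ - φ)) :
    phaseEnergy P φ φ₁ - phaseEnergy P φ' φ ≤ nodalForm G.wt nodeEval (φ₁ - φ) μ := by
  have hsymm : nodalForm G.wt nodeEval (φ₁ - φ) μ = nodalForm G.wt nodeEval μ (φ₁ - φ) := by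
    simp only [nodalForm_apply, mul_comm (nodeEval _ (φ₁ - φ))]
  have hconv : ∑ j : G.NodeIdx k, G.wt j * Fv (nodeEval j φ₁)
      - ∑ j : G.NodeIdx k, G.wt j * Fv (nodeEval j φ)
      ≤ ∑ j, G.wt j * ((quotFv (nodeEval j φ₁) (nodeEval j φ)
          + δt * (fv (nodeEval j φ₁) - fv (nodeEval j φ))) * nodeEval j (φ₁ - φ)) := by
    rw [← Finset.sum_sub_distrib]
    refine Finset.sum_le_sum fun j _ => ?_
    rw [← mul_sub]
    refine mul_le_mul_of_nonneg_left ?_ (G.wt_pos hk j).le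
    have h1 := quotFv_mul_sub (nodeEval j φ₁) (nodeEval j φ)
    have h2 : 0 ≤ (fv (nodeEval j φ₁) - fv (nodeEval j φ)) * (nodeEval j φ₁ - nodeEval j φ) := by
      have m1 := abs_lt.mp (nodeBound_iff.mp hφ₁ j)
      have m := abs_lt.mp (nodeBound_iff.mp hφ j)
      rcases le_total (nodeEval j φ) (nodeEval j φ₁) with h | h
      · exact mul_nonneg (sub_nonneg.mpr (fv_monotoneOn m m1 h)) (sub_nonneg.mpr h)
      · exact mul_nonneg_of_nonpos_of_nonpos (sub_nonpos.mpr (fv_monotoneOn m1 m h))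
          (sub_nonpos.mpr h)
    rw [map_sub]
    nlinarith [mul_nonneg hδt.le h2]
  -- With `d = φ₁ - φ` and `e = φ - φ'`, the extrapolation error is half of `(d - e, d)`.
  have hmass := massForm_one_self_nonneg ((φ₁ - φ) - (φ - φ'))
  have hθ : 0 < P.θc := one_pos.trans P.one_lt_θc
  have hmass' := mul_nonneg hθ.le hmass
  rw [hsymm, hchem]
  simp only [phaseEnergy, extrap, map_sub, map_smul, LinearMap.sub_apply, LinearMap.smul_apply,
    smul_eq_mul] at hmass' hconv ⊢
  rw [gradForm_one_comm φ φ₁]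
  rw [massForm_one_comm φ φ₁, massForm_one_comm φ' φ₁, massForm_one_comm φ' φ] at *
  linarith

/-- The projection step and the pressure terms of the momentum equation combine to an exact
increment, since velocities are orthogonal to discrete pressure gradients. -/
lemma SecondOrderForms.kinetic_identity {δt : ℝ} {φ φt φ₁ μ : femSpace G k}
    {u ut ubar u₁ : velSpace G k} {p p₁ : meanZeroSpace G (k - 1)}
    (h : SecondOrderForms P G k δt φ φt u ut p φ₁ μ ubar p₁ u₁)
    (hu : ∀ q : femSpace G (k - 1), transForm 1 u q = 0) :
    2 * velForm ubar ubar - 2 * velForm u ubar + δt * presForm p ubar =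
      1 / 2 * (velForm u₁ u₁ - velForm u u)
      + δt ^ 2 / 8 * (velForm (discreteGrad G k p₁) (discreteGrad G k p₁)
        - velForm (discreteGrad G k p) (discreteGrad G k p)) := by
  set g := discreteGrad G k p with hg
  set g₁ := discreteGrad G k p₁ with hg₁
  have hubar : (2 : ℝ) • ubar = u₁ + u + (δt / 2) • (g₁ - g) := by
    rw [← sub_eq_zero]
    by_contra hne
    have hpos := velForm_self_pos hne
    set z := (2 : ℝ) • ubar - (u₁ + u + (δt / 2) • (g₁ - g)) with hz
    have h1 := h.projection z
    rw [← velForm_discreteGrad, ← velForm_discreteGrad, ← hg, ← hg₁, velForm_comm z,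
      velForm_comm z] at h1
    have h2 : ∀ w, velForm z w = 2 * velForm ubar w - (velForm u₁ w + velForm u w
        + δt / 2 * (velForm g₁ w - velForm g w)) := fun w => by
      simp only [hz, map_sub, map_add, map_smul, LinearMap.sub_apply, LinearMap.add_apply,
        LinearMap.smul_apply, smul_eq_mul]
    have h3 := h2 z
    linarith
  have horth : ∀ (w : velSpace G k) (q : meanZeroSpace G (k - 1)),
      (∀ r : femSpace G (k - 1), transForm 1 w r = 0) → velForm w (discreteGrad G k q) = 0 := by
    intro w q hw
    rw [velForm_discreteGrad, presForm_apply, hw]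
  have o1 := horth u p hu
  have o2 := horth u p₁ hu
  have o3 := horth u₁ p h.incompressible
  have o4 := horth u₁ p₁ h.incompressible
  rw [← hg] at o1 o3
  rw [← hg₁] at o2 o4
  rw [← velForm_discreteGrad, ← hg]
  have hb : ubar = (1 / 2 : ℝ) • (u₁ + u + (δt / 2) • (g₁ - g)) := by
    rw [← hubar, smul_smul]; norm_num
  rw [hb]
  simp only [map_sub, map_add, map_smul, LinearMap.sub_apply, LinearMap.add_apply,
    LinearMap.smul_apply, smul_eq_mul]
  rw [velForm_comm g u, velForm_comm g u₁, velForm_comm g₁ u, velForm_comm g₁ u₁, velForm_comm u u₁,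
    velForm_comm g₁ g, o1, o2, o3, o4]
  ring

/-- Every solution that satisfies the bound at the nodes obeys the energy law. -/
theorem Trajectory.Solves.energy_le (hk : 1 ≤ k) {δt : ℝ} (hδt : 0 < δt) {N : ℕ}
    {φ₀ : femSpace G k} {u₀ : velSpace G k} {S : Trajectory G k} (hS : S.Solves P δt N φ₀ u₀)
    (hB : S.BoundPreserving N) {n : ℕ} (hn : 1 ≤ n) (hnN : n + 1 ≤ N) :
    S.energy P δt (n + 1) + S.dissipation P δt n ≤ S.energy P δt n := by
  have h := (secondOrderStep_iff P).mp (hS.second n hn hnN)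
  have hu : ∀ q : femSpace G (k - 1), transForm 1 (S.u n) q = 0 := by
    obtain ⟨m, rfl⟩ := Nat.exists_eq_add_of_le' hn
    rcases Nat.eq_zero_or_pos m with rfl | hm
    · intro q
      have := (hS.first (by omega)).incompressible q
      rwa [ip_divg, neg_eq_zero] at this
    · exact ((secondOrderStep_iff P).mp (hS.second m hm (by omega))).incompressible
  have hphase := h.phase (S.μ n)
  have hpot := phaseEnergy_sub_le (P := P) hk hδt (hB n hn (by omega)) (hB (n + 1) (by omega) hnN)
    (h.chem (S.φ (n + 1) - S.φ n))
  have hmom := h.momentum (S.ubar n)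
  rw [skewForm_self, mul_zero, add_zero] at hmom
  have hkin := h.kinetic_identity hu
  have hc : 0 < P.ε⁻¹ / P.We := div_pos (inv_pos.mpr P.ε_pos) P.We_pos
  have hpot' := mul_le_mul_of_nonneg_left hpot hc.le
  have hphase' := congrArg (P.ε⁻¹ / P.We * ·) hphase
  simp only [mul_zero] at hphase'
  rw [Trajectory.energy_eq, Trajectory.energy_eq, Trajectory.dissipation_eq, Nat.add_sub_cancel]
  linarith

end Energy

/-! ### Existence and uniqueness of the trajectory -/

section Trajectory

variable {G : RectGrid} {k : ℕ} {P : Params}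

/-- The data carried from one time level to the next: `φⁿ⁻¹`, `uⁿ⁻¹`, `pⁿ`, `uⁿ`, the latest
chemical potential and intermediate velocity, and `φⁿ`, which satisfies the bound at the nodes. -/
structure TimeLevel (G : RectGrid) (k : ℕ) where
  φ' : femSpace G k
  u' : velSpace G k
  φ : femSpace G k
  μ : femSpace G k
  ubar : velSpace G k
  p : meanZeroSpace G (k - 1)
  u : velSpace G k
  bound : ∀ z ∈ G.nodes k, |φ.1 z| < 1

/-- `t` arises from `s` by a second-order step. -/
structure TimeLevel.Step (P : Params) (δt : ℝ) (s t : TimeLevel G k) : Prop where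
  prev_φ : t.φ' = s.φ
  prev_u : t.u' = s.u
  step : SecondOrderStep P G k δt s.φ' s.φ s.u' s.u s.p t.φ t.μ t.ubar t.p t.u

lemma TimeLevel.exists_step (P : Params) (hk : 1 ≤ k) (hG : 2 ≤ G.nx * G.ny) {δt : ℝ}
    (hδt : 0 < δt) (s : TimeLevel G k) : ∃ t, s.Step P δt t := by
  obtain ⟨⟨φ₁, μ, ubar, p₁, u₁⟩, ⟨hstep, hb⟩, -⟩ :=
    existsUnique_secondOrderStep P hk hG hδt s.φ' s.φ s.u' s.u s.p s.bound
  exact ⟨⟨s.φ, s.u, φ₁, μ, ubar, p₁, u₁, hb⟩, ⟨rfl, rfl, hstep⟩⟩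

theorem exists_trajectory (hk : 1 ≤ k) (hG : 2 ≤ G.nx * G.ny) {δt : ℝ} (hδt : 0 < δt) (N : ℕ)
    (φ₀ : femSpace G k) (u₀ : velSpace G k) (hφ₀ : ∀ᵐ z ∂G.vol, |φ₀.1 z| ≤ 1)
    (hmean : |∑ j : G.NodeIdx k, G.wt j * φ₀.1 (G.pt j)| < ∑ j : G.NodeIdx k, G.wt j) :
    ∃ S : Trajectory G k, S.Solves P δt N φ₀ u₀ ∧ S.BoundPreserving N := by
  obtain ⟨⟨φ₁, μ₁, u₁, p₁⟩, ⟨hfirst, hb⟩, -⟩ :=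
    existsUnique_firstOrderStep P hk hG hδt φ₀ u₀ hφ₀ hmean
  choose next hnext using TimeLevel.exists_step (G := G) (k := k) P hk hG hδt
  -- `L n` holds the quantities of time level `n + 1`.
  set L : ℕ → TimeLevel G k := fun n => next^[n] ⟨φ₀, u₀, φ₁, μ₁, 0, p₁, u₁, hb⟩ with hL
  have hstep : ∀ n, (L n).Step P δt (L (n + 1)) := fun n => by
    have : L (n + 1) = next (L n) := Function.iterate_succ_apply' _ _ _
    rw [this]
    exact hnext _
  set φ : ℕ → femSpace G k := fun n => n.casesOn φ₀ fun m => (L m).φ with hφ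
  set u : ℕ → velSpace G k := fun n => n.casesOn u₀ fun m => (L m).u with hu
  have hprev : ∀ n, (L n).φ' = φ n ∧ (L n).u' = u n := by
    rintro (_ | n)
    · exact ⟨rfl, rfl⟩
    · exact ⟨(hstep n).prev_φ, (hstep n).prev_u⟩
  refine ⟨⟨φ, fun n => (L n).μ, fun n => (L n).ubar, fun n => (L (n - 1)).p, u⟩,
    ⟨rfl, rfl, fun _ => hfirst, ?_⟩, ?_⟩
  · intro n hn _
    obtain ⟨m, rfl⟩ := Nat.exists_eq_add_of_le' hn
    have := (hstep m).step
    rw [(hprev m).1, (hprev m).2] at this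
    exact this
  · intro n hn _
    obtain ⟨m, rfl⟩ := Nat.exists_eq_add_of_le' hn
    exact (L m).bound

theorem Trajectory.Solves.agreeUpTo (hk : 1 ≤ k) (hG : 2 ≤ G.nx * G.ny) {δt : ℝ} (hδt : 0 < δt)
    {N : ℕ} {φ₀ : femSpace G k} {u₀ : velSpace G k} (hφ₀ : ∀ᵐ z ∂G.vol, |φ₀.1 z| ≤ 1)
    (hmean : |∑ j : G.NodeIdx k, G.wt j * φ₀.1 (G.pt j)| < ∑ j : G.NodeIdx k, G.wt j)
    {S S' : Trajectory G k} (hS : S.Solves P δt N φ₀ u₀) (hB : S.BoundPreserving N)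
    (hS' : S'.Solves P δt N φ₀ u₀) (hB' : S'.BoundPreserving N) : S'.AgreeUpTo S N := by
  have first : 1 ≤ N → S'.φ 1 = S.φ 1 ∧ S'.μ 0 = S.μ 0 ∧ S'.u 1 = S.u 1 ∧ S'.p 1 = S.p 1 := by
    intro hN
    have h := hS.first hN
    have h' := hS'.first hN
    rw [hS.init_φ, hS.init_u] at h
    rw [hS'.init_φ, hS'.init_u] at h'
    have := (existsUnique_firstOrderStep P hk hG hδt φ₀ u₀ hφ₀ hmean).unique
      (y₁ := (S'.φ 1, S'.μ 0, S'.u 1, S'.p 1)) (y₂ := (S.φ 1, S.μ 0, S.u 1, S.p 1))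
      ⟨h', hB' 1 le_rfl hN⟩ ⟨h, hB 1 le_rfl hN⟩
    simpa only [Prod.mk.injEq] using this
  have second : ∀ n, 1 ≤ n → n + 1 ≤ N → S'.φ (n - 1) = S.φ (n - 1) → S'.φ n = S.φ n →
      S'.u (n - 1) = S.u (n - 1) → S'.u n = S.u n → S'.p n = S.p n →
      S'.φ (n + 1) = S.φ (n + 1) ∧ S'.μ n = S.μ n ∧ S'.ubar n = S.ubar n ∧
        S'.p (n + 1) = S.p (n + 1) ∧ S'.u (n + 1) = S.u (n + 1) := by
    intro n hn hnN e1 e2 e3 e4 e5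
    have h := hS.second n hn hnN
    have h' := hS'.second n hn hnN
    rw [e1, e2, e3, e4, e5] at h'
    have := (existsUnique_secondOrderStep P hk hG hδt _ _ _ _ _ (hB n hn (by omega))).unique
      (y₁ := (S'.φ (n + 1), S'.μ n, S'.ubar n, S'.p (n + 1), S'.u (n + 1)))
      (y₂ := (S.φ (n + 1), S.μ n, S.ubar n, S.p (n + 1), S.u (n + 1)))
      ⟨h', hB' (n + 1) (by omega) hnN⟩ ⟨h, hB (n + 1) (by omega) hnN⟩
    simpa only [Prod.mk.injEq] using this
  have levels : ∀ n, n + 1 ≤ N → S'.φ n = S.φ n ∧ S'.u n = S.u n ∧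
      S'.φ (n + 1) = S.φ (n + 1) ∧ S'.u (n + 1) = S.u (n + 1) ∧ S'.p (n + 1) = S.p (n + 1) := by
    intro n
    induction n with
    | zero =>
      intro hN
      obtain ⟨h1, -, h2, h3⟩ := first hN
      exact ⟨hS'.init_φ.trans hS.init_φ.symm, hS'.init_u.trans hS.init_u.symm, h1, h2, h3⟩
    | succ n ih =>
      intro hN
      obtain ⟨h1, h2, h3, h4, h5⟩ := ih (by omega)
      obtain ⟨g1, -, -, g2, g3⟩ := second (n + 1) (by omega) hN h1 h3 h2 h4 h5
      exact ⟨h3, h4, g1, g3, g2⟩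
  have hmid : ∀ n, 1 ≤ n → n + 1 ≤ N → S'.μ n = S.μ n ∧ S'.ubar n = S.ubar n := by
    intro n hn hN
    obtain ⟨m, rfl⟩ := Nat.exists_eq_add_of_le' hn
    obtain ⟨h1, h2, h3, h4, h5⟩ := levels m (by omega)
    obtain ⟨-, g1, g2, -, -⟩ := second (m + 1) hn hN h1 h3 h2 h4 h5
    exact ⟨g1, g2⟩
  refine ⟨?_, ?_, ?_, ?_, fun n hn hN => (hmid n hn hN).2⟩
  · rintro (_ | n) hn
    · exact hS'.init_φ.trans hS.init_φ.symm
    · exact (levels n hn).2.2.1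
  · rintro (_ | n) hn
    · exact hS'.init_u.trans hS.init_u.symm
    · exact (levels n hn).2.2.2.1
  · rintro (_ | n) hn hN
    · omega
    · exact (levels n hN).2.2.2.2
  · rintro (_ | n) hN
    · exact (first hN).2.1
    · exact (hmid _ (by omega) hN).1

end Trajectory

end CHNS

theorem mainTheorem1 (P : CHNS.Params) (G : CHNS.RectGrid) (hG : 2 ≤ G.nx * G.ny)
    (k : ℕ) (hk : 1 ≤ k) (T δt : ℝ) (hT : 0 < T) (hδt : 0 < δt)
    (N : ℕ) (hN : N = ⌊T / δt⌋₊)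
    (φ₀ : CHNS.femSpace G k) (u₀ : CHNS.velSpace G k)
    (hφ₀ : ∀ᵐ z ∂(MeasureTheory.volume.restrict G.dom), |φ₀.1 z| ≤ 1)
    (hmean : (∫ z in G.dom, φ₀.1 z) / (MeasureTheory.volume G.dom).toReal ∈
      Set.Ioo (-1 : ℝ) 1) :
    (∃ S : CHNS.Trajectory G k, S.Solves P δt N φ₀ u₀ ∧ S.BoundPreserving N ∧
      ∀ S' : CHNS.Trajectory G k, S'.Solves P δt N φ₀ u₀ → S'.BoundPreserving N →
        S'.AgreeUpTo S N) ∧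
    ∀ S : CHNS.Trajectory G k, S.Solves P δt N φ₀ u₀ → S.BoundPreserving N →
      ∀ n, 1 ≤ n → n + 1 ≤ N →
        S.energy P δt (n + 1) + S.dissipation P δt n ≤ S.energy P δt n := by
  -- The quadrature is exact on `Y_h^k`, so the condition on the mean value is one on the nodes.
  have hm : |∑ j : G.NodeIdx k, G.wt j * φ₀.1 (G.pt j)| < ∑ j : G.NodeIdx k, G.wt j := by
    have hpos : 0 < ∑ j : G.NodeIdx k, G.wt j :=
      Finset.sum_pos (fun j _ => G.wt_pos hk j) Finset.univ_nonempty
    rw [CHNS.integral_eq_sum_wt hk, CHNS.volume_dom_toReal hk] at hmean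
    have := abs_lt.mpr hmean
    rwa [abs_div, abs_of_pos hpos, div_lt_one hpos] at this
  refine ⟨?_, fun S hS hB n hn hnN => hS.energy_le hk hδt hB hn hnN⟩
  obtain ⟨S, hS, hB⟩ := CHNS.exists_trajectory (P := P) hk hG hδt N φ₀ u₀ hφ₀ hm
  exact ⟨S, hS, hB, fun S' hS' hB' => hS.agreeUpTo hk hG hδt hφ₀ hm hB hS' hB'⟩
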